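/- **Setting.** Let $V$ be a complex vector space of finite dimension $n$, let $G\subset GL(V)$ be a finite group, and let $\pi:V\to Z=V/G$ be the quotient map. A function on an open set $W\subset Z$ is called holomorphic if its composition with $\pi$ is holomorphic on $\pi^{-1}(W)$. Let $Z_i=\pi(\{v\in V:\dim V-\dim V^{G_v}\le i\})$ be the union of the isotropy type strata of codimension at most $i$; here $G_v$ is the isotropy group of $v$. The space $Z_1$ with the above holomorphic functions is a complex manifold, and $\pi$ is étale over the principal stratum $Z_0$. A meromorphic $\binom pq$-tensor field on an open subset of $Z_1$ is a tensor field with $p$ contravariant and $q$ covariant indices whose coefficients in local holomorphic coordinates $y^1,\dots,y^n$ are meromorphic functions. If $P$ is a $G$-invariant holomorphic tensor field on a $G$-stable open set $U\subset V$, then $\pi_*P$ denotes the meromorphic tensor field on $Z_1\cap\pi(U)$ such that $\pi^*\pi_*P=P$. **Divisors.** A hyperplane $H\subset V$ is a reflection hyperplane if some $g\in G$, $g\ne1$, fixes it pointwise, and $e_H$ is the order of the group of all $g\in G$ that fix $H$ pointwise. The reflection divisor is $D=\sum_S e_S\,S$, where $S$ runs over the hypersurfaces $\pi(H)$, $H$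 a reflection hyperplane, and $e_{\pi(H)}=e_H$. A divisor is described by its coefficients along the germs $S$ of smooth hypersurfaces (which determine it, since every irreducible hypersurface is smooth at a dense set of points). Let $Q$ be a meromorphic tensor field on an open subset of $Z_1$, and choose local holomorphic coordinates in which $S=\{y^k=0\}$ near $z\in S$. For a coefficient $Q^{i_1\dots i_p}_{j_1\dots j_q}\neq0$ of $Q$ let $m\in\mathbb Z$ be its order along $S$, i.e. $Q^{i_1\dots i_p}_{j_1\dots j_q}=(y^k)^m g/h$ near $z$ with holomorphic $g,h$ whose germs at $z$ are not divisible by $y^k$, and let $p'$ and $q'$ be the numbers of the indices $i_1,\dots,i_p$ and $j_1,\dots,j_q$, respectively, that are equal to $k$. * If $S$ is contained in some $\pi(H)$, $H$ a reflection hyperplane, then the coefficient of $S$ in $\operatorname{div}_D(Q)$ is the minimum over all nonzero coefficients of $Q$ of the numbers $m\,r+(q'-p')(r-1)$, where $r=e_S$. * Otherwise the coefficient of $S$ in $\operatorname{div}_D(Q)$ is its coefficient in $\operatorname{div}(Q)$, i.e. the minimum of the orders $m$. (The minimum is $\infty$ if $Q=0$ near $z$.) One writes $\operatorname{div}_D(Q)\ge0$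 if all coefficients are $\ge0$ (for every $S$, $z$ and every choice of such coordinates). **Theorem 3.7.** Let $U\subset V$ be a $G$-stable open subset (for instance $U=V$), and let $p,q\ge0$. 1. Let $P$ be a holomorphic $G$-invariant $\binom pq$-tensor field on $U$. Then $\pi_*P$ is a meromorphic tensor field on $Z_1\cap\pi(U)$, it satisfies $\pi^*\pi_*P=P$ on $U\cap\pi^{-1}(Z_1)$, and $\operatorname{div}_D(\pi_*P)\ge0$. 2. Let $Q$ be a meromorphic $\binom pq$-tensor field on $Z_1\cap\pi(U)$. Then $\pi^*Q$ extends to a holomorphic $G$-invariant tensor field on $U$ if and only if $\operatorname{div}_D(Q)\ge0$. -/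

import Mathlib

open Filter Topology
open scoped Classical

noncomputable section

namespace OrbitTensor

/-! ### Tensors and tensor fields -/

/-- Tensors of type `(p, q)` on `E`: `p` contravariant slots (fed with covectors) and `q` covariant
slots (fed with vectors). -/
abbrev Tensor (p q : ℕ) (E : Type*) [NormedAddCommGroup E] [NormedSpace ℂ E] : Type _ :=
  ContinuousMultilinearMap ℂ (fun _ : Fin p => E →L[ℂ] ℂ)
    (ContinuousMultilinearMap ℂ (fun _ : Fin q => E) ℂ)

section Tensors

variable {E F : Type*} [NormedAddCommGroup E] [NormedSpace ℂ E]
  [NormedAddCommGroup F] [NormedSpace ℂ F] {p q : ℕ}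

/-- Pullback of a tensor along an invertible linear map `A : E → F`:
`(A^* T)(α, x) = T(α ∘ A⁻¹, A x)`. (It has a meaningless value when `A` is not invertible.) -/
def tensorPullback (A : E →L[ℂ] F) (T : Tensor p q F) : Tensor p q E :=
  (ContinuousMultilinearMap.compContinuousLinearMapL (fun _ : Fin q => A)).compContinuousMultilinearMap
    (T.compContinuousLinearMap fun _ : Fin p => ContinuousLinearMap.precomp ℂ A.inverse)

theorem tensorPullback_apply (A : E →L[ℂ] F) (T : Tensor p q F)
    (α : Fin p → (E →L[ℂ] ℂ)) (x : Fin q → E) :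
    tensorPullback A T α x = T (fun s => (α s).comp A.inverse) (fun t => A (x t)) := rfl

/-- Pullback `f^* P` of a tensor field along a local biholomorphism `f`. -/
def pullbackField (f : E → F) (P : F → Tensor p q F) : E → Tensor p q E :=
  fun v => tensorPullback (fderiv ℂ f v) (P (f v))

/-- The coefficient `T^{i_1 … i_p}_{j_1 … j_q}` of a tensor on `ℂⁿ`. -/
def component {n : ℕ} (T : Tensor p q (Fin n → ℂ)) (i : Fin p → Fin n) (j : Fin q → Fin n) : ℂ :=
  T (fun s => ContinuousLinearMap.proj (i s)) (fun t => Pi.single (j t) 1)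

end Tensors

/-! ### Meromorphic functions of several variables

A meromorphic function is represented by a total function; its values on thin sets (nowhere dense
sets contained locally in the zero set of a nonzero holomorphic function) carry no meaning. -/

section Meromorphic

variable {E F : Type*} [NormedAddCommGroup E] [NormedSpace ℂ E]

/-- `f` and `g` agree near `a` off the zero set of some holomorphic function whose germ at `a` is
not zero: equality of germs of meromorphic objects. -/
def MerEqAt (f g : E → F) (a : E) : Prop :=
  ∃ h : E → ℂ, AnalyticAt ℂ h a ∧ ¬ (∀ᶠ w in 𝓝 a, h w = 0) ∧
    ∀ᶠ w in 𝓝 a, h w ≠ 0 → f w = g w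

/-- `f` is meromorphic at `a`: near `a` it is a quotient of holomorphic functions. -/
def IsMerAt (f : E → ℂ) (a : E) : Prop :=
  ∃ g h : E → ℂ, AnalyticAt ℂ g a ∧ AnalyticAt ℂ h a ∧ ¬ (∀ᶠ w in 𝓝 a, h w = 0) ∧
    MerEqAt f (fun w => g w / h w) a

variable {n : ℕ}

/-- The coordinate function `y^k` divides `g` in the ring of germs of holomorphic functions
at `a`. -/
def CoordDvdAt (k : Fin n) (g : (Fin n → ℂ) → ℂ) (a : Fin n → ℂ) : Prop :=
  ∃ u : (Fin n → ℂ) → ℂ, AnalyticAt ℂ u a ∧ ∀ᶠ w in 𝓝 a, g w = w k * u w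

/-- `f = (y^k)^m g / h` as germs of meromorphic functions at `a`, with `g`, `h` holomorphic and not
divisible by `y^k`. -/
def HasOrderAlong (k : Fin n) (f : (Fin n → ℂ) → ℂ) (a : Fin n → ℂ) (m : ℤ) : Prop :=
  ∃ g h : (Fin n → ℂ) → ℂ, AnalyticAt ℂ g a ∧ AnalyticAt ℂ h a ∧
    ¬ CoordDvdAt k g a ∧ ¬ CoordDvdAt k h a ∧
    MerEqAt f (fun w => w k ^ m * (g w / h w)) a

/-- The order of a meromorphic function `f` along the hypersurface germ `{y^k = 0}` at a point `a`
with `a k = 0`; it is `⊤` when `f` is zero near `a`. -/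
def orderAlong (k : Fin n) (f : (Fin n → ℂ) → ℂ) (a : Fin n → ℂ) : WithTop ℤ :=
  if MerEqAt f (fun _ => 0) a then ⊤ else ((Classical.epsilon (HasOrderAlong k f a) : ℤ) : WithTop ℤ)

end Meromorphic

/-! ### The orbit space, its structure sheaf and its strata -/

section OrbitSpace

variable {V : Type*} [NormedAddCommGroup V] [NormedSpace ℂ V]

/-- The orbit space `Z = V/G` with the quotient topology. -/
abbrev OrbitSpace (G : Subgroup (LinearMap.GeneralLinearGroup ℂ V)) : Type _ :=
  MulAction.orbitRel.Quotient G V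

/-- The quotient projection `π : V → V/G`. -/
def proj (G : Subgroup (LinearMap.GeneralLinearGroup ℂ V)) (v : V) : OrbitSpace G :=
  Quotient.mk (MulAction.orbitRel G V) v

variable (G : Subgroup (LinearMap.GeneralLinearGroup ℂ V))

/-- The space `V^{G_v}` of vectors fixed by the isotropy group `G_v`. -/
def isotropyFixedSpace (v : V) : Submodule ℂ V where
  carrier := {x | ∀ g ∈ G, g • v = v → g • x = x}
  add_mem' := fun {x y} hx hy g hg hv => by rw [smul_add, hx g hg hv, hy g hg hv]
  zero_mem' := fun g _ _ => smul_zero g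
  smul_mem' := fun c x hx g hg hv => by
    have h : g • (c • x) = c • (g • x) := map_smul (g : V →ₗ[ℂ] V) c x
    rw [h, hx g hg hv]

/-- `Z_i`: the union of the isotropy type strata of codimension at most `i` (the stratum through
`π(v)` has the dimension of `V^{G_v}`). So `Z_0` is the principal stratum, and `Z_1` is the union of
`Z_0` and the strata of codimension one. -/
def strataUpTo (i : ℕ) : Set (OrbitSpace G) :=
  proj G '' {v | Module.finrank ℂ V ≤ Module.finrank ℂ (isotropyFixedSpace G v) + i}

/-- The open part `Z_1 ∩ π(U)` of the complex manifold `Z_1`. -/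
def Z1 (U : Set V) : Set (OrbitSpace G) := strataUpTo G 1 ∩ proj G '' U

/-- The coordinate space `ℂⁿ`, `n = dim V`. -/
abbrev Coord (V : Type*) [NormedAddCommGroup V] [NormedSpace ℂ V] : Type :=
  Fin (Module.finrank ℂ V) → ℂ

/-- Holomorphic coordinates `y^1, …, y^n` on an open subset of `Ω ⊆ Z`: a homeomorphism onto an open
subset of `ℂⁿ` which is an isomorphism of ringed spaces, where the holomorphic functions on an open
set `W ⊆ Z` are the functions `f` such that `f ∘ π` is holomorphic on `π⁻¹(W)`. -/
structure Chart (Ω : Set (OrbitSpace G)) where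
  toHomeo : OpenPartialHomeomorph (OrbitSpace G) (Coord V)
  source_subset : toHomeo.source ⊆ Ω
  holomorphic_iff : ∀ W : Set (OrbitSpace G), IsOpen W → W ⊆ toHomeo.source →
    ∀ f : OrbitSpace G → ℂ,
      AnalyticOnNhd ℂ (fun v => f (proj G v)) (proj G ⁻¹' W) ↔
        AnalyticOnNhd ℂ (fun w => f (toHomeo.symm w)) (toHomeo '' W)

/-! ### Meromorphic tensor fields on open subsets of `Z_1` -/

/-- A meromorphic `(p, q)`-tensor field on `Ω` (an open subset of the complex manifold `Z_1`): in all
holomorphic coordinates a tensor field on the coordinate domain with meromorphic coefficient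
functions, such that these coordinate representations are transformed into each other by the
coordinate changes. -/
structure MeromorphicTensorField (Ω : Set (OrbitSpace G)) (p q : ℕ) where
  inChart : Chart G Ω → Coord V → Tensor p q (Coord V)
  meromorphic : ∀ φ : Chart G Ω, ∀ a ∈ φ.toHomeo.target, ∀ i j,
    IsMerAt (fun w => component (inChart φ w) i j) a
  transform : ∀ φ ψ : Chart G Ω, ∀ z ∈ φ.toHomeo.source ∩ ψ.toHomeo.source,
    MerEqAt (inChart φ)
      (pullbackField (fun w => ψ.toHomeo (φ.toHomeo.symm w)) (inChart ψ)) (φ.toHomeo z)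

variable {G}

/-- `P` is a holomorphic `G`-invariant tensor field on the `G`-stable open set `U ⊆ V`. -/
def IsHolomorphicInvariant (G : Subgroup (LinearMap.GeneralLinearGroup ℂ V)) (U : Set V)
    {p q : ℕ} (P : V → Tensor p q V) : Prop :=
  AnalyticOnNhd ℂ P U ∧ ∀ g ∈ G, ∀ v ∈ U, pullbackField (fun x : V => g • x) P v = P v

/-- `P` extends the meromorphic tensor field `π^* Q`: over each coordinate domain, `P` is (as a
meromorphic tensor field) the pullback along `φ ∘ π` of the coordinate representation of `Q`. -/
def ExtendsPullback {Ω : Set (OrbitSpace G)} {p q : ℕ} (P : V → Tensor p q V)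
    (Q : MeromorphicTensorField G Ω p q) : Prop :=
  ∀ φ : Chart G Ω, ∀ v : V, proj G v ∈ φ.toHomeo.source →
    MerEqAt P (pullbackField (fun x => φ.toHomeo (proj G x)) (Q.inChart φ)) v

/-- The coordinate representations of `π_* P`: at a point `z ∈ Z_0` the tensor `P(v)`, for a point `v`
of the orbit `z`, is transported by the (there invertible) derivative of `φ ∘ π` at `v`. -/
def pushforward (Ω : Set (OrbitSpace G)) {p q : ℕ} (P : V → Tensor p q V)
    (φ : Chart G Ω) (w : Coord V) : Tensor p q (Coord V) :=
  let v : V := Quotient.out (φ.toHomeo.symm w)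
  tensorPullback (fderiv ℂ (fun x => φ.toHomeo (proj G x)) v).inverse (P v)

/-! ### Divisors

A divisor on a complex manifold is determined by its multiplicities along the germs of irreducible
hypersurfaces at their smooth points (every irreducible hypersurface `S` is smooth at a dense set of
points, the coefficient of `S` is read off at any of these, and the global divisor is glued from the
local ones). So a divisor is recorded as the function that assigns to each germ of a smooth
hypersurface the coefficient of the divisor along it. -/

/-- A germ of a smooth hypersurface `S = {y^k = 0}` at a point `z`, given in holomorphic
coordinates. -/
structure HypersurfaceGerm (G : Subgroup (LinearMap.GeneralLinearGroup ℂ V))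
    (Ω : Set (OrbitSpace G)) where
  chart : Chart G Ω
  index : Fin (Module.finrank ℂ V)
  point : OrbitSpace G
  mem_source : point ∈ chart.toHomeo.source
  coord_eq_zero : chart.toHomeo point index = 0

/-- The germ `S` is contained in the subset `A` of the orbit space. -/
def HypersurfaceGerm.LiesIn {Ω : Set (OrbitSpace G)} (S : HypersurfaceGerm G Ω)
    (A : Set (OrbitSpace G)) : Prop :=
  ∀ᶠ w in 𝓝 S.point, S.chart.toHomeo w S.index = 0 → w ∈ A

/-- `H` is a reflection hyperplane: a hyperplane fixed pointwise by some `g ≠ 1` in `G`. -/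
def IsReflectionHyperplane (G : Subgroup (LinearMap.GeneralLinearGroup ℂ V))
    (H : Submodule ℂ V) : Prop :=
  Module.finrank ℂ H + 1 = Module.finrank ℂ V ∧ ∃ g ∈ G, g ≠ 1 ∧ ∀ x ∈ H, g • x = x

/-- `e_H`: the order of the (cyclic) subgroup of `G` that fixes `H` pointwise. -/
def hyperplaneLabel (G : Subgroup (LinearMap.GeneralLinearGroup ℂ V)) (H : Submodule ℂ V) : ℕ :=
  Nat.card {g : LinearMap.GeneralLinearGroup ℂ V // g ∈ G ∧ ∀ x ∈ H, g • x = x}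

/-- The reflection divisor `D = ∑_S e_S . S` of the orbit space, the sum being over the
hypersurfaces `S = π(H)` with `H` a reflection hyperplane, and `e_S = e_H`. -/
def reflectionDivisor (G : Subgroup (LinearMap.GeneralLinearGroup ℂ V))
    (Ω : Set (OrbitSpace G)) : HypersurfaceGerm G Ω → ℕ :=
  fun S =>
    if h : ∃ H : Submodule ℂ V, IsReflectionHyperplane G H ∧ S.LiesIn (proj G '' H) then
      hyperplaneLabel G h.choose
    else 0

namespace MeromorphicTensorField

variable {Ω : Set (OrbitSpace G)} {p q : ℕ} (Q : MeromorphicTensorField G Ω p q)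

/-- The order along `S` of the coefficient function `Q^{i_1 … i_p}_{j_1 … j_q}`. -/
def coeffOrder (S : HypersurfaceGerm G Ω) (i : Fin p → Fin (Module.finrank ℂ V))
    (j : Fin q → Fin (Module.finrank ℂ V)) : WithTop ℤ :=
  orderAlong S.index (fun w => component (Q.inChart S.chart w) i j) (S.chart.toHomeo S.point)

/-- The divisor `div(Q)`: the minimum of the divisors of the coefficient functions. -/
def div : HypersurfaceGerm G Ω → WithTop ℤ :=
  fun S => Finset.univ.inf fun i => Finset.univ.inf fun j => Q.coeffOrder S i j

/-- The reflection residuum `μ = m r + (q' - p') (r - 1)` at `S` of a summand of `Q`, where `m` is the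
order along `S = {y^k = 0}` of the coefficient and where `∂/∂y^k` and `dy^k` occur `p'` and `q'` times
in the summand. It is `⊤` for a zero summand. -/
def residuum (S : HypersurfaceGerm G Ω) (r : ℕ) (i : Fin p → Fin (Module.finrank ℂ V))
    (j : Fin q → Fin (Module.finrank ℂ V)) : WithTop ℤ :=
  (Q.coeffOrder S i j).map fun m : ℤ =>
    m * r + (((Finset.univ.filter fun t => j t = S.index).card : ℤ)
      - ((Finset.univ.filter fun s => i s = S.index).card : ℤ)) * ((r : ℤ) - 1)

/-- `div_D(Q)`: it has the coefficient `μ_S(Q)`, the minimum of the reflection residua of the summands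
of `Q` with `r = e_S`, along the hypersurfaces `S` in the support of `D`, and the coefficient of
`div(Q)` along all other hypersurfaces. -/
def divD (D : HypersurfaceGerm G Ω → ℕ) : HypersurfaceGerm G Ω → WithTop ℤ :=
  fun S =>
    if D S = 0 then Q.div S
    else Finset.univ.inf fun i => Finset.univ.inf fun j => Q.residuum S (D S) i j

end MeromorphicTensorField

end OrbitSpace

end OrbitTensor

end

open OrbitTensor

/-!
Meromorphic objects are functions modulo changes on thin sets, that is, on zero sets of holomorphic
functions with nonzero germ (`NonzeroGerm`, `MerEqAt`); such an object is holomorphic at a point if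
it has a holomorphic representative there (`HolExtAt`), and by the identity theorem this
representative is unique (`MerEqAt.eventuallyEq`, `holExt`). All extension theorems used below come
from one observation: if a function satisfies the mean value property on generic discs in a fixed
direction, then it is generically equal to its average over the boundary circles, and this average
is a holomorphic function of the centre as soon as the function is holomorphic near the circles
(`analyticAt_circleAverage`, `holExtAt_of_circleAverage`). In this way one divides by a coordinate
(`coordDvdAt_of_eventually`), descends holomorphic functions along a power map
(`analyticAt_of_comp_powCoord`), removes singularities of codimension one when there is no pole
(`holExtAt_of_order_nonneg`) and removes singularities of codimension two
(`holExtAt_of_analyticAt_strata`).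

*Local structure of `π`.* The isotropy group of a point of `π⁻¹(Z_1)` is trivial or a cyclic group
of order `e` which fixes a hyperplane pointwise and acts by a faithful character on a complementary
line. Hence in suitable coordinates of `Z_1` the quotient map is biholomorphic
(`exists_chart_of_isFree`) or the map `powCoord k e`, which raises the `k`-th coordinate to the
power `e` (`exists_reflectionCoord`, `exists_reflectionChart`). The same holds in arbitrary coordinates in
which the image of the hyperplane is `{y^k = 0}`, up to a local biholomorphism of `V`
(`exists_lift_powCoord`, `exists_lift_of_reflectionDivisor_ne_zero`).

*The reflection residuum.* The derivative of `powCoord k e` is diagonal, with `k`-th entry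
`e t_k^(e - 1)`. Pulling back a tensor field multiplies a component with `p'` contravariant and `q'`
covariant indices `k` by the power `q' - p'` of this entry (`component_pullbackField_powCoord`), so
a coefficient of order `m` becomes one of order `m e + (q' - p') (e - 1)`, which is the reflection
residuum. Therefore a field whose pullback is holomorphic has `div_D ≥ 0`
(`zero_le_divD_of_extendsPullback`).

*Extension.* Conversely, let `div_D(Q) ≥ 0`. Over `Z_0` the field `Q` has no poles: its singular set
lies in the zero set of a denominator, hence near some of its points in a smooth hypersurface
(`exists_regular_equation`), along which all orders are nonnegative (`holExtAt_inChart_of_isFree`).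
Over the strata of codimension one the pullback has coefficients of nonnegative order
(`holExtAt_pullback`), and it extends over the remaining points, which form a set of codimension at
least two. The extension is invariant since it is so over `Z_0` (`exists_extension`).

*Push-forward.* The components of `π_* P` become holomorphic functions on `V` after multiplication
by the power `det(dπ)^q` (`scaledComponent`). Summation and multiplication over `G` make numerator and
denominator invariant, so that they descend to `Z_1` (`isMerAt_pushforward`).
-/

noncomputable section

namespace OrbitTensor

/-! ### Averages of analytic functions over circles -/

section Average

variable {K E F : Type*} [TopologicalSpace K] [CompactSpace K]
  [NormedAddCommGroup E] [NormedSpace ℂ E] [NormedAddCommGroup F] [NormedSpace ℂ F]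

/-- Pointwise application of a continuous multilinear map to continuous functions on a compact
space. -/
def pointwiseMultilinear {n : ℕ} (p : ContinuousMultilinearMap ℂ (fun _ : Fin n => E) F) :
    ContinuousMultilinearMap ℂ (fun _ : Fin n => C(K, E)) C(K, F) :=
  MultilinearMap.mkContinuous
    { toFun := fun u => ⟨fun x => p fun i => u i x, by fun_prop⟩
      map_update_add' := by
        intro _ m i x y
        ext t
        have h : ∀ z : C(K, E), (fun j => (Function.update m i z j) t)
            = Function.update (fun j => m j t) i (z t) := fun z => by
          ext j
          by_cases hj : j = i
          · subst hj; simp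
          · simp [hj]
        simp [h]
      map_update_smul' := by
        intro _ m i c x
        ext t
        have h : ∀ z : C(K, E), (fun j => (Function.update m i z j) t)
            = Function.update (fun j => m j t) i (z t) := fun z => by
          ext j
          by_cases hj : j = i
          · subst hj; simp
          · simp [hj]
        simp [h] }
    ‖p‖ (fun u => by
      rw [ContinuousMap.norm_le _ (by positivity)]
      intro x
      refine (p.le_opNorm _).trans ?_
      gcongr with i
      exact (u i).norm_coe_le_norm x)

theorem norm_pointwiseMultilinear_le {n : ℕ}
    (p : ContinuousMultilinearMap ℂ (fun _ : Fin n => E) F) :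
    ‖pointwiseMultilinear (K := K) p‖ ≤ ‖p‖ :=
  MultilinearMap.mkContinuous_norm_le _ (norm_nonneg _) _

/-- Composition with an analytic function is analytic near constant functions, as a map of Banach
spaces of continuous functions: the power series is applied pointwise. -/
theorem hasFPowerSeriesOnBall_comp [CompleteSpace F] {f : E → F}
    {p : FormalMultilinearSeries ℂ E F} {c : E} {r : ENNReal} (hf : HasFPowerSeriesOnBall f p c r)
    (Φ : C(K, E) → C(K, F))
    (hΦ : ∀ u : C(K, E), u - ContinuousMap.const K c ∈ Metric.eball 0 r → ∀ x, Φ u x = f (u x)) :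
    HasFPowerSeriesOnBall Φ (fun n => pointwiseMultilinear (p n)) (ContinuousMap.const K c) r where
  r_le := by
    refine hf.r_le.trans ?_
    refine ENNReal.le_of_forall_nnreal_lt fun ρ hρ => ?_
    obtain ⟨C, -, hC⟩ := p.norm_mul_pow_le_of_lt_radius hρ
    refine FormalMultilinearSeries.le_radius_of_bound _ C fun n => ?_
    refine le_trans ?_ (hC n)
    gcongr
    exact norm_pointwiseMultilinear_le _
  r_pos := hf.r_pos
  hasSum := by
    intro u hu
    have hnorm : ∀ x, u x ∈ Metric.eball (0 : E) r := by
      intro x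
      rw [mem_eball_zero_iff] at hu ⊢
      refine lt_of_le_of_lt ?_ hu
      have := u.norm_coe_le_norm x
      exact ENNReal.coe_le_coe.2 (show ‖u x‖₊ ≤ ‖u‖₊ from this)
    have hsum : Summable fun n => pointwiseMultilinear (p n) fun _ : Fin n => u := by
      refine Summable.of_norm_bounded (g := fun n => ‖p n‖ * ‖u‖ ^ n) ?_ fun n => ?_
      · refine p.summable_norm_mul_pow (r := ‖u‖₊) ?_
        rw [mem_eball_zero_iff] at hu
        exact lt_of_lt_of_le hu hf.r_le
      · refine (ContinuousMultilinearMap.le_opNorm _ _).trans ?_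
        simp only [Finset.prod_const, Finset.card_univ, Fintype.card_fin]
        gcongr
        exact norm_pointwiseMultilinear_le _
    have key : Φ (ContinuousMap.const K c + u)
        = ∑' n, pointwiseMultilinear (p n) fun _ : Fin n => u := ContinuousMap.ext fun x => by
      have h1 := (ContinuousMap.evalCLM ℂ x : C(K, F) →L[ℂ] F).hasSum hsum.hasSum
      have h2 := hf.hasSum (hnorm x)
      have h3 : Φ (ContinuousMap.const K c + u) x = f (c + u x) := by
        rw [hΦ _ (by simpa using hu)]; rfl
      rw [h3]
      exact h2.unique h1
    rw [key]
    exact hsum.hasSum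

/-- Integrals of translates of an analytic function along a short path are analytic: the integral is
the composition of the affine map `w ↦ (θ ↦ w + γ θ)` into a Banach space of continuous functions,
of composition with `f`, and of a continuous linear functional. -/
theorem analyticAt_integral_of_ball [CompleteSpace F] {f : E → F} {a c : E} {r : ENNReal}
    {p : FormalMultilinearSeries ℂ E F} (hf : HasFPowerSeriesOnBall f p c r) {γ : ℝ → E}
    (hγ : Continuous γ) {s t : ℝ} (hst : s ≤ t)
    (hball : ∀ θ ∈ Set.Icc s t, a + γ θ ∈ Metric.eball c r) :
    AnalyticAt ℂ (fun w => ∫ θ in s..t, f (w + γ θ)) a := by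
  let K := Set.Icc s t
  let γK : C(K, E) := ⟨fun x => γ x, by fun_prop⟩
  let A : E → C(K, E) := fun w => ContinuousMap.const K w + γK
  -- the value `0` is never used: near `A a` all compositions are continuous
  let Φ : C(K, E) → C(K, F) := fun u =>
    if h : Continuous fun x => f (u x) then ⟨fun x => f (u x), h⟩ else 0
  have hsub : ∀ u : C(K, E), (∀ x, u x ∈ Metric.eball c r) → Continuous fun x => f (u x) := by
    intro u hu
    have := hf.analyticOnNhd.continuousOn
    exact this.comp_continuous u.continuous hu
  have hΦ : ∀ u : C(K, E), u - ContinuousMap.const K c ∈ Metric.eball 0 r →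
      ∀ x, Φ u x = f (u x) := by
    intro u hu x
    have : Continuous fun x => f (u x) := by
      refine hsub u fun x => ?_
      rw [Metric.mem_eball, edist_eq_enorm_sub]
      rw [mem_eball_zero_iff] at hu
      refine lt_of_le_of_lt ?_ hu
      have := (u - ContinuousMap.const K c).norm_coe_le_norm x
      exact ENNReal.coe_le_coe.2
        (show ‖u x - c‖₊ ≤ ‖u - ContinuousMap.const K c‖₊ from this)
    simp [Φ, this]
  have h1 := hasFPowerSeriesOnBall_comp hf Φ hΦ
  have : Nonempty K := ⟨⟨s, le_refl s, hst⟩⟩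
  have hAball : A a ∈ Metric.eball (ContinuousMap.const K c) r := by
    rw [Metric.mem_eball, edist_eq_enorm_sub]
    obtain ⟨x, -, hx⟩ := (isCompact_univ (X := K)).exists_isMaxOn Set.univ_nonempty
      ((A a - ContinuousMap.const K c).continuous.norm.continuousOn)
    have hle : ‖A a - ContinuousMap.const K c‖ ≤ ‖(A a - ContinuousMap.const K c) x‖ := by
      rw [ContinuousMap.norm_le _ (norm_nonneg _)]
      intro y
      exact hx (Set.mem_univ y)
    have h2 := hball x x.2
    rw [Metric.mem_eball, edist_eq_enorm_sub] at h2
    refine lt_of_le_of_lt ?_ h2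
    exact ENNReal.coe_le_coe.2
      (show ‖A a - ContinuousMap.const K c‖₊ ≤ ‖(a + γ x) - c‖₊ from hle)
  have h2 : AnalyticAt ℂ Φ (A a) := h1.analyticOnNhd _ hAball
  have hA : AnalyticAt ℂ A a := by
    refine AnalyticAt.add ?_ analyticAt_const
    let C : E →L[ℂ] C(K, E) := LinearMap.mkContinuous
      { toFun := fun w => ContinuousMap.const K w
        map_add' := fun _ _ => rfl
        map_smul' := fun _ _ => rfl } 1 (fun w => by
          rw [one_mul, ContinuousMap.norm_le _ (norm_nonneg _)]
          intro x
          exact le_refl _)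
    exact C.analyticAt a
  let μ : MeasureTheory.Measure K := MeasureTheory.Measure.comap Subtype.val MeasureTheory.volume
  have : MeasureTheory.IsFiniteMeasure μ := by
    constructor
    rw [MeasureTheory.Measure.comap_apply _ Subtype.val_injective
      (fun u hu => (MeasurableEmbedding.subtype_coe measurableSet_Icc).measurableSet_image' hu) _
      MeasurableSet.univ]
    rw [Set.image_univ, Subtype.range_coe]
    exact isCompact_Icc.measure_lt_top
  have hint : ∀ u : C(K, F), MeasureTheory.Integrable (fun x => u x) μ := fun u =>
    u.continuous.integrable_of_hasCompactSupport (HasCompactSupport.of_compactSpace _)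
  let I : C(K, F) →L[ℂ] F := LinearMap.mkContinuous
      { toFun := fun u => ∫ x, u x ∂μ
        map_add' := fun u v => MeasureTheory.integral_add (hint u) (hint v)
        map_smul' := fun z u => MeasureTheory.integral_smul z _ } (μ.real Set.univ) (fun u => by
          have := MeasureTheory.norm_integral_le_of_norm_le_const (μ := μ) (f := fun x => u x)
            (C := ‖u‖) (Eventually.of_forall fun x => u.norm_coe_le_norm x)
          rw [mul_comm]; exact this)
  have h3 : AnalyticAt ℂ (fun w => I (Φ (A w))) a :=
    (I.analyticAt _).comp (h2.comp hA)
  refine h3.congr ?_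
  have hev : ∀ᶠ w in 𝓝 a, A w ∈ Metric.eball (ContinuousMap.const K c) r :=
    hA.continuousAt.eventually_mem (Metric.isOpen_eball.mem_nhds hAball)
  filter_upwards [hev] with w hw
  have h4 : ∀ x, Φ (A w) x = f (w + γ x) := fun x => by
    rw [hΦ _ (by rw [Metric.mem_eball, edist_eq_enorm_sub] at hw; rwa [mem_eball_zero_iff]) x]; rfl
  change ∫ x, Φ (A w) x ∂μ = _
  simp_rw [h4]
  rw [MeasureTheory.integral_subtype_comap measurableSet_Icc (fun θ => f (w + γ θ)),
    intervalIntegral.integral_of_le hst, MeasureTheory.integral_Icc_eq_integral_Ioc]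

/-- Integrals of translates of an analytic function along a path are analytic: a subdivision of the
path reduces this to the case where it lies in the domain of convergence of one power series. -/
theorem analyticAt_integral [CompleteSpace F] {f : E → F} {a : E} {γ : ℝ → E}
    (hγ : Continuous γ) {s t : ℝ} (hst : s ≤ t)
    (hf : ∀ θ ∈ Set.Icc s t, AnalyticAt ℂ f (a + γ θ)) :
    AnalyticAt ℂ (fun w => ∫ θ in s..t, f (w + γ θ)) a := by
  have hf' : ∀ θ : Set.Icc s t, ∃ r : ENNReal, ∃ p : FormalMultilinearSeries ℂ E F,
      HasFPowerSeriesOnBall f p (a + γ θ) r := fun θ => by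
    obtain ⟨p, r, hr⟩ := hf θ θ.2
    exact ⟨r, p, hr⟩
  choose r p hp using hf'
  let c : Set.Icc s t → Set (Set.Icc s t) := fun θ => {x | a + γ x ∈ Metric.eball (a + γ θ) (r θ)}
  obtain ⟨τ, h0, hmono, ⟨m, hm⟩, hcov⟩ := exists_monotone_Icc_subset_open_cover_Icc hst (c := c)
    (fun θ => Metric.isOpen_eball.preimage (by fun_prop))
    (fun θ _ => Set.mem_iUnion.2 ⟨θ, Metric.mem_eball_self (hp θ).r_pos⟩)
  have hseg : ∀ n, ∃ θ : Set.Icc s t, ∀ x ∈ Set.Icc (τ n : ℝ) (τ (n + 1)), a + γ x ∈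
      Metric.eball (a + γ θ) (r θ) := by
    intro n
    obtain ⟨θ, hθ⟩ := hcov n
    refine ⟨θ, fun x hx => ?_⟩
    have hx' : x ∈ Set.Icc s t := ⟨(τ n).2.1.trans hx.1, hx.2.trans (τ (n + 1)).2.2⟩
    exact hθ (a := ⟨x, hx'⟩) ⟨hx.1, hx.2⟩
  have hle : ∀ n, (τ n : ℝ) ≤ τ (n + 1) := fun n => hmono (Nat.le_succ n)
  have hpart : ∀ n, AnalyticAt ℂ (fun w => ∫ θ in (τ n : ℝ)..τ (n + 1), f (w + γ θ)) a := by
    intro n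
    obtain ⟨θ, hθ⟩ := hseg n
    exact analyticAt_integral_of_ball (hp θ) hγ (hle n) hθ
  have hsum : AnalyticAt ℂ (fun w => ∑ n ∈ Finset.range m,
      ∫ θ in (τ n : ℝ)..τ (n + 1), f (w + γ θ)) a :=
    Finset.analyticAt_fun_sum _ fun n _ => hpart n
  refine hsum.congr ?_
  have hcont : ∀ᶠ w in 𝓝 a, ∀ n ∈ Finset.range m,
      ContinuousOn (fun θ => f (w + γ θ)) (Set.uIcc (τ n : ℝ) (τ (n + 1))) := by
    rw [Filter.eventually_all_finset]
    intro n _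
    obtain ⟨θ, hθ⟩ := hseg n
    have hK : IsCompact (Set.Icc (τ n : ℝ) (τ (n + 1))) := isCompact_Icc
    have := hK.eventually_forall_of_forall_eventually (x₀ := a)
      (P := fun w x => w + γ x ∈ Metric.eball (a + γ θ) (r θ)) (fun x hx => by
        have hc : Continuous fun z : E × ℝ => z.1 + γ z.2 := by fun_prop
        exact hc.continuousAt.eventually_mem (Metric.isOpen_eball.mem_nhds (hθ x hx)))
    filter_upwards [this] with w hw
    rw [Set.uIcc_of_le (hle n)]
    refine (hp θ).analyticOnNhd.continuousOn.comp (by fun_prop) fun x hx => hw x hx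
  filter_upwards [hcont] with w hw
  rw [intervalIntegral.sum_integral_adjacent_intervals
    (a := fun n => (τ n : ℝ)) (fun n hn => (hw n (Finset.mem_range.2 hn)).intervalIntegrable)]
  simp [h0, hm m le_rfl]

/-- The averages of an analytic function over the circles of radius `r` in the direction `u` form
an analytic function of the centre. -/
theorem analyticAt_circleAverage [CompleteSpace F] {f : E → F} {a u : E} {r : ℝ}
    (hf : ∀ z ∈ Metric.sphere (0 : ℂ) |r|, AnalyticAt ℂ f (a + z • u)) :
    AnalyticAt ℂ (fun w => Real.circleAverage (fun z => f (w + z • u)) 0 r) a := by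
  have := analyticAt_integral (f := f) (a := a) (γ := fun θ => circleMap 0 r θ • u)
    (by fun_prop) Real.two_pi_pos.le (fun θ _ => hf _ (circleMap_mem_sphere' 0 r θ))
  have h2 := (analyticAt_const (v := (((2 * Real.pi)⁻¹ : ℝ) : ℂ))).fun_smul this
  refine h2.congr (Eventually.of_forall fun w => ?_)
  simp only [Real.circleAverage]
  exact (Complex.coe_smul _ _)

end Average

/-! ### Germs of holomorphic and meromorphic maps -/

section Germs

variable {E F F' : Type*} [NormedAddCommGroup E] [NormedSpace ℂ E]
  [NormedAddCommGroup F] [NormedSpace ℂ F]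

/-- `h` is holomorphic at `a` and its germ at `a` is not zero. -/
def NonzeroGerm (h : E → ℂ) (a : E) : Prop :=
  AnalyticAt ℂ h a ∧ ¬ ∀ᶠ w in 𝓝 a, h w = 0

theorem NonzeroGerm.of_ne {h : E → ℂ} {a : E} (hh : AnalyticAt ℂ h a) (h0 : h a ≠ 0) :
    NonzeroGerm h a := ⟨hh, fun H => h0 H.self_of_nhds⟩

theorem nonzeroGerm_one (a : E) : NonzeroGerm (fun _ => 1) a :=
  .of_ne analyticAt_const one_ne_zero

/-- The identity theorem: a germ which is not zero is not zero at nearby points. -/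
theorem NonzeroGerm.eventually {h : E → ℂ} {a : E} (hh : NonzeroGerm h a) :
    ∀ᶠ b in 𝓝 a, NonzeroGerm h b := by
  obtain ⟨r, hr, hball⟩ := Metric.eventually_nhds_iff_ball.1 hh.1.eventually_analyticAt
  filter_upwards [Metric.ball_mem_nhds a hr] with b hb
  refine ⟨hball b hb, fun h0 => hh.2 ?_⟩
  have := AnalyticOnNhd.eqOn_zero_of_preconnected_of_eventuallyEq_zero
    (f := h) (U := Metric.ball a r) (fun x hx => hball x hx)
    (convex_ball a r).isPreconnected hb h0
  filter_upwards [Metric.ball_mem_nhds a hr] with w hw using this hw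

theorem NonzeroGerm.frequently {h : E → ℂ} {a : E} (hh : NonzeroGerm h a) :
    ∃ᶠ w in 𝓝 a, h w ≠ 0 := fun H => hh.2 (H.mono fun _ hw => not_not.1 hw)

theorem NonzeroGerm.mul {h k : E → ℂ} {a : E} (hh : NonzeroGerm h a) (hk : NonzeroGerm k a) :
    NonzeroGerm (fun w => h w * k w) a := by
  refine ⟨hh.1.fun_mul hk.1, fun H => ?_⟩
  obtain ⟨b, hb, hb1, hb2, hb3⟩ := (hh.frequently.and_eventually
    (hk.eventually.and (H.eventually_nhds.and hh.1.eventually_analyticAt))).exists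
  refine hb1.2 ?_
  filter_upwards [hb2, hb3.continuousAt.eventually_ne hb] with w hw hw'
  exact (mul_eq_zero.1 hw).resolve_left hw'

theorem NonzeroGerm.prod {ι : Type*} (s : Finset ι) {h : ι → E → ℂ} {a : E}
    (hh : ∀ i ∈ s, NonzeroGerm (h i) a) : NonzeroGerm (fun w => ∏ i ∈ s, h i w) a := by
  induction s using Finset.induction_on with
  | empty => simpa using nonzeroGerm_one a
  | insert i s hi ih =>
    simp_rw [Finset.prod_insert hi]
    exact (hh i (Finset.mem_insert_self _ _)).mul
      (ih fun j hj => hh j (Finset.mem_insert_of_mem hj))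

theorem NonzeroGerm.comp {E' : Type*} [NormedAddCommGroup E'] [NormedSpace ℂ E'] {h : E' → ℂ}
    {θ : E → E'} {a : E} (hh : NonzeroGerm h (θ a)) (hθ : AnalyticAt ℂ θ a)
    (hopen : 𝓝 (θ a) ≤ map θ (𝓝 a)) : NonzeroGerm (fun w => h (θ w)) a :=
  ⟨hh.1.comp hθ, fun H => hh.2 (hopen H)⟩

section Equality

variable {F F' G : Type*}

theorem MerEqAt.of_germ {f g : E → F} {a : E} {h : E → ℂ} (hh : NonzeroGerm h a)
    (H : ∀ᶠ w in 𝓝 a, h w ≠ 0 → f w = g w) : MerEqAt f g a := ⟨h, hh.1, hh.2, H⟩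

theorem MerEqAt.exists_germ {f g : E → F} {a : E} (H : MerEqAt f g a) :
    ∃ h, NonzeroGerm h a ∧ ∀ᶠ w in 𝓝 a, h w ≠ 0 → f w = g w := by
  obtain ⟨h, h1, h2, h3⟩ := H
  exact ⟨h, ⟨h1, h2⟩, h3⟩

theorem MerEqAt.of_eventuallyEq {f g : E → F} {a : E} (H : f =ᶠ[𝓝 a] g) : MerEqAt f g a :=
  .of_germ (nonzeroGerm_one a) (H.mono fun _ h _ => h)

theorem MerEqAt.refl (f : E → F) (a : E) : MerEqAt f f a :=
  .of_eventuallyEq (EventuallyEq.refl _ _)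

theorem MerEqAt.symm {f g : E → F} {a : E} (H : MerEqAt f g a) : MerEqAt g f a := by
  obtain ⟨h, hh, hw⟩ := H.exists_germ
  exact .of_germ hh (hw.mono fun _ h1 h2 => (h1 h2).symm)

theorem MerEqAt.apply₂ {f f' : E → F} {g g' : E → F'} {a : E} (Φ : E → F → F' → G)
    (H : MerEqAt f f' a) (K : MerEqAt g g' a) :
    MerEqAt (fun w => Φ w (f w) (g w)) (fun w => Φ w (f' w) (g' w)) a := by
  obtain ⟨h, hh, hw⟩ := H.exists_germ
  obtain ⟨k, hk, kw⟩ := K.exists_germ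
  refine .of_germ (hh.mul hk) ?_
  filter_upwards [hw, kw] with w h1 h2 h3
  rw [h1 (left_ne_zero_of_mul h3), h2 (right_ne_zero_of_mul h3)]

theorem MerEqAt.apply {f f' : E → F} {a : E} (Φ : E → F → F') (H : MerEqAt f f' a) :
    MerEqAt (fun w => Φ w (f w)) (fun w => Φ w (f' w)) a :=
  MerEqAt.apply₂ (fun w x _ => Φ w x) H H

theorem MerEqAt.trans {f g k : E → F} {a : E} (H : MerEqAt f g a) (K : MerEqAt g k a) :
    MerEqAt f k a := by
  obtain ⟨h, hh, hw⟩ := H.exists_germ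
  obtain ⟨h', hk, kw⟩ := K.exists_germ
  refine .of_germ (hh.mul hk) ?_
  filter_upwards [hw, kw] with w h1 h2 h3
  rw [h1 (left_ne_zero_of_mul h3), h2 (right_ne_zero_of_mul h3)]

theorem MerEqAt.eventually {f g : E → F} {a : E} (H : MerEqAt f g a) :
    ∀ᶠ b in 𝓝 a, MerEqAt f g b := by
  obtain ⟨h, hh, hw⟩ := H.exists_germ
  filter_upwards [hh.eventually, hw.eventually_nhds] with b h1 h2 using .of_germ h1 h2

theorem MerEqAt.comp {E' : Type*} [NormedAddCommGroup E'] [NormedSpace ℂ E'] {f g : E' → F}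
    {θ : E → E'} {a : E} (H : MerEqAt f g (θ a)) (hθ : AnalyticAt ℂ θ a)
    (hopen : 𝓝 (θ a) ≤ map θ (𝓝 a)) : MerEqAt (fun w => f (θ w)) (fun w => g (θ w)) a := by
  obtain ⟨h, hh, hw⟩ := H.exists_germ
  exact .of_germ (hh.comp hθ hopen) (hθ.continuousAt.eventually hw)

end Equality

set_option linter.unusedSectionVars false in
/-- Continuous representatives of the same meromorphic germ are equal. -/
theorem MerEqAt.eventuallyEq {f g : E → F} {a : E} (H : MerEqAt f g a)
    (hf : ∀ᶠ w in 𝓝 a, ContinuousAt f w) (hg : ∀ᶠ w in 𝓝 a, ContinuousAt g w) :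
    f =ᶠ[𝓝 a] g := by
  obtain ⟨h, hh, hw⟩ := H.exists_germ
  filter_upwards [hh.eventually, hw.eventually_nhds, hf, hg] with w h1 h2 h3 h4
  by_contra hne
  have h5 : ∀ᶠ x in 𝓝 w, f x ≠ g x := by
    have := (h3.fun_sub h4).eventually_ne (sub_ne_zero.2 hne)
    exact this.mono fun x hx => sub_ne_zero.1 hx
  obtain ⟨x, hx, hx1, hx2⟩ := (h1.frequently.and_eventually (h2.and h5)).exists
  exact hx2 (hx1 hx)

theorem MerEqAt.eventuallyEq_of_analyticAt [CompleteSpace F] {f g : E → F} {a : E}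
    (H : MerEqAt f g a) (hf : AnalyticAt ℂ f a) (hg : AnalyticAt ℂ g a) : f =ᶠ[𝓝 a] g := by
  exact H.eventuallyEq (hf.eventually_analyticAt.mono fun _ h => h.continuousAt)
      (hg.eventually_analyticAt.mono fun _ h => h.continuousAt)

/-- The meromorphic germ of `f` at `a` is holomorphic: off a thin set, `f` agrees with a function
which is holomorphic at `a`. -/
def HolExtAt (f : E → F) (a : E) : Prop := ∃ g : E → F, AnalyticAt ℂ g a ∧ MerEqAt f g a

theorem HolExtAt.of_analyticAt {f : E → F} {a : E} (hf : AnalyticAt ℂ f a) : HolExtAt f a :=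
  ⟨f, hf, .refl f a⟩

theorem HolExtAt.congr {f g : E → F} {a : E} (hf : HolExtAt f a) (h : MerEqAt g f a) :
    HolExtAt g a := by
  obtain ⟨k, hk, hfk⟩ := hf
  exact ⟨k, hk, h.trans hfk⟩

/-- The values of the holomorphic germs which represent `f`; it is `0` at the points where the
meromorphic germ of `f` is not holomorphic. -/
def holExt (f : E → F) (a : E) : F := if h : HolExtAt f a then h.choose a else 0

theorem holExt_eventuallyEq [CompleteSpace F] {f g : E → F} {a : E} (hg : AnalyticAt ℂ g a)
    (h : MerEqAt f g a) : holExt f =ᶠ[𝓝 a] g := by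
  have h1 : ∀ᶠ w in 𝓝 a, AnalyticAt ℂ g w := hg.eventually_analyticAt
  filter_upwards [h1, h.eventually] with w hw hw'
  have hE : HolExtAt f w := ⟨g, hw, hw'⟩
  have h2 := hE.choose_spec
  have : hE.choose =ᶠ[𝓝 w] g := (h2.2.symm.trans hw').eventuallyEq_of_analyticAt h2.1 hw
  rw [holExt, dif_pos hE]
  exact this.self_of_nhds

theorem HolExtAt.analyticAt_holExt [CompleteSpace F] {f : E → F} {a : E} (h : HolExtAt f a) :
    AnalyticAt ℂ (holExt f) a := by
  obtain ⟨g, hg, h⟩ := h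
  exact hg.congr (holExt_eventuallyEq hg h).symm

theorem HolExtAt.merEqAt_holExt [CompleteSpace F] {f : E → F} {a : E} (h : HolExtAt f a) :
    MerEqAt f (holExt f) a := by
  obtain ⟨g, hg, h⟩ := h
  exact h.trans (.of_eventuallyEq (holExt_eventuallyEq hg h).symm)

/-- Hartogs-type extension: if for `w` off the thin set `{h = 0}` the function `f` satisfies the
mean value property on the disc with centre `w` in the direction `u`, and if `f` is holomorphic near
the boundary circle of the disc with centre `a`, then `f` extends holomorphically to `a`: the
extension is the average of `f` over the circles. -/
theorem holExtAt_of_circleAverage [CompleteSpace F] {f : E → F} {h : E → ℂ} {a u : E} {r : ℝ}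
    (hh : NonzeroGerm h a) (hcirc : ∀ z ∈ Metric.sphere (0 : ℂ) |r|, AnalyticAt ℂ f (a + z • u))
    (hmean : ∀ᶠ w in 𝓝 a, h w ≠ 0 → Real.circleAverage (fun z => f (w + z • u)) 0 r = f w) :
    HolExtAt f a :=
  ⟨_, analyticAt_circleAverage hcirc, .of_germ hh (hmean.mono fun _ h1 h2 => (h1 h2).symm)⟩

/-- Hartogs-type extension from generic discs: a function which is holomorphic on the disc in the
direction `u` with centre `w`, for generic `w`, satisfies the mean value property there. -/
theorem holExtAt_of_discs [CompleteSpace F] {f : E → F} {h : E → ℂ} {a u : E} {r : ℝ}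
    (hh : NonzeroGerm h a) (hcirc : ∀ z ∈ Metric.sphere (0 : ℂ) |r|, AnalyticAt ℂ f (a + z • u))
    (hdisc : ∀ᶠ w in 𝓝 a, h w ≠ 0 → ∀ z ∈ Metric.closedBall (0 : ℂ) |r|,
      AnalyticAt ℂ f (w + z • u)) :
    HolExtAt f a := by
  refine holExtAt_of_circleAverage hh hcirc (hdisc.mono fun w hw hne => ?_)
  have hd : ∀ z ∈ Metric.closedBall (0 : ℂ) |r|, AnalyticAt ℂ (fun z : ℂ => f (w + z • u)) z :=
    fun z hz => (hw hne z hz).comp (f := fun z : ℂ => w + z • u) (by fun_prop)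
  have := circleAverage_of_differentiable_on_off_countable (s := ∅) (R := r) (c := 0)
    (f := fun z : ℂ => f (w + z • u)) Set.countable_empty
    (fun z hz => (hd z hz).continuousAt.continuousWithinAt)
    (fun z hz => (hd z (Metric.ball_subset_closedBall hz.1)).differentiableAt)
  simpa using this

end Germs

/-! ### Orders along a coordinate hyperplane -/

section Order

variable {n : ℕ} {k : Fin n} {a : Fin n → ℂ}

/-- The projection of `ℂⁿ` onto the coordinate hyperplane `{y^k = 0}`. -/
def dropCoord (k : Fin n) (w : Fin n → ℂ) : Fin n → ℂ := Function.update w k 0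

@[simp] theorem dropCoord_self (k : Fin n) (w : Fin n → ℂ) : dropCoord k w k = 0 := by
  simp [dropCoord]

@[simp] theorem dropCoord_of_ne {k j : Fin n} (h : j ≠ k) (w : Fin n → ℂ) :
    dropCoord k w j = w j := by
  simp [dropCoord, h]

theorem dropCoord_of_eq_zero {w : Fin n → ℂ} (h : w k = 0) : dropCoord k w = w := by
  simp [dropCoord, ← h]

theorem analyticAt_proj (j : Fin n) (a : Fin n → ℂ) :
    AnalyticAt ℂ (fun w : Fin n → ℂ => w j) a :=
  (ContinuousLinearMap.proj (R := ℂ) (φ := fun _ : Fin n => ℂ) j).analyticAt a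

theorem analyticAt_update {E : Type*} [NormedAddCommGroup E] [NormedSpace ℂ E] {f : E → Fin n → ℂ}
    {g : E → ℂ} {x : E} (k : Fin n) (hf : AnalyticAt ℂ f x) (hg : AnalyticAt ℂ g x) :
    AnalyticAt ℂ (fun w => Function.update (f w) k (g w)) x := by
  rw [analyticAt_pi_iff]
  intro j
  by_cases h : j = k
  · subst h; simpa using hg
  · simpa [h] using (analyticAt_pi_iff.1 hf) j

theorem analyticAt_dropCoord (k : Fin n) (a : Fin n → ℂ) : AnalyticAt ℂ (dropCoord k) a :=
  analyticAt_update k analyticAt_id analyticAt_const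

theorem nonzeroGerm_coord (k : Fin n) (a : Fin n → ℂ) :
    NonzeroGerm (fun w : Fin n → ℂ => w k) a := by
  refine ⟨analyticAt_proj k a, fun H => ?_⟩
  have h1 : Tendsto (fun t : ℂ => a + t • (Pi.single k 1 : Fin n → ℂ)) (𝓝 0) (𝓝 a) := by
    have : Continuous fun t : ℂ => a + t • (Pi.single k 1 : Fin n → ℂ) := by fun_prop
    simpa using this.tendsto 0
  have h2 : ∀ᶠ t : ℂ in 𝓝 0, a k + t = 0 := (h1.eventually H).mono fun t ht => by simpa using ht
  have h3 : ∀ᶠ t : ℂ in 𝓝[≠] 0, a k + t = 0 := h2.filter_mono nhdsWithin_le_nhds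
  have h0 : a k = 0 := by simpa using h2.self_of_nhds
  obtain ⟨t, ht, ht'⟩ := (h3.and self_mem_nhdsWithin).exists
  exact ht' (by simpa [h0] using ht)

theorem add_smul_single_apply (w : Fin n → ℂ) (z : ℂ) (k j : Fin n) :
    (w + z • (Pi.single k 1 : Fin n → ℂ)) j = if j = k then w k + z else w j := by
  by_cases h : j = k
  · subst h; simp
  · simp [h]

theorem dropCoord_add_smul_single (w : Fin n → ℂ) (z : ℂ) (k : Fin n) :
    dropCoord k (w + z • (Pi.single k 1 : Fin n → ℂ)) = dropCoord k w := by
  ext j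
  by_cases h : j = k
  · subst h; simp
  · simp [h]

/-- A neighbourhood of `a` contains all discs of a fixed small radius in the direction `u` with
centre close to `a`. -/
theorem exists_disc_radius {E : Type*} [NormedAddCommGroup E] [NormedSpace ℂ E] {a u : E}
    {p : E → Prop} (hp : ∀ᶠ w in 𝓝 a, p w) :
    ∃ r > 0, ∀ᶠ w in 𝓝 a, ∀ z ∈ Metric.ball (0 : ℂ) (2 * r), p (w + z • u) := by
  have h1 : Tendsto (fun q : E × ℂ => q.1 + q.2 • u) (𝓝 (a, 0)) (𝓝 a) := by
    have : Continuous fun q : E × ℂ => q.1 + q.2 • u := by fun_prop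
    simpa using this.tendsto (a, 0)
  have h2 := h1.eventually hp
  rw [nhds_prod_eq, Filter.eventually_prod_iff] at h2
  obtain ⟨pa, hpa, pb, hpb, h3⟩ := h2
  obtain ⟨r, hr, hball⟩ := Metric.eventually_nhds_iff_ball.1 hpb
  refine ⟨r / 2, by positivity, hpa.mono fun w hw z hz => h3 hw (hball z ?_)⟩
  rwa [mul_div_cancel₀ _ two_ne_zero] at hz

/-- A holomorphic germ which vanishes on `{y^k = 0}` is divisible by `y^k`: on lines parallel to the
`k`-th axis the quotient is a slope of `g`, so it has a removable singularity and the mean value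
property. -/
theorem coordDvdAt_of_eventually {g : (Fin n → ℂ) → ℂ} (hg : AnalyticAt ℂ g a) (ha : a k = 0)
    (h0 : ∀ᶠ w in 𝓝 a, g (dropCoord k w) = 0) : CoordDvdAt k g a := by
  obtain ⟨r, hr, hdisc⟩ := exists_disc_radius (u := (Pi.single k 1 : Fin n → ℂ))
    (hg.eventually_analyticAt.and h0)
  have hsmall : ∀ᶠ w : Fin n → ℂ in 𝓝 a, w k ∈ Metric.ball (0 : ℂ) r :=
    (analyticAt_proj k a).continuousAt.eventually_mem
      (by simpa [ha] using Metric.ball_mem_nhds (0 : ℂ) hr)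
  obtain ⟨u, hu, hgu⟩ : HolExtAt (fun w => g w / w k) a := by
    refine holExtAt_of_circleAverage (u := (Pi.single k 1 : Fin n → ℂ)) (r := r)
      (nonzeroGerm_coord k a) ?_ ?_
    · intro z hz
      rw [abs_of_pos hr] at hz
      have hz' : ‖z‖ = r := by simpa using hz
      have hz0 : z ≠ 0 := by rintro rfl; simp at hz'; exact hr.ne hz'
      refine AnalyticAt.fun_div (hdisc.self_of_nhds z ?_).1 (analyticAt_proj k _) ?_
      · simp [hz']; linarith
      · rw [add_smul_single_apply]; simpa [ha] using hz0
    · filter_upwards [hdisc, hsmall] with w hw hwk hne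
      let G : ℂ → ℂ := fun z => g (w + z • (Pi.single k 1 : Fin n → ℂ))
      have hG : DifferentiableOn ℂ G (Metric.ball 0 (2 * r)) := fun z hz =>
        ((hw z hz).1.comp (f := fun z : ℂ => w + z • (Pi.single k 1 : Fin n → ℂ))
          (by fun_prop)).differentiableAt.differentiableWithinAt
      have hmem : -w k ∈ Metric.ball (0 : ℂ) (2 * r) := by
        simp at hwk ⊢; linarith
      have hG0 : G (-w k) = 0 := by
        have h := (hw _ hmem).2
        rwa [dropCoord_of_eq_zero (by simp)] at h
      -- the slope of `G` at its zero `-w k` extends `g / y^k` holomorphically to the whole disc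
      have hD := (Complex.differentiableOn_dslope (Metric.isOpen_ball.mem_nhds hmem)).2 hG
      have hval : ∀ z, z ≠ -w k → dslope G (-w k) z
          = g (w + z • (Pi.single k 1 : Fin n → ℂ)) / (w + z • (Pi.single k 1 : Fin n → ℂ)) k := by
        intro z hz
        rw [dslope_of_ne _ hz, slope_def_field, hG0, add_smul_single_apply]
        simp [G, add_comm]
      have hsub : Metric.closedBall (0 : ℂ) |r| ⊆ Metric.ball 0 (2 * r) := by
        rw [abs_of_pos hr]; exact Metric.closedBall_subset_ball (by linarith)
      have hmean := circleAverage_of_differentiable_on_off_countable (s := ∅) (R := r) (c := 0)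
        (f := dslope G (-w k)) Set.countable_empty (hD.continuousOn.mono hsub)
        (fun z hz => hD.differentiableAt
          (Metric.isOpen_ball.mem_nhds (hsub (Metric.ball_subset_closedBall hz.1))))
      rw [hval 0 (by simpa [eq_comm] using hne)] at hmean
      simp only [zero_smul, add_zero] at hmean
      rw [← hmean]
      refine Real.circleAverage_congr_sphere fun z hz => (hval z ?_).symm
      rintro rfl
      simp [abs_of_pos hr] at hz hwk
      linarith
  have hmul : MerEqAt g (fun w => w k * u w) a := by
    have h1 : MerEqAt g (fun w => w k * (g w / w k)) a :=
      .of_germ (nonzeroGerm_coord k a) (Eventually.of_forall fun w hw => by field_simp)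
    exact h1.trans (hgu.apply fun w x => w k * x)
  exact ⟨u, hu, hmul.eventuallyEq_of_analyticAt hg ((analyticAt_proj k a).fun_mul hu)⟩

/-- Divisibility by `y^k` is tested by restriction to `{y^k = 0}`. -/
theorem nonzeroGerm_drop_of_not_dvd {g : (Fin n → ℂ) → ℂ} (hg : AnalyticAt ℂ g a) (ha : a k = 0)
    (h : ¬ CoordDvdAt k g a) : NonzeroGerm (fun w => g (dropCoord k w)) a := by
  refine ⟨?_, fun H => h (coordDvdAt_of_eventually hg ha H)⟩
  exact AnalyticAt.comp (by rwa [dropCoord_of_eq_zero ha]) (analyticAt_dropCoord k a)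

theorem tendsto_dropCoord (ha : a k = 0) : Tendsto (dropCoord k) (𝓝 a) (𝓝 a) := by
  have := (analyticAt_dropCoord k a).continuousAt.tendsto
  rwa [dropCoord_of_eq_zero ha] at this

theorem not_dvd_of_nonzeroGerm_drop {g : (Fin n → ℂ) → ℂ} (ha : a k = 0)
    (h : NonzeroGerm (fun w => g (dropCoord k w)) a) : ¬ CoordDvdAt k g a := by
  rintro ⟨u, -, hu⟩
  refine h.2 ((tendsto_dropCoord ha).eventually hu |>.mono fun w hw => ?_)
  simp [hw]

theorem NonzeroGerm.of_drop {g : (Fin n → ℂ) → ℂ} (hg : AnalyticAt ℂ g a) (ha : a k = 0)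
    (h : NonzeroGerm (fun w => g (dropCoord k w)) a) : NonzeroGerm g a :=
  ⟨hg, fun H => h.2 ((tendsto_dropCoord ha).eventually H)⟩

/-- A nonzero germ is divisible by `y^k` only finitely often: a germ divisible by all powers of
`y^k` vanishes to infinite order at `a` on each line through `a`. -/
theorem NonzeroGerm.exists_eq_pow_mul {g : (Fin n → ℂ) → ℂ} (hg : NonzeroGerm g a) (ha : a k = 0) :
    ∃ (m : ℕ) (u : (Fin n → ℂ) → ℂ), AnalyticAt ℂ u a ∧ ¬ CoordDvdAt k u a ∧
      ∀ᶠ w in 𝓝 a, g w = w k ^ m * u w := by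
  by_contra hcon
  have hall : ∀ m : ℕ, ∃ u : (Fin n → ℂ) → ℂ, AnalyticAt ℂ u a ∧
      ∀ᶠ w in 𝓝 a, g w = w k ^ m * u w := by
    intro m
    induction m with
    | zero => exact ⟨g, hg.1, by simp⟩
    | succ m ih =>
      obtain ⟨u, hu, hgu⟩ := ih
      have hdvd : CoordDvdAt k u a := by
        by_contra h
        exact hcon ⟨m, u, hu, h, hgu⟩
      obtain ⟨v, hv, huv⟩ := hdvd
      refine ⟨v, hv, ?_⟩
      filter_upwards [hgu, huv] with w h1 h2
      rw [h1, h2]; ring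
  obtain ⟨r, hr, hball⟩ := Metric.eventually_nhds_iff_ball.1 hg.1.eventually_analyticAt
  refine hg.2 ?_
  filter_upwards [Metric.ball_mem_nhds a hr] with b hb
  -- the identity theorem on the line through `a` and `b`
  let line : ℂ → Fin n → ℂ := fun t => a + t • (b - a)
  have hline : Continuous line := by fun_prop
  have hla : ∀ t, AnalyticAt ℂ line t := fun t => by fun_prop
  have hl0 : line 0 = a := by simp [line]
  have hl1 : line 1 = b := by simp [line]
  have horder : ∀ᶠ t in 𝓝 (0 : ℂ), g (line t) = 0 := by
    rw [← analyticOrderAt_eq_top, ENat.eq_top_iff_forall_ge]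
    intro m
    have hgl : AnalyticAt ℂ (fun t => g (line t)) 0 :=
      AnalyticAt.comp (by rw [hl0]; exact hg.1) (hla 0)
    rw [natCast_le_analyticOrderAt hgl]
    obtain ⟨u, hu, hgu⟩ := hall m
    refine ⟨fun t => (b - a) k ^ m * u (line t), ?_, ?_⟩
    · exact analyticAt_const.fun_mul (AnalyticAt.comp (by rw [hl0]; exact hu) (hla 0))
    · have : Tendsto line (𝓝 0) (𝓝 a) := by simpa [hl0] using hline.tendsto 0
      filter_upwards [this.eventually hgu] with t ht
      rw [ht]
      have : line t k = t * (b - a) k := by simp [line, ha]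
      rw [this, mul_pow, sub_zero, smul_eq_mul, mul_assoc]
  have hconv : IsPreconnected (line ⁻¹' Metric.ball a r) := by
    have : Convex ℝ (line ⁻¹' Metric.ball a r) := by
      intro x hx y hy s t hs ht hst
      have h := (convex_ball a r) hx hy hs ht hst
      have h2 : line (s • x + t • y) = s • line x + t • line y := by
        ext j
        have h3 : (s : ℂ) + t = 1 := by exact_mod_cast hst
        simp only [line, Pi.add_apply, Pi.smul_apply, Pi.sub_apply, smul_eq_mul,
          Complex.real_smul]
        linear_combination (-(a j)) * h3
      rw [Set.mem_preimage, h2]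
      exact h
    exact this.isPreconnected
  have hzero := AnalyticOnNhd.eqOn_zero_of_preconnected_of_eventuallyEq_zero (𝕜 := ℂ)
    (f := fun t => g (line t)) (U := line ⁻¹' Metric.ball a r)
    (fun t ht => (hball _ ht).comp (hla t)) hconv
    (by rw [Set.mem_preimage, hl0]; exact Metric.mem_ball_self hr) horder
  have := hzero (x := 1) (by rw [Set.mem_preimage, hl1]; exact hb)
  simpa [hl1] using this

/-- A nonzero meromorphic germ has an order along a coordinate hyperplane. -/
theorem IsMerAt.exists_hasOrderAlong {f : (Fin n → ℂ) → ℂ} (hf : IsMerAt f a) (ha : a k = 0)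
    (h0 : ¬ MerEqAt f (fun _ => 0) a) : ∃ m, HasOrderAlong k f a m := by
  obtain ⟨g, h, hg, hh, hh0, hfgh⟩ := hf
  have hg0 : NonzeroGerm g a := by
    refine ⟨hg, fun H => h0 (hfgh.trans (.of_eventuallyEq ?_))⟩
    filter_upwards [H] with w hw
    simp [hw]
  obtain ⟨p, u, hu, hu1, hgu⟩ := hg0.exists_eq_pow_mul (k := k) ha
  obtain ⟨s, v, hv, hv1, hhv⟩ := NonzeroGerm.exists_eq_pow_mul (k := k) ⟨hh, hh0⟩ ha
  refine ⟨(p : ℤ) - s, u, v, hu, hv, hu1, hv1, hfgh.trans (.of_germ (nonzeroGerm_coord k a) ?_)⟩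
  filter_upwards [hgu, hhv] with w h1 h2 h3
  rw [h1, h2, zpow_sub₀ h3, zpow_natCast, zpow_natCast, mul_div_mul_comm]

/-- If the function is not zero near `a`, then `orderAlong` is an order. -/
theorem IsMerAt.orderAlong_spec {f : (Fin n → ℂ) → ℂ} (hf : IsMerAt f a) (ha : a k = 0)
    (h0 : ¬ MerEqAt f (fun _ => 0) a) :
    ∃ m : ℤ, HasOrderAlong k f a m ∧ orderAlong k f a = (m : WithTop ℤ) := by
  refine ⟨_, Classical.epsilon_spec (hf.exists_hasOrderAlong ha h0), ?_⟩
  rw [orderAlong, if_neg h0]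

/-- A holomorphic germ has no pole along `{y^k = 0}`: if it is of the form `c (y^k)^M G / H` where
`G` does not vanish on this hyperplane, then `M ≥ 0`. -/
theorem nonneg_of_merEqAt_zpow {F G H : (Fin n → ℂ) → ℂ} {c : ℂ} {M : ℤ}
    (hF : AnalyticAt ℂ F a) (hG : AnalyticAt ℂ G a) (hH : AnalyticAt ℂ H a) (ha : a k = 0)
    (hc : c ≠ 0) (hG0 : NonzeroGerm (fun w => G (dropCoord k w)) a) (hH0 : NonzeroGerm H a)
    (hFM : MerEqAt F (fun w => c * w k ^ M * (G w / H w)) a) : 0 ≤ M := by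
  by_contra! hM
  obtain ⟨N, hN⟩ : ∃ N : ℕ, M = -((N : ℤ) + 1) := ⟨(-M - 1).toNat, by omega⟩
  have h1 : MerEqAt (fun w => w k ^ (N + 1) * F w * H w) (fun w => c * G w) a := by
    refine (hFM.apply fun w x => w k ^ (N + 1) * x * H w).trans
      (.of_germ ((nonzeroGerm_coord k a).mul hH0) (Eventually.of_forall fun w hw => ?_))
    have hk := left_ne_zero_of_mul hw
    have hh := right_ne_zero_of_mul hw
    rw [hN, zpow_neg, ← Nat.cast_succ, zpow_natCast]
    field_simp
  have h2 := h1.eventuallyEq_of_analyticAt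
    ((((analyticAt_proj k a).fun_pow _).fun_mul hF).fun_mul hH) (analyticAt_const.fun_mul hG)
  refine hG0.2 (((tendsto_dropCoord ha).eventually h2).mono fun w hw => ?_)
  simpa [hc] using hw.symm

/-- A meromorphic function which has no pole along `{y^k = 0}`, and no pole off this hyperplane,
is holomorphic: on generic discs transversal to the hyperplane there are no poles at all. -/
theorem holExtAt_of_order_nonneg {f G H : (Fin n → ℂ) → ℂ} {M : ℕ}
    (hf : ∀ᶠ w in 𝓝 a, w k ≠ 0 → HolExtAt f w) (hG : AnalyticAt ℂ G a) (hH : AnalyticAt ℂ H a)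
    (ha : a k = 0) (hH0 : NonzeroGerm (fun w => H (dropCoord k w)) a)
    (hfM : MerEqAt f (fun w => w k ^ M * (G w / H w)) a) : HolExtAt f a := by
  have hquot : ∀ w, AnalyticAt ℂ G w → AnalyticAt ℂ H w → H w ≠ 0 →
      AnalyticAt ℂ (fun w => w k ^ M * (G w / H w)) w := fun w h1 h2 h3 =>
    ((analyticAt_proj k w).fun_pow M).fun_mul (h1.fun_div h2 h3)
  have hΩ : ∀ᶠ w in 𝓝 a, (w k ≠ 0 ∨ H w ≠ 0) → HolExtAt f w := by
    filter_upwards [hf, hG.eventually_analyticAt, hH.eventually_analyticAt, hfM.eventually]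
      with w h1 h2 h3 h4 h5
    rcases h5 with h5 | h5
    · exact h1 h5
    · exact ⟨_, hquot w h2 h3 h5, h4⟩
  have hfF : MerEqAt f (holExt f) a := by
    refine hfM.trans (.of_germ (NonzeroGerm.of_drop hH ha hH0) ?_)
    filter_upwards [hG.eventually_analyticAt, hH.eventually_analyticAt, hfM.eventually]
      with w h2 h3 h4 h5
    exact (holExt_eventuallyEq (hquot w h2 h3 h5) h4).self_of_nhds.symm
  refine HolExtAt.congr ?_ hfF
  obtain ⟨r, hr, hdisc⟩ := exists_disc_radius (u := (Pi.single k 1 : Fin n → ℂ)) hΩ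
  have hsub : Metric.closedBall (0 : ℂ) |r| ⊆ Metric.ball 0 (2 * r) := by
    rw [abs_of_pos hr]; exact Metric.closedBall_subset_ball (by linarith)
  refine holExtAt_of_discs (u := (Pi.single k 1 : Fin n → ℂ)) (r := r) hH0 ?_ ?_
  · intro z hz
    refine (hdisc.self_of_nhds z (hsub (Metric.sphere_subset_closedBall hz))
      (Or.inl ?_)).analyticAt_holExt
    have hz' : ‖z‖ = |r| := by simpa using hz
    rw [add_smul_single_apply]
    rintro h0
    simp [ha] at h0
    simp only [h0, norm_zero] at hz'
    exact (abs_pos.2 hr.ne').ne hz'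
  · -- such a disc meets the hyperplane at most in `dropCoord k w`, where `H` is not zero
    filter_upwards [hdisc] with w hw hne z hz
    refine (hw z (hsub hz) ?_).analyticAt_holExt
    by_cases h0 : (w + z • (Pi.single k 1 : Fin n → ℂ)) k = 0
    · right
      rw [← dropCoord_of_eq_zero h0, dropCoord_add_smul_single]
      exact hne
    · exact Or.inl h0

end Order

/-! ### Pullback of tensor fields -/

section Pullback

open ContinuousLinearMap

variable {E F G : Type*} [NormedAddCommGroup E] [NormedSpace ℂ E]
  [NormedAddCommGroup F] [NormedSpace ℂ F] [NormedAddCommGroup G] [NormedSpace ℂ G] {p q : ℕ}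

theorem tensorPullback_comp {A : E →L[ℂ] F} {B : F →L[ℂ] G} (hA : A.IsInvertible)
    (T : Tensor p q G) : tensorPullback (B ∘L A) T = tensorPullback A (tensorPullback B T) := by
  ext α x
  simp only [tensorPullback_apply, hA.inverse_comp_of_right]
  rfl

theorem tensorPullback_id (T : Tensor p q E) :
    tensorPullback (ContinuousLinearMap.id ℂ E) T = T := by
  ext α x
  simp [tensorPullback_apply]

theorem tensorPullback_inverse {A : E →L[ℂ] F} (hA : A.IsInvertible) (T : Tensor p q E) :
    tensorPullback A (tensorPullback A.inverse T) = T := by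
  rw [← tensorPullback_comp hA, hA.inverse_comp_self]
  exact tensorPullback_id T

theorem tensorPullback_inverse' {A : E →L[ℂ] F} (hA : A.IsInvertible) (T : Tensor p q F) :
    tensorPullback A.inverse (tensorPullback A T) = T := by
  rw [← tensorPullback_comp hA.inverse, hA.self_comp_inverse]
  exact tensorPullback_id T

theorem analyticAt_inverse [CompleteSpace E] {A : G → E →L[ℂ] F} {x : G} (hA : AnalyticAt ℂ A x)
    (hi : (A x).IsInvertible) : AnalyticAt ℂ (fun v => (A v).inverse) x := by
  have h : AnalyticAt ℂ (ContinuousLinearMap.inverse : (E →L[ℂ] F) → (F →L[ℂ] E)) (A x) :=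
    (ContinuousLinearMap.IsInvertible.contDiffAt_map_inverse (n := ⊤) hi).analyticAt
  exact h.comp hA

theorem analyticAt_comp_precomp {N M : Type*} [NormedAddCommGroup N] [NormedSpace ℂ N]
    [NormedAddCommGroup M] [NormedSpace ℂ M] [CompleteSpace E] {A : G → E →L[ℂ] F}
    {L : G → N →L[ℂ] M} {T : G → ContinuousMultilinearMap ℂ (fun _ : Fin p => F →L[ℂ] ℂ) N} {x : G}
    (hA : AnalyticAt ℂ A x) (hL : AnalyticAt ℂ L x) (hT : AnalyticAt ℂ T x)
    (hi : (A x).IsInvertible) :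
    AnalyticAt ℂ (fun v => (L v).compContinuousMultilinearMap ((T v).compContinuousLinearMap
      fun _ : Fin p => ContinuousLinearMap.precomp ℂ (A v).inverse)) x := by
  have h1 : AnalyticAt ℂ (fun v => fun _ : Fin p => (ContinuousLinearMap.precomp ℂ (A v).inverse :
      (E →L[ℂ] ℂ) →L[ℂ] (F →L[ℂ] ℂ))) x := by
    refine analyticAt_pi_iff.2 fun _ => ?_
    have h0 : IsBoundedLinearMap ℂ fun B : F →L[ℂ] E => (ContinuousLinearMap.precomp ℂ B :
        (E →L[ℂ] ℂ) →L[ℂ] (F →L[ℂ] ℂ)) := by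
      refine IsLinearMap.with_bound ⟨fun B C => ?_, fun c B => ?_⟩ 1 fun B => ?_
      · ext α y; simp
      · ext α y; simp
      · rw [one_mul]
        refine ContinuousLinearMap.opNorm_le_bound _ (norm_nonneg _) fun α => ?_
        rw [mul_comm]
        exact α.opNorm_comp_le B
    exact AnalyticAt.comp (g := fun B : F →L[ℂ] E => (ContinuousLinearMap.precomp ℂ B :
        (E →L[ℂ] ℂ) →L[ℂ] (F →L[ℂ] ℂ))) (h0.contDiff (n := ⊤)).contDiffAt.analyticAt
      (analyticAt_inverse hA hi)
  have h2 : AnalyticAt ℂ (fun v => (T v).compContinuousLinearMap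
      fun _ : Fin p => ContinuousLinearMap.precomp ℂ (A v).inverse) x :=
    AnalyticAt.comp
      (f := fun v => ((fun _ : Fin p => ContinuousLinearMap.precomp ℂ (A v).inverse), T v))
      (ContinuousMultilinearMap.analyticAt_uncurry_compContinuousLinearMap
        (Em := fun _ : Fin p => F →L[ℂ] ℂ) (Fm := fun _ : Fin p => E →L[ℂ] ℂ)) (h1.prod hT)
  have h3 := (isBoundedBilinearMap_compMultilinear (𝕜 := ℂ) (E := fun _ : Fin p => E →L[ℂ] ℂ)
    (F := N) (G := M)).contDiff (n := ⊤)
  exact AnalyticAt.comp (f := fun v => (L v, (T v).compContinuousLinearMap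
      fun _ : Fin p => ContinuousLinearMap.precomp ℂ (A v).inverse))
    h3.contDiffAt.analyticAt (hL.prod h2)

theorem analyticAt_tensorPullback [CompleteSpace E] {A : G → E →L[ℂ] F} {T : G → Tensor p q F}
    {x : G} (hA : AnalyticAt ℂ A x) (hT : AnalyticAt ℂ T x) (hi : (A x).IsInvertible) :
    AnalyticAt ℂ (fun v => tensorPullback (A v) (T v)) x := by
  have h1 : AnalyticAt ℂ (fun v => (ContinuousMultilinearMap.compContinuousLinearMapL
      fun _ : Fin q => A v : ContinuousMultilinearMap ℂ (fun _ : Fin q => F) ℂ →L[ℂ]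
        ContinuousMultilinearMap ℂ (fun _ : Fin q => E) ℂ)) x :=
    AnalyticAt.comp (g := fun B : Fin q → (E →L[ℂ] F) =>
        ContinuousMultilinearMap.compContinuousLinearMapContinuousMultilinear ℂ
          (fun _ : Fin q => E) (fun _ : Fin q => F) ℂ B)
      (f := fun v => fun _ : Fin q => A v)
      (ContinuousMultilinearMap.analyticAt _) (analyticAt_pi_iff.2 fun _ => hA)
  exact analyticAt_comp_precomp (N := ContinuousMultilinearMap ℂ (fun _ : Fin q => F) ℂ)
    (M := ContinuousMultilinearMap ℂ (fun _ : Fin q => E) ℂ) hA h1 hT hi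

/-- An analytic map with invertible derivative is open. -/
theorem nhds_le_map_of_isInvertible [CompleteSpace E] {f : E → F} {a : E} (hf : AnalyticAt ℂ f a)
    (hi : (fderiv ℂ f a).IsInvertible) : 𝓝 (f a) ≤ map f (𝓝 a) := by
  obtain ⟨e, he⟩ := hi
  have h := hf.hasStrictFDerivAt
  rw [← he] at h
  exact h.map_nhds_eq_of_equiv.ge

theorem eventually_isInvertible {G : Type*} [TopologicalSpace G] [CompleteSpace E]
    {A : G → E →L[ℂ] F} {a : G} (hA : ContinuousAt A a) (hi : (A a).IsInvertible) :
    ∀ᶠ x in 𝓝 a, (A x).IsInvertible := by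
  obtain ⟨e, he⟩ := hi
  have := ContinuousLinearEquiv.nhds e
  rw [he] at this
  filter_upwards [hA this] with x hx
  obtain ⟨e', he'⟩ := hx
  exact ⟨e', he'⟩

theorem eventually_isInvertible_fderiv [CompleteSpace E] [CompleteSpace F] {f : E → F} {a : E}
    (hf : AnalyticAt ℂ f a) (hi : (fderiv ℂ f a).IsInvertible) :
    ∀ᶠ x in 𝓝 a, (fderiv ℂ f x).IsInvertible :=
  eventually_isInvertible hf.fderiv.continuousAt hi

theorem MerEqAt.pullbackField {f : E → F} {a : E} {S T : F → Tensor p q F}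
    (h : MerEqAt S T (f a)) (hf : AnalyticAt ℂ f a) (hopen : 𝓝 (f a) ≤ map f (𝓝 a)) :
    MerEqAt (pullbackField f S) (pullbackField f T) a :=
  (h.comp hf hopen).apply fun w X => tensorPullback (fderiv ℂ f w) X

theorem analyticAt_pullbackField [CompleteSpace E] [CompleteSpace F] {f : E → F} {a : E}
    {T : F → Tensor p q F} (hT : AnalyticAt ℂ T (f a)) (hf : AnalyticAt ℂ f a)
    (hi : (fderiv ℂ f a).IsInvertible) : AnalyticAt ℂ (pullbackField f T) a :=
  analyticAt_tensorPullback hf.fderiv (hT.comp hf) hi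

theorem HolExtAt.pullbackField [CompleteSpace E] [CompleteSpace F] {f : E → F} {a : E}
    {T : F → Tensor p q F} (hT : HolExtAt T (f a)) (hf : AnalyticAt ℂ f a)
    (hi : (fderiv ℂ f a).IsInvertible) : HolExtAt (pullbackField f T) a := by
  obtain ⟨g, hg, h⟩ := hT
  exact ⟨_, analyticAt_pullbackField hg hf hi,
    h.pullbackField hf (nhds_le_map_of_isInvertible hf hi)⟩

theorem pullbackField_congr {f g : E → F} {a : E} (h : f =ᶠ[𝓝 a] g) (T : F → Tensor p q F) :
    pullbackField f T =ᶠ[𝓝 a] pullbackField g T := by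
  filter_upwards [h.eventuallyEq_nhds] with w hw
  simp only [OrbitTensor.pullbackField, hw.fderiv_eq, hw.self_of_nhds]

theorem pullbackField_comp {f : E → F} {g : F → G} {a : E} (hf : DifferentiableAt ℂ f a)
    (hg : DifferentiableAt ℂ g (f a)) (hi : (fderiv ℂ f a).IsInvertible) (T : G → Tensor p q G) :
    pullbackField (fun x => g (f x)) T a = pullbackField f (pullbackField g T) a := by
  simp only [OrbitTensor.pullbackField]
  rw [fderiv_fun_comp a hg hf, tensorPullback_comp hi]

/-- The local inverse of a local biholomorphism. -/
theorem exists_local_inverse [CompleteSpace E] [CompleteSpace F] {f : E → F} {a : E}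
    (hf : AnalyticAt ℂ f a) (hi : (fderiv ℂ f a).IsInvertible) :
    ∃ e : OpenPartialHomeomorph E F, a ∈ e.source ∧ (e : E → F) = f ∧
      (∀ x ∈ e.source, AnalyticAt ℂ f x ∧ (fderiv ℂ f x).IsInvertible) ∧
      ∀ y ∈ e.target, AnalyticAt ℂ e.symm y ∧ (fderiv ℂ e.symm y).IsInvertible := by
  obtain ⟨A, hA⟩ := id hi
  have hs := hf.hasStrictFDerivAt
  rw [← hA] at hs
  obtain ⟨s, hs1, hs2, has⟩ := eventually_nhds_iff.1
    (hf.eventually_analyticAt.and (eventually_isInvertible_fderiv hf hi))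
  let e := (hs.toOpenPartialHomeomorph f).restrOpen s hs2
  have hsrc : ∀ x ∈ e.source, x ∈ s := fun x hx => by
    simp [e] at hx
    exact hx.2
  have hef : (e : E → F) = f := rfl
  refine ⟨e, ?_, hef, fun x hx => hs1 x (hsrc x hx), fun y hy => ?_⟩
  · rw [OpenPartialHomeomorph.restrOpen_source]
    exact ⟨hs.mem_toOpenPartialHomeomorph_source, has⟩
  · have hx := e.map_target hy
    obtain ⟨h1, h2⟩ := hs1 _ (hsrc _ hx)
    obtain ⟨B, hB⟩ := id h2
    have h3 : AnalyticAt ℂ e.symm y := e.analyticAt_symm hy (i := B) h1 hB.symm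
    refine ⟨h3, ?_⟩
    have h4 : HasFDerivAt e (B : E →L[ℂ] F) (e.symm y) := by
      rw [hB]; exact h1.differentiableAt.hasFDerivAt
    exact ⟨B.symm, (e.hasFDerivAt_symm hy h4).fderiv.symm⟩

end Pullback

/-! ### Components -/

section Components

variable {n p q : ℕ} {E : Type*} [NormedAddCommGroup E] [NormedSpace ℂ E]

/-- The components of a tensor on `ℂⁿ`, as a linear map. -/
def componentsLM (n p q : ℕ) :
    Tensor p q (Fin n → ℂ) →ₗ[ℂ] ((Fin p → Fin n) × (Fin q → Fin n) → ℂ) where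
  toFun T ij := component T ij.1 ij.2
  map_add' _ _ := rfl
  map_smul' _ _ := rfl

theorem componentsLM_injective : Function.Injective (componentsLM n p q) := by
  intro S T h
  have hb : ∀ i j, component S i j = component T i j := fun i j => congrFun h (i, j)
  have hcov : ∀ α : (Fin n → ℂ) →L[ℂ] ℂ, α = ∑ i, α (Pi.single i 1) •
      (ContinuousLinearMap.proj i : (Fin n → ℂ) →L[ℂ] ℂ) := by
    intro α
    ext x
    have : x = ∑ i, x i • (Pi.single i 1 : Fin n → ℂ) := by
      ext j; simp [Finset.sum_apply, Pi.single_apply]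
    conv_lhs => rw [this]
    simp [mul_comm]
  have hvec : ∀ x : Fin n → ℂ, x = ∑ i, x i • (Pi.single i 1 : Fin n → ℂ) := fun x => by
    ext j; simp [Finset.sum_apply, Pi.single_apply]
  ext α x
  have key : ∀ T : Tensor p q (Fin n → ℂ), T α x = ∑ i : Fin p → Fin n, ∑ j : Fin q → Fin n,
      (∏ s, α s (Pi.single (i s) 1)) * ((∏ t, x t (j t)) * component T i j) := by
    intro T
    have h1 : α = fun s => ∑ i, α s (Pi.single i 1) •
      (ContinuousLinearMap.proj i : (Fin n → ℂ) →L[ℂ] ℂ) := funext fun s => hcov _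
    have h2 : x = fun t => ∑ i, x t i • (Pi.single i 1 : Fin n → ℂ) := funext fun s => hvec _
    have h3 : T α = ∑ i : Fin p → Fin n, (∏ s, α s (Pi.single (i s) 1)) •
        T fun s => (ContinuousLinearMap.proj (i s) : (Fin n → ℂ) →L[ℂ] ℂ) := by
      conv_lhs => rw [h1]
      rw [ContinuousMultilinearMap.map_sum]
      exact Finset.sum_congr rfl fun i _ => ContinuousMultilinearMap.map_smul_univ _ _ _
    have h4 : ∀ i : Fin p → Fin n,
        T (fun s => (ContinuousLinearMap.proj (i s) : (Fin n → ℂ) →L[ℂ] ℂ)) x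
          = ∑ j : Fin q → Fin n, (∏ t, x t (j t)) * component T i j := by
      intro i
      conv_lhs => rw [h2]
      rw [ContinuousMultilinearMap.map_sum]
      exact Finset.sum_congr rfl fun j _ => ContinuousMultilinearMap.map_smul_univ _ _ _
    rw [h3, sum_apply]
    refine Finset.sum_congr rfl fun i _ => ?_
    rw [smul_apply, h4, smul_eq_mul, Finset.mul_sum]
  rw [key S, key T]
  simp_rw [hb]

omit [NormedAddCommGroup E] [NormedSpace ℂ E] in
/-- An injective linear map into a finite-dimensional space is analytic, and so is a left inverse
of it. -/
theorem exists_analytic_leftInverse {N W : Type*} [NormedAddCommGroup N] [NormedSpace ℂ N]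
    [NormedAddCommGroup W] [NormedSpace ℂ W] [FiniteDimensional ℂ W] {f : N → W}
    (hadd : ∀ x y, f (x + y) = f x + f y) (hsmul : ∀ (c : ℂ) x, f (c • x) = c • f x)
    (hinj : Function.Injective f) :
    (∀ x, AnalyticAt ℂ f x) ∧ ∃ R : W → N, (∀ x, R (f x) = x) ∧ ∀ y, AnalyticAt ℂ R y := by
  let L : N →ₗ[ℂ] W := { toFun := f, map_add' := hadd, map_smul' := hsmul }
  have hfin : FiniteDimensional ℂ N := FiniteDimensional.of_injective L hinj
  obtain ⟨R, hR⟩ := L.exists_leftInverse_of_injective (LinearMap.ker_eq_bot.2 hinj)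
  exact ⟨fun x => L.toContinuousLinearMap.analyticAt x, R,
    fun x => LinearMap.congr_fun hR x, fun y => R.toContinuousLinearMap.analyticAt y⟩

/-- Tensors on `ℂⁿ` are determined by their components, in a way which preserves analyticity. -/
theorem exists_components_leftInverse (n p q : ℕ) :
    (∀ T, AnalyticAt ℂ (componentsLM n p q) T) ∧
      ∃ R : ((Fin p → Fin n) × (Fin q → Fin n) → ℂ) → Tensor p q (Fin n → ℂ),
        (∀ T, R (componentsLM n p q T) = T) ∧ ∀ y, AnalyticAt ℂ R y :=
  exists_analytic_leftInverse (fun _ _ => rfl) (fun _ _ => rfl) componentsLM_injective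

theorem analyticAt_component {T : E → Tensor p q (Fin n → ℂ)} {a : E} (hT : AnalyticAt ℂ T a)
    (i : Fin p → Fin n) (j : Fin q → Fin n) : AnalyticAt ℂ (fun w => component (T w) i j) a :=
  analyticAt_pi_iff.1 (((exists_components_leftInverse n p q).1 (T a)).comp hT) (i, j)

/-- A tensor field is holomorphic up to thin sets if its components are. -/
theorem holExtAt_of_components {T : E → Tensor p q (Fin n → ℂ)} {a : E}
    (h : ∀ i j, HolExtAt (fun w => component (T w) i j) a) : HolExtAt T a := by
  obtain ⟨R, hR, hRa⟩ := (exists_components_leftInverse n p q).2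
  choose g hg hgT using h
  refine ⟨fun w => R fun ij => g ij.1 ij.2 w, ?_, ?_⟩
  · exact AnalyticAt.comp (f := fun w (ij : (Fin p → Fin n) × (Fin q → Fin n)) => g ij.1 ij.2 w)
      (hRa _) (analyticAt_pi_iff.2 fun ij => hg ij.1 ij.2)
  · choose k hk hkT using fun i j => (hgT i j).exists_germ
    refine .of_germ (NonzeroGerm.prod (Finset.univ : Finset ((Fin p → Fin n) × (Fin q → Fin n)))
      (h := fun ij => k ij.1 ij.2) fun ij _ => hk ij.1 ij.2) ?_
    have hall : ∀ᶠ w in 𝓝 a, ∀ ij : (Fin p → Fin n) × (Fin q → Fin n),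
        k ij.1 ij.2 w ≠ 0 → component (T w) ij.1 ij.2 = g ij.1 ij.2 w :=
      eventually_all.2 fun ij => hkT ij.1 ij.2
    filter_upwards [hall] with w hw hne
    have h1 : componentsLM n p q (T w) = fun ij => g ij.1 ij.2 w := by
      ext ij
      exact hw ij (Finset.prod_ne_zero_iff.1 hne ij (Finset.mem_univ _))
    rw [← h1, hR]

/-- The map `(y^1, …, y^n) ↦ (y^1, …, (y^k)^e, …, y^n)`. -/
def powCoord (k : Fin n) (e : ℕ) (t : Fin n → ℂ) : Fin n → ℂ := Function.update t k (t k ^ e)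

@[simp] theorem powCoord_self (k : Fin n) (e : ℕ) (t : Fin n → ℂ) :
    powCoord k e t k = t k ^ e := by simp [powCoord]

@[simp] theorem powCoord_of_ne {k j : Fin n} (h : j ≠ k) (e : ℕ) (t : Fin n → ℂ) :
    powCoord k e t j = t j := by simp [powCoord, h]

theorem powCoord_of_eq_zero {k : Fin n} {e : ℕ} (he : e ≠ 0) {t : Fin n → ℂ} (h : t k = 0) :
    powCoord k e t = t := by
  ext j
  by_cases hj : j = k
  · subst hj; simp [h, he]
  · simp [hj]

theorem powCoord_dropCoord {k : Fin n} {e : ℕ} (he : e ≠ 0) (t : Fin n → ℂ) :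
    powCoord k e (dropCoord k t) = dropCoord k t := powCoord_of_eq_zero he (by simp)

theorem analyticAt_powCoord (k : Fin n) (e : ℕ) (t : Fin n → ℂ) :
    AnalyticAt ℂ (powCoord k e) t :=
  analyticAt_update k analyticAt_id ((analyticAt_proj k t).fun_pow e)

/-- The eigenvalues of the derivative of `powCoord k e`. -/
def powCoordEigenvalue (k : Fin n) (e : ℕ) (t : Fin n → ℂ) (j : Fin n) : ℂ :=
  if j = k then e * t k ^ (e - 1) else 1

theorem powCoordEigenvalue_ne_zero {k : Fin n} {e : ℕ} (he : e ≠ 0) {t : Fin n → ℂ}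
    (ht : t k ≠ 0) (j : Fin n) : powCoordEigenvalue k e t j ≠ 0 := by
  unfold powCoordEigenvalue
  split_ifs
  · exact mul_ne_zero (by exact_mod_cast he) (pow_ne_zero _ ht)
  · exact one_ne_zero

theorem fderiv_powCoord_apply (k : Fin n) (e : ℕ) (t x : Fin n → ℂ) (j : Fin n) :
    fderiv ℂ (powCoord k e) t x j = powCoordEigenvalue k e t j * x j := by
  have h : HasFDerivAt (powCoord k e) (ContinuousLinearMap.pi fun j =>
      powCoordEigenvalue k e t j • (ContinuousLinearMap.proj j : (Fin n → ℂ) →L[ℂ] ℂ)) t := by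
    rw [hasFDerivAt_pi]
    intro j
    have hp := (ContinuousLinearMap.proj (R := ℂ) (φ := fun _ : Fin n => ℂ) j).hasFDerivAt (x := t)
    by_cases hj : j = k
    · subst hj
      have h1 : (fun x => powCoord j e x j) = fun x : Fin n → ℂ => x j ^ e := by ext w; simp
      rw [h1]
      exact (hp.pow e).congr_fderiv (by ext w; simp [powCoordEigenvalue])
    · have h1 : (fun x => powCoord k e x j) = fun x : Fin n → ℂ => x j := by ext w; simp [hj]
      rw [h1]
      exact hp.congr_fderiv (by ext w; simp [powCoordEigenvalue, hj])
  rw [h.fderiv]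
  simp

theorem isInvertible_fderiv_powCoord {k : Fin n} {e : ℕ} (he : e ≠ 0) {t : Fin n → ℂ}
    (ht : t k ≠ 0) : (fderiv ℂ (powCoord k e) t).IsInvertible := by
  refine ContinuousLinearMap.IsInvertible.of_inverse (g := ContinuousLinearMap.pi fun j =>
      (powCoordEigenvalue k e t j)⁻¹ • (ContinuousLinearMap.proj j : (Fin n → ℂ) →L[ℂ] ℂ)) ?_ ?_
  · ext x j
    have := powCoordEigenvalue_ne_zero he ht j
    simp only [ContinuousLinearMap.comp_apply, fderiv_powCoord_apply]
    simp [this]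
  · ext x j
    have := powCoordEigenvalue_ne_zero he ht j
    simp [fderiv_powCoord_apply, this]

/-- The number of indices equal to `k`. -/
def indexCount {m : ℕ} (i : Fin m → Fin n) (k : Fin n) : ℕ :=
  (Finset.univ.filter fun s => i s = k).card

theorem prod_powCoordEigenvalue {m : ℕ} (k : Fin n) (e : ℕ) (t : Fin n → ℂ) (i : Fin m → Fin n) :
    ∏ s, powCoordEigenvalue k e t (i s) = (e * t k ^ (e - 1)) ^ indexCount i k := by
  simp only [powCoordEigenvalue, indexCount, Finset.prod_ite, Finset.prod_const, one_pow, mul_one]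

/-- The components of the pullback of a tensor field along `powCoord k e`: each covariant index `k`
contributes a factor `e (y^k)^(e - 1)`, each contravariant index `k` its inverse. -/
theorem component_pullbackField_powCoord {k : Fin n} {e : ℕ} (he : e ≠ 0) {t : Fin n → ℂ}
    (ht : t k ≠ 0) (T : (Fin n → ℂ) → Tensor p q (Fin n → ℂ)) (i : Fin p → Fin n)
    (j : Fin q → Fin n) :
    component (pullbackField (powCoord k e) T t) i j
      = (e * t k ^ (e - 1)) ^ ((indexCount j k : ℤ) - indexCount i k)
        * component (T (powCoord k e t)) i j := by
  have hinv := isInvertible_fderiv_powCoord he ht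
  have hcov : ∀ l : Fin n, (ContinuousLinearMap.proj l : (Fin n → ℂ) →L[ℂ] ℂ).comp
      (fderiv ℂ (powCoord k e) t).inverse
      = (powCoordEigenvalue k e t l)⁻¹ • (ContinuousLinearMap.proj l : (Fin n → ℂ) →L[ℂ] ℂ) := by
    intro l
    refine ContinuousLinearMap.ext fun x => ?_
    have h1 := congrFun (hinv.self_apply_inverse x) l
    rw [fderiv_powCoord_apply] at h1
    have := powCoordEigenvalue_ne_zero he ht l
    change (fderiv ℂ (powCoord k e) t).inverse x l = (powCoordEigenvalue k e t l)⁻¹ * x l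
    rw [← h1]
    field_simp
  have hvec : ∀ l : Fin n, fderiv ℂ (powCoord k e) t (Pi.single l 1)
      = powCoordEigenvalue k e t l • (Pi.single l 1 : Fin n → ℂ) := by
    intro l
    ext m
    rw [fderiv_powCoord_apply]
    by_cases hm : m = l
    · subst hm; simp
    · simp [hm]
  rw [component, pullbackField, tensorPullback_apply]
  simp_rw [hcov, hvec]
  rw [ContinuousMultilinearMap.map_smul_univ, ContinuousMultilinearMap.map_smul_univ,
    smul_apply, prod_powCoordEigenvalue, Finset.prod_inv_distrib,
    prod_powCoordEigenvalue, zpow_sub₀, zpow_natCast, zpow_natCast]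
  · simp only [smul_eq_mul, component]
    ring
  · exact mul_ne_zero (by exact_mod_cast he) (pow_ne_zero _ ht)

end Components

/-! ### The power map -/

section PowCoord

variable {n : ℕ} {k : Fin n} {e : ℕ}

theorem isOpenMap_powCoord (he : e ≠ 0) : IsOpenMap (powCoord k e) := by
  have h : powCoord k e = Pi.map fun j : Fin n => if j = k then (fun z : ℂ => z ^ e) else id := by
    ext t j
    by_cases hj : j = k
    · subst hj; simp
    · simp [hj]
  rw [h]
  refine IsOpenMap.piMap (A := fun _ : Fin n => ℂ) (B := fun _ : Fin n => ℂ) (fun j => ?_)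
    (by simp [Filter.cofinite_eq_bot])
  by_cases hj : j = k
  · simp only [hj, if_true]
    rcases AnalyticOnNhd.is_constant_or_isOpen (g := fun z : ℂ => z ^ e) (U := Set.univ)
      (fun z _ => by fun_prop) isPreconnected_univ with ⟨w, hw⟩ | h
    · have h0 := hw 0 trivial
      have h1 := hw 1 trivial
      simp [he] at h0 h1
      exact absurd (h1.trans h0.symm) one_ne_zero
    · exact fun s hs => h s (Set.subset_univ s) hs
  · simp only [hj, if_false]
    exact IsOpenMap.id

/-- A function on `ℂⁿ` is holomorphic if its composition with `powCoord k e` is holomorphic: it is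
continuous, and holomorphic off `{y^k = 0}`, so it has the mean value property on the discs parallel
to the `k`-th axis. -/
theorem analyticAt_of_comp_powCoord (he : e ≠ 0) {f : (Fin n → ℂ) → ℂ} {t : Fin n → ℂ}
    (hf : AnalyticAt ℂ (fun s => f (powCoord k e s)) t) : AnalyticAt ℂ f (powCoord k e t) := by
  have hoff : ∀ s, AnalyticAt ℂ (fun s => f (powCoord k e s)) s → s k ≠ 0 →
      AnalyticAt ℂ f (powCoord k e s) := by
    intro s hs hsk
    obtain ⟨E, hsE, hE, -, hEt⟩ := exists_local_inverse (analyticAt_powCoord k e s)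
      (isInvertible_fderiv_powCoord he hsk)
    have hmem : powCoord k e s ∈ E.target := by rw [← hE]; exact E.map_source hsE
    have hback : E.symm (powCoord k e s) = s := by rw [← hE]; exact E.left_inv hsE
    have h1 : AnalyticAt ℂ (fun y => f (powCoord k e (E.symm y))) (powCoord k e s) :=
      AnalyticAt.comp (g := fun s => f (powCoord k e s)) (by rwa [hback]) (hEt _ hmem).1
    refine h1.congr ?_
    filter_upwards [E.open_target.mem_nhds hmem] with y hy
    rw [← hE, E.right_inv hy]
  by_cases htk : t k ≠ 0
  · exact hoff t hf htk
  rw [not_not] at htk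
  have htt : powCoord k e t = t := powCoord_of_eq_zero he htk
  rw [htt]
  have hop : 𝓝 t ≤ map (powCoord k e) (𝓝 t) := by
    have := (isOpenMap_powCoord (k := k) he).nhds_le t
    rwa [htt] at this
  have hnear : ∀ᶠ y in 𝓝 t, ∃ s, powCoord k e s = y ∧
      AnalyticAt ℂ (fun s => f (powCoord k e s)) s :=
    hop (hf.eventually_analyticAt.mono fun s hs => ⟨s, rfl, hs⟩)
  have han : ∀ᶠ y in 𝓝 t, y k ≠ 0 → AnalyticAt ℂ f y := by
    filter_upwards [hnear] with y hy hyk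
    obtain ⟨s, rfl, hs⟩ := hy
    refine hoff s hs fun h0 => hyk ?_
    simp [h0, he]
  have hcont : ∀ᶠ y in 𝓝 t, ContinuousAt f y := by
    filter_upwards [hnear] with y hy
    obtain ⟨s, rfl, hs⟩ := hy
    exact (tendsto_map'_iff (f := f) (g := powCoord k e) (x := 𝓝 s)).2 hs.continuousAt
      |>.mono_left ((isOpenMap_powCoord (k := k) he).nhds_le s)
  obtain ⟨r, hr, hdisc⟩ := exists_disc_radius (u := (Pi.single k 1 : Fin n → ℂ)) (han.and hcont)
  have hsub : Metric.closedBall (0 : ℂ) |r| ⊆ Metric.ball 0 (2 * r) := by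
    rw [abs_of_pos hr]; exact Metric.closedBall_subset_ball (by linarith)
  obtain ⟨g, hg, hfg⟩ : HolExtAt f t := by
    refine holExtAt_of_circleAverage (u := (Pi.single k 1 : Fin n → ℂ)) (r := r)
      (nonzeroGerm_one t) ?_ ?_
    · intro z hz
      refine (hdisc.self_of_nhds z (hsub (Metric.sphere_subset_closedBall hz))).1 ?_
      rw [add_smul_single_apply, if_pos rfl, htk, zero_add]
      rintro rfl
      simp at hz
      exact (abs_pos.2 hr.ne').ne hz
    · filter_upwards [hdisc] with w hw _
      have hline : Continuous fun z : ℂ => w + z • (Pi.single k 1 : Fin n → ℂ) := by fun_prop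
      have := circleAverage_of_differentiable_on_off_countable (s := {-w k}) (R := r) (c := 0)
        (f := fun z : ℂ => f (w + z • (Pi.single k 1 : Fin n → ℂ))) (Set.countable_singleton _)
        (fun z hz => (ContinuousAt.comp (f := fun z : ℂ => w + z • (Pi.single k 1 : Fin n → ℂ))
          (hw z (hsub hz)).2 hline.continuousAt).continuousWithinAt)
        (fun z hz => ?_)
      · simpa using this
      · refine (((hw z (hsub (Metric.ball_subset_closedBall hz.1))).1 ?_).comp
          (f := fun z : ℂ => w + z • (Pi.single k 1 : Fin n → ℂ)) (by fun_prop)).differentiableAt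
        rw [add_smul_single_apply, if_pos rfl]
        intro h0
        exact hz.2 (eq_neg_of_add_eq_zero_right h0)
  exact hg.congr (hfg.eventuallyEq hcont
    (hg.eventually_analyticAt.mono fun _ h => h.continuousAt)).symm

end PowCoord

/-! ### The group action -/

section Action

variable {V : Type*} [NormedAddCommGroup V] [NormedSpace ℂ V] [FiniteDimensional ℂ V]

/-- The action of an element of `GL(V)` as a continuous linear equivalence. -/
def smulCLE (g : LinearMap.GeneralLinearGroup ℂ V) : V ≃L[ℂ] V :=
  (LinearMap.GeneralLinearGroup.generalLinearEquiv ℂ V g).toContinuousLinearEquiv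

theorem smul_eq_coe (g : LinearMap.GeneralLinearGroup ℂ V) :
    (fun x : V => g • x) = (smulCLE g : V →L[ℂ] V) := rfl

theorem analyticAt_smul (g : LinearMap.GeneralLinearGroup ℂ V) (v : V) :
    AnalyticAt ℂ (fun x : V => g • x) v := by
  rw [smul_eq_coe]; exact ContinuousLinearMap.analyticAt _ _

theorem fderiv_smul_gl (g : LinearMap.GeneralLinearGroup ℂ V) (v : V) :
    fderiv ℂ (fun x : V => g • x) v = (smulCLE g : V →L[ℂ] V) := by
  rw [smul_eq_coe]; exact ContinuousLinearMap.fderiv _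

theorem isInvertible_fderiv_smul (g : LinearMap.GeneralLinearGroup ℂ V) (v : V) :
    (fderiv ℂ (fun x : V => g • x) v).IsInvertible := by
  rw [fderiv_smul_gl]; exact ContinuousLinearMap.isInvertible_equiv

instance continuousConstSMul_gl :
    ContinuousConstSMul (LinearMap.GeneralLinearGroup ℂ V) V :=
  ⟨fun g => (smulCLE g).continuous⟩

theorem smul_add_gl (g : LinearMap.GeneralLinearGroup ℂ V) (v w : V) :
    g • (v + w) = g • v + g • w := map_add (smulCLE g) v w

theorem smul_sub_gl (g : LinearMap.GeneralLinearGroup ℂ V) (v w : V) :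
    g • (v - w) = g • v - g • w := map_sub (smulCLE g) v w

theorem smul_smul_gl (g : LinearMap.GeneralLinearGroup ℂ V) (c : ℂ) (v : V) :
    g • (c • v) = c • g • v := map_smul (smulCLE g) c v

omit [FiniteDimensional ℂ V] in
theorem eq_one_of_forall_smul {g : LinearMap.GeneralLinearGroup ℂ V} (h : ∀ x : V, g • x = x) :
    g = 1 := Units.ext (LinearMap.ext h)

variable (G : Subgroup (LinearMap.GeneralLinearGroup ℂ V))

omit [FiniteDimensional ℂ V] in
theorem proj_eq_proj_iff {v w : V} : proj G v = proj G w ↔ ∃ g ∈ G, g • v = w := by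
  rw [proj, proj, Quotient.eq, MulAction.orbitRel_apply]
  constructor
  · rintro ⟨g, hg⟩
    refine ⟨g⁻¹, inv_mem g.2, ?_⟩
    rw [inv_smul_eq_iff]; exact hg.symm
  · rintro ⟨g, hg, rfl⟩
    refine ⟨⟨g⁻¹, inv_mem hg⟩, ?_⟩
    change g⁻¹ • g • v = v
    simp

variable {G}

omit [FiniteDimensional ℂ V] in
theorem proj_smul {g : LinearMap.GeneralLinearGroup ℂ V} (hg : g ∈ G) (v : V) :
    proj G (g • v) = proj G v :=
  ((proj_eq_proj_iff G).2 ⟨g, hg, rfl⟩).symm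

omit [FiniteDimensional ℂ V] in
theorem proj_out (z : OrbitSpace G) : proj G (Quotient.out z) = z := Quotient.out_eq z

omit [FiniteDimensional ℂ V] in
theorem continuous_proj : Continuous (proj G) := continuous_quotient_mk'

theorem isOpenMap_proj : IsOpenMap (proj G) := by
  intro O hO
  change IsOpen (proj G ⁻¹' (proj G '' O))
  have : proj G ⁻¹' (proj G '' O)
      = ⋃ g : G, (fun x : V => (g : LinearMap.GeneralLinearGroup ℂ V) • x) ⁻¹' O := by
    ext x
    simp only [Set.mem_preimage, Set.mem_image, Set.mem_iUnion]
    constructor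
    · rintro ⟨y, hy, hxy⟩
      obtain ⟨g, hg, rfl⟩ := (proj_eq_proj_iff G).1 hxy.symm
      exact ⟨⟨g, hg⟩, hy⟩
    · rintro ⟨g, hg⟩
      exact ⟨_, hg, proj_smul g.2 x⟩
  rw [this]
  exact isOpen_iUnion fun g => hO.preimage (continuous_const_smul _)

omit [FiniteDimensional ℂ V] in
theorem proj_preimage_image {U : Set V} (hGU : ∀ g ∈ G, ∀ v ∈ U, g • v ∈ U) {v : V}
    (h : proj G v ∈ proj G '' U) : v ∈ U := by
  obtain ⟨u, hu, huv⟩ := h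
  obtain ⟨g, hg, rfl⟩ := (proj_eq_proj_iff G).1 huv
  exact hGU g hg u hu

/-! ### Isotropy groups and slices -/

theorem finrank_isotropyFixedSpace_smul {g : LinearMap.GeneralLinearGroup ℂ V} (hg : g ∈ G)
    (v : V) : Module.finrank ℂ (isotropyFixedSpace G v)
      ≤ Module.finrank ℂ (isotropyFixedSpace G (g • v)) := by
  have h : (isotropyFixedSpace G v).map ((smulCLE g).toLinearEquiv : V →ₗ[ℂ] V)
      ≤ isotropyFixedSpace G (g • v) := by
    rintro _ ⟨x, hx, rfl⟩ k hk hkv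
    have h1 : (g⁻¹ * k * g) • v = v := by
      rw [mul_smul, mul_smul, hkv, inv_smul_smul]
    have h2 := hx _ (G.mul_mem (G.mul_mem (inv_mem hg) hk) hg) h1
    rw [mul_smul, mul_smul, inv_smul_eq_iff] at h2
    exact h2
  calc _ = Module.finrank ℂ ((isotropyFixedSpace G v).map
        ((smulCLE g).toLinearEquiv : V →ₗ[ℂ] V)) :=
        (LinearEquiv.finrank_map_eq (smulCLE g).toLinearEquiv _).symm
    _ ≤ _ := Submodule.finrank_mono h

theorem mem_strataUpTo_iff {v : V} {i : ℕ} : proj G v ∈ strataUpTo G i ↔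
    Module.finrank ℂ V ≤ Module.finrank ℂ (isotropyFixedSpace G v) + i := by
  constructor
  · rintro ⟨w, hw, hwv⟩
    obtain ⟨g, hg, rfl⟩ := (proj_eq_proj_iff G).1 hwv
    exact (show _ ≤ _ from hw).trans (Nat.add_le_add_right (finrank_isotropyFixedSpace_smul hg w) i)
  · exact fun h => ⟨v, h, rfl⟩

variable (G) in
/-- The isotropy group of `v` is trivial. -/
def IsFree (v : V) : Prop := ∀ g ∈ G, g • v = v → g = 1

omit [FiniteDimensional ℂ V] in
theorem IsFree.isotropyFixedSpace_eq {v : V} (h : IsFree G v) : isotropyFixedSpace G v = ⊤ := by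
  rw [eq_top_iff]
  intro x _ g hg hgv
  rw [h g hg hgv, one_smul]

omit [FiniteDimensional ℂ V] in
theorem IsFree.smul {v : V} (h : IsFree G v) {g : LinearMap.GeneralLinearGroup ℂ V} (hg : g ∈ G) :
    IsFree G (g • v) := by
  intro k hk hkv
  have h1 := h (g⁻¹ * k * g) (G.mul_mem (G.mul_mem (inv_mem hg) hk) hg) (by
    rw [mul_smul, mul_smul, hkv, inv_smul_smul])
  rw [mul_assoc, inv_mul_eq_one] at h1
  exact mul_eq_right.1 h1.symm

theorem IsFree.mem_strataUpTo {v : V} (h : IsFree G v) (i : ℕ) : proj G v ∈ strataUpTo G i := by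
  rw [mem_strataUpTo_iff, h.isotropyFixedSpace_eq, finrank_top]
  exact Nat.le_add_right _ _

/-- A small open neighbourhood `N` of `v` which is stable under the isotropy group of `v` and
disjoint from its other translates. -/
theorem exists_slice [Finite G] {v : V} {p : V → Prop} (hp : ∀ᶠ x in 𝓝 v, p x) :
    ∃ N : Set V, IsOpen N ∧ v ∈ N ∧ (∀ x ∈ N, p x) ∧
      (∀ g ∈ G, ∀ x ∈ N, g • x ∈ N → g • v = v) ∧
      ∀ g ∈ G, g • v = v → ∀ x ∈ N, g • x ∈ N := by
  -- near `v`, each `g` which moves `v` increases the distance to `v`; so `g` and `g⁻¹` cannot both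
  -- map a point of the neighbourhood to a point of it
  have h1 : ∀ᶠ x in 𝓝 v, p x ∧ ∀ g : G, (g : LinearMap.GeneralLinearGroup ℂ V) • v ≠ v →
      (g : LinearMap.GeneralLinearGroup ℂ V) • x ≠ x ∧
        dist x v < dist ((g : LinearMap.GeneralLinearGroup ℂ V) • x) v := by
    refine hp.and (eventually_all.2 fun g => ?_)
    by_cases hg : (g : LinearMap.GeneralLinearGroup ℂ V) • v = v
    · exact Eventually.of_forall fun _ h => absurd hg h
    have hc : Continuous fun x : V => (g : LinearMap.GeneralLinearGroup ℂ V) • x :=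
      continuous_const_smul _
    have h2 : ∀ᶠ x in 𝓝 v, dist x v < dist ((g : LinearMap.GeneralLinearGroup ℂ V) • x) v :=
      (continuous_id.dist continuous_const).continuousAt.eventually_lt
        (hc.dist continuous_const).continuousAt (by simpa using hg)
    filter_upwards [h2] with x hx _
    refine ⟨fun h => ?_, hx⟩
    rw [h] at hx
    exact lt_irrefl _ hx
  obtain ⟨N₀, hN₀, hN₀o, hvN₀⟩ := eventually_nhds_iff.1 h1
  refine ⟨⋂ g : {g : G // (g : LinearMap.GeneralLinearGroup ℂ V) • v = v},
    (fun x : V => (g.1 : LinearMap.GeneralLinearGroup ℂ V) • x) ⁻¹' N₀,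
    isOpen_iInter_of_finite fun g => hN₀o.preimage (continuous_const_smul _), ?_, ?_, ?_, ?_⟩
  · rw [Set.mem_iInter]
    intro g
    rw [Set.mem_preimage, g.2]
    exact hvN₀
  · intro x hx
    have := Set.mem_iInter.1 hx ⟨1, one_smul _ _⟩
    exact (hN₀ x (by simpa using this)).1
  · intro g hg x hx hgx
    by_contra hne
    have hx0 : x ∈ N₀ := by simpa using Set.mem_iInter.1 hx ⟨1, one_smul _ _⟩
    have hgx0 : g • x ∈ N₀ := by simpa using Set.mem_iInter.1 hgx ⟨1, one_smul _ _⟩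
    have h3 := ((hN₀ x hx0).2 ⟨g, hg⟩ hne).2
    have hne' : g⁻¹ • v ≠ v := fun h => hne (by rw [← h, smul_inv_smul, h])
    have h4 := ((hN₀ _ hgx0).2 ⟨g⁻¹, inv_mem hg⟩ hne').2
    simp only [inv_smul_smul] at h4
    exact lt_asymm h3 h4
  · intro g hg hgv x hx
    rw [Set.mem_iInter] at hx ⊢
    intro k
    have hkg : (k.1 : LinearMap.GeneralLinearGroup ℂ V) • g • v = v := by rw [hgv, k.2]
    have := hx ⟨k.1 * ⟨g, hg⟩, by rw [← mul_smul] at hkg; exact hkg⟩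
    simpa [mul_smul] using this

/-- The isotropy groups of points near `v` are contained in the isotropy group of `v`. -/
theorem eventually_isotropy_le [Finite G] (v : V) :
    ∀ᶠ x in 𝓝 v, ∀ g ∈ G, g • x = x → g • v = v := by
  obtain ⟨N, hN, hv, -, h, -⟩ := exists_slice (G := G) (v := v) (p := fun _ => True)
    (Eventually.of_forall fun _ => trivial)
  filter_upwards [hN.mem_nhds hv] with x hx g hg hgx
  exact h g hg x hx (by rwa [hgx])

omit [FiniteDimensional ℂ V] in
theorem isotropyFixedSpace_mono {v x : V} (h : ∀ g ∈ G, g • x = x → g • v = v) :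
    isotropyFixedSpace G v ≤ isotropyFixedSpace G x :=
  fun _ hy g hg hgx => hy g hg (h g hg hgx)

theorem eventually_mem_strataUpTo [Finite G] {v : V} {i : ℕ} (hv : proj G v ∈ strataUpTo G i) :
    ∀ᶠ x in 𝓝 v, proj G x ∈ strataUpTo G i := by
  filter_upwards [eventually_isotropy_le (G := G) v] with x hx
  rw [mem_strataUpTo_iff] at hv ⊢
  exact hv.trans (Nat.add_le_add_right (Submodule.finrank_mono (isotropyFixedSpace_mono hx)) i)

theorem eventually_isFree [Finite G] {v : V} (hv : IsFree G v) : ∀ᶠ x in 𝓝 v, IsFree G x := by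
  filter_upwards [eventually_isotropy_le (G := G) v] with x hx g hg hgx
  exact hv g hg (hx g hg hgx)

omit [FiniteDimensional ℂ V] in
theorem nonzeroGerm_linear {ℓ : V →L[ℂ] ℂ} (hℓ : ℓ ≠ 0) (a : V) : NonzeroGerm (fun w => ℓ w) a := by
  refine ⟨ℓ.analyticAt a, fun H => hℓ ?_⟩
  have h1 : HasFDerivAt (fun w => ℓ w) (0 : V →L[ℂ] ℂ) a :=
    (hasFDerivAt_const (0 : ℂ) a).congr_of_eventuallyEq H
  exact ℓ.hasFDerivAt.unique h1

omit [FiniteDimensional ℂ V] in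
theorem exists_functional_ne_zero {w : V} (hw : w ≠ 0) : ∃ ℓ : V →L[ℂ] ℂ, ℓ w ≠ 0 := by
  obtain ⟨ℓ, -, hℓ⟩ := exists_dual_vector ℂ w (norm_ne_zero_iff.2 hw)
  refine ⟨ℓ, ?_⟩
  rw [hℓ]
  simpa using hw

/-- The points with trivial isotropy group form the complement of a thin set. -/
theorem exists_nonzeroGerm_isFree (G : Subgroup (LinearMap.GeneralLinearGroup ℂ V)) [Finite G] :
    ∃ h : V → ℂ, (∀ a, NonzeroGerm h a) ∧ ∀ w, h w ≠ 0 → IsFree G w := by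
  have hex : ∀ g : G, ∃ ℓ : V →L[ℂ] ℂ, (g : LinearMap.GeneralLinearGroup ℂ V) ≠ 1 →
      ℓ ≠ 0 ∧ ∀ w, (g : LinearMap.GeneralLinearGroup ℂ V) • w = w → ℓ w = 0 := by
    intro g
    by_cases hg : (g : LinearMap.GeneralLinearGroup ℂ V) = 1
    · exact ⟨0, fun h => absurd hg h⟩
    obtain ⟨x, hx⟩ : ∃ x : V, (g : LinearMap.GeneralLinearGroup ℂ V) • x ≠ x := by
      by_contra! h
      exact hg (eq_one_of_forall_smul h)
    obtain ⟨ℓ, hℓ⟩ := exists_functional_ne_zero (sub_ne_zero.2 hx)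
    refine ⟨ℓ ∘L ((smulCLE (g : LinearMap.GeneralLinearGroup ℂ V) : V →L[ℂ] V)
      - ContinuousLinearMap.id ℂ V), fun _ => ⟨fun h => hℓ ?_, fun w hw => ?_⟩⟩
    · exact DFunLike.congr_fun h x
    · change ℓ ((g : LinearMap.GeneralLinearGroup ℂ V) • w - w) = 0
      rw [hw, sub_self, map_zero]
  choose ℓ hℓ using hex
  have : Fintype G := Fintype.ofFinite G
  refine ⟨fun w => ∏ g ∈ Finset.univ.filter fun g : G =>
      (g : LinearMap.GeneralLinearGroup ℂ V) ≠ 1, ℓ g w, ?_, ?_⟩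
  · exact fun a => NonzeroGerm.prod _ fun g hg =>
      nonzeroGerm_linear (hℓ g (Finset.mem_filter.1 hg).2).1 a
  · intro w hw g hg hgw
    by_contra hne
    exact Finset.prod_ne_zero_iff.1 hw ⟨g, hg⟩ (by simpa using hne)
      ((hℓ ⟨g, hg⟩ hne).2 w hgw)

end Action

/-! ### Charts of the orbit space -/

section Charts

variable {V : Type*} [NormedAddCommGroup V] [NormedSpace ℂ V] [FiniteDimensional ℂ V]
  {G : Subgroup (LinearMap.GeneralLinearGroup ℂ V)} {Ω : Set (OrbitSpace G)}

theorem isInvertible_fderiv_of_inverse {E F : Type*} [NormedAddCommGroup E] [NormedSpace ℂ E]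
    [NormedAddCommGroup F] [NormedSpace ℂ F] {f : E → F} {g : F → E} {a : E}
    (hf : DifferentiableAt ℂ f a) (hg : DifferentiableAt ℂ g (f a))
    (hgf : ∀ᶠ x in 𝓝 a, g (f x) = x) (hfg : ∀ᶠ y in 𝓝 (f a), f (g y) = y) :
    (fderiv ℂ f a).IsInvertible := by
  have hga : g (f a) = a := hgf.self_of_nhds
  refine ContinuousLinearMap.IsInvertible.of_inverse (g := fderiv ℂ g (f a)) ?_ ?_
  · have h1 : fderiv ℂ (fun y => f (g y)) (f a) = ContinuousLinearMap.id ℂ F := by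
      rw [EventuallyEq.fderiv_eq (f₁ := fun y => f (g y)) (f := fun y => y) hfg]
      exact fderiv_fun_id
    rw [← h1, fderiv_fun_comp _ (by rwa [hga]) hg, hga]
  · have h1 : fderiv ℂ (fun y => g (f y)) a = ContinuousLinearMap.id ℂ E := by
      rw [EventuallyEq.fderiv_eq (f₁ := fun y => g (f y)) (f := fun y => y) hgf]
      exact fderiv_fun_id
    rw [← h1, fderiv_fun_comp _ hg hf]

/-- The coordinates of a chart, as functions on `V`. -/
def chartMap (φ : Chart G Ω) (v : V) : Coord V := φ.toHomeo (proj G v)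

omit [FiniteDimensional ℂ V] in
theorem chartMap_mem_target {φ : Chart G Ω} {v : V} (hv : proj G v ∈ φ.toHomeo.source) :
    chartMap φ v ∈ φ.toHomeo.target := φ.toHomeo.map_source hv

omit [FiniteDimensional ℂ V] in
theorem symm_chartMap {φ : Chart G Ω} {v : V} (hv : proj G v ∈ φ.toHomeo.source) :
    φ.toHomeo.symm (chartMap φ v) = proj G v := φ.toHomeo.left_inv hv

omit [FiniteDimensional ℂ V] in
theorem chartMap_out {φ : Chart G Ω} {w : Coord V} (hw : w ∈ φ.toHomeo.target) :
    proj G (Quotient.out (φ.toHomeo.symm w)) ∈ φ.toHomeo.source ∧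
      chartMap φ (Quotient.out (φ.toHomeo.symm w)) = w := by
  rw [chartMap, proj_out]
  exact ⟨φ.toHomeo.map_target hw, φ.toHomeo.right_inv hw⟩

omit [FiniteDimensional ℂ V] in
theorem eventually_proj_mem {φ : Chart G Ω} {v : V} (hv : proj G v ∈ φ.toHomeo.source) :
    ∀ᶠ x in 𝓝 v, proj G x ∈ φ.toHomeo.source :=
  continuous_proj.continuousAt.eventually_mem (φ.toHomeo.open_source.mem_nhds hv)

omit [FiniteDimensional ℂ V] in
theorem chartMap_smul (φ : Chart G Ω) {g : LinearMap.GeneralLinearGroup ℂ V} (hg : g ∈ G) (v : V) :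
    chartMap φ (g • v) = chartMap φ v := by rw [chartMap, proj_smul hg, chartMap]

omit [FiniteDimensional ℂ V] in
theorem analyticAt_chartMap (φ : Chart G Ω) {v : V} (hv : proj G v ∈ φ.toHomeo.source) :
    AnalyticAt ℂ (chartMap φ) v := by
  rw [analyticAt_pi_iff]
  intro j
  have := (φ.holomorphic_iff φ.toHomeo.source φ.toHomeo.open_source subset_rfl
    fun z => φ.toHomeo z j).2 ?_
  · exact this v hv
  · intro w hw
    have hw' : w ∈ φ.toHomeo.target := by
      obtain ⟨z, hz, rfl⟩ := hw
      exact φ.toHomeo.map_source hz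
    refine (analyticAt_proj j w).congr ?_
    filter_upwards [φ.toHomeo.open_target.mem_nhds hw'] with y hy
    rw [φ.toHomeo.right_inv hy]

theorem nhds_le_map_chartMap (φ : Chart G Ω) {v : V}
    (hv : proj G v ∈ φ.toHomeo.source) : 𝓝 (chartMap φ v) ≤ map (chartMap φ) (𝓝 v) := by
  have h1 : 𝓝 (proj G v) ≤ map (proj G) (𝓝 v) := isOpenMap_proj.nhds_le v
  have h2 := φ.toHomeo.map_nhds_eq hv
  rw [chartMap, ← h2]
  exact (map_mono h1).trans (by rw [map_map]; exact le_rfl)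

/-- Functions on the orbit space which are holomorphic on `V` near `v` are holomorphic in
coordinates near `π(v)`; by invariance they are holomorphic on `V` near all points of the orbit of `v`. -/
theorem analyticAt_of_comp_proj (φ : Chart G Ω) {v : V}
    (hv : proj G v ∈ φ.toHomeo.source)
    {f : OrbitSpace G → ℂ} (hf : AnalyticAt ℂ (fun x => f (proj G x)) v) :
    AnalyticAt ℂ (fun w => f (φ.toHomeo.symm w)) (chartMap φ v) := by
  obtain ⟨N, hN, hNo, hvN⟩ := eventually_nhds_iff.1
    (hf.eventually_analyticAt.and (eventually_proj_mem hv))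
  have hsub : proj G '' N ⊆ φ.toHomeo.source := by
    rintro _ ⟨x, hx, rfl⟩
    exact (hN x hx).2
  refine (φ.holomorphic_iff (proj G '' N) (isOpenMap_proj N hNo) hsub f).1 ?_ _
    ⟨proj G v, ⟨v, hvN, rfl⟩, rfl⟩
  rintro y ⟨x, hx, hxy⟩
  obtain ⟨g, hg, rfl⟩ := (proj_eq_proj_iff G).1 hxy
  have h2 : (fun y => f (proj G y)) = fun y => f (proj G (g⁻¹ • y)) := by
    funext y
    rw [proj_smul (inv_mem hg)]
  rw [h2]
  exact AnalyticAt.comp (g := fun y => f (proj G y)) (f := fun y : V => g⁻¹ • y)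
    (by rw [inv_smul_smul]; exact (hN x hx).1) (analyticAt_smul _ _)

/-- The coordinate change from `φ` to `ψ`. -/
def chartChange (φ ψ : Chart G Ω) (w : Coord V) : Coord V := ψ.toHomeo (φ.toHomeo.symm w)

theorem analyticAt_chartChange (φ ψ : Chart G Ω) {v : V} (hφ : proj G v ∈ φ.toHomeo.source)
    (hψ : proj G v ∈ ψ.toHomeo.source) : AnalyticAt ℂ (chartChange φ ψ) (chartMap φ v) := by
  rw [analyticAt_pi_iff]
  intro j
  exact analyticAt_of_comp_proj φ hφ (f := fun z => ψ.toHomeo z j)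
    (analyticAt_pi_iff.1 (analyticAt_chartMap ψ hψ) j)

omit [FiniteDimensional ℂ V] in
theorem chartChange_chartMap (φ ψ : Chart G Ω) {v : V} (hφ : proj G v ∈ φ.toHomeo.source) :
    chartChange φ ψ (chartMap φ v) = chartMap ψ v := by
  rw [chartChange, symm_chartMap hφ, chartMap]

omit [FiniteDimensional ℂ V] in
theorem eventually_chartChange (φ ψ : Chart G Ω) {v : V} (hφ : proj G v ∈ φ.toHomeo.source)
    (hψ : proj G v ∈ ψ.toHomeo.source) :
    ∀ᶠ w in 𝓝 (chartMap φ v), w ∈ φ.toHomeo.target ∧ φ.toHomeo.symm w ∈ ψ.toHomeo.source ∧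
      chartChange ψ φ (chartChange φ ψ w) = w := by
  have h1 := φ.toHomeo.open_target.mem_nhds (chartMap_mem_target hφ)
  have h2 : ∀ᶠ w in 𝓝 (chartMap φ v), φ.toHomeo.symm w ∈ ψ.toHomeo.source :=
    (φ.toHomeo.continuousAt_symm (chartMap_mem_target hφ)).eventually_mem
      (by rw [symm_chartMap hφ]; exact ψ.toHomeo.open_source.mem_nhds hψ)
  filter_upwards [h1, h2] with w hw1 hw2
  refine ⟨hw1, hw2, ?_⟩
  rw [chartChange, chartChange, ψ.toHomeo.left_inv hw2, φ.toHomeo.right_inv hw1]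

theorem isInvertible_fderiv_chartChange (φ ψ : Chart G Ω) {v : V}
    (hφ : proj G v ∈ φ.toHomeo.source) (hψ : proj G v ∈ ψ.toHomeo.source) :
    (fderiv ℂ (chartChange φ ψ) (chartMap φ v)).IsInvertible := by
  have h := chartChange_chartMap φ ψ hφ
  refine isInvertible_fderiv_of_inverse (g := chartChange ψ φ)
    (analyticAt_chartChange φ ψ hφ hψ).differentiableAt ?_ ?_ ?_
  · rw [h]; exact (analyticAt_chartChange ψ φ hψ hφ).differentiableAt
  · exact (eventually_chartChange φ ψ hφ hψ).mono fun w hw => hw.2.2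
  · rw [h]; exact (eventually_chartChange ψ φ hψ hφ).mono fun w hw => hw.2.2

omit [FiniteDimensional ℂ V] in
theorem eventually_chartMap_eq (φ ψ : Chart G Ω) {v : V} (hφ : proj G v ∈ φ.toHomeo.source) :
    chartMap ψ =ᶠ[𝓝 v] fun x => chartChange φ ψ (chartMap φ x) :=
  (eventually_proj_mem hφ).mono fun _ hx => (chartChange_chartMap φ ψ hx).symm

/-- Composition of a chart with a biholomorphic map. -/
def Chart.trans (φ : Chart G Ω) (E : OpenPartialHomeomorph (Coord V) (Coord V))
    (hE : ∀ x ∈ E.source, AnalyticAt ℂ E x) (hE' : ∀ y ∈ E.target, AnalyticAt ℂ E.symm y) :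
    Chart G Ω where
  toHomeo := φ.toHomeo.trans E
  source_subset := fun z hz => φ.source_subset (by
    rw [OpenPartialHomeomorph.trans_source] at hz; exact hz.1)
  holomorphic_iff := by
    intro W hW hWs f
    rw [OpenPartialHomeomorph.trans_source] at hWs
    rw [φ.holomorphic_iff W hW (fun z hz => (hWs hz).1) f]
    constructor
    · rintro h _ ⟨z, hz, rfl⟩
      have hzE : φ.toHomeo z ∈ E.source := (hWs hz).2
      refine AnalyticAt.comp (g := fun w => f (φ.toHomeo.symm w)) (f := E.symm) ?_
        (hE' _ (E.map_source hzE))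
      have : E.symm ((φ.toHomeo.trans E) z) = φ.toHomeo z := E.left_inv hzE
      rw [this]
      exact h _ ⟨z, hz, rfl⟩
    · rintro h _ ⟨z, hz, rfl⟩
      have hzE : φ.toHomeo z ∈ E.source := (hWs hz).2
      have h1 : AnalyticAt ℂ (fun w => f ((φ.toHomeo.trans E).symm (E w))) (φ.toHomeo z) :=
        AnalyticAt.comp (g := fun w => f ((φ.toHomeo.trans E).symm w)) (f := E)
          (h _ ⟨z, hz, rfl⟩) (hE _ hzE)
      refine h1.congr ?_
      filter_upwards [E.open_source.mem_nhds hzE] with w hw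
      change f (φ.toHomeo.symm (E.symm (E w))) = _
      rw [E.left_inv hw]

/-- A holomorphic map `μ` on an open set `N ⊆ V` which has the fibres of `proj G`, and which
descends holomorphic functions, gives a chart. -/
theorem exists_chart {N : Set V} {μ : V → Coord V} (hN : IsOpen N) (hNΩ : ∀ x ∈ N, proj G x ∈ Ω)
    (hμa : ∀ x, AnalyticAt ℂ μ x) (hμo : IsOpenMap μ)
    (hfib : ∀ x ∈ N, ∀ y ∈ N, proj G x = proj G y ↔ μ x = μ y)
    (hdesc : ∀ (f : Coord V → ℂ) (x : V), AnalyticAt ℂ (fun y => f (μ y)) x →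
      AnalyticAt ℂ f (μ x)) :
    ∃ φ : Chart G Ω, φ.toHomeo.source = proj G '' N ∧ ∀ x ∈ N, chartMap φ x = μ x := by
  let F : OrbitSpace G → Coord V := fun z => if h : ∃ x ∈ N, proj G x = z then μ h.choose else 0
  let I : Coord V → OrbitSpace G := fun w =>
    if h : ∃ x ∈ N, μ x = w then proj G h.choose else proj G 0
  have hF : ∀ x ∈ N, F (proj G x) = μ x := by
    intro x hx
    have h : ∃ y ∈ N, proj G y = proj G x := ⟨x, hx, rfl⟩
    simp only [F, dif_pos h]
    exact (hfib _ h.choose_spec.1 _ hx).1 h.choose_spec.2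
  have hI : ∀ x ∈ N, I (μ x) = proj G x := by
    intro x hx
    have h : ∃ y ∈ N, μ y = μ x := ⟨x, hx, rfl⟩
    simp only [I, dif_pos h]
    exact (hfib _ h.choose_spec.1 _ hx).2 h.choose_spec.2
  let e : OpenPartialHomeomorph (OrbitSpace G) (Coord V) :=
    { toFun := F
      invFun := I
      source := proj G '' N
      target := μ '' N
      map_source' := by
        rintro _ ⟨x, hx, rfl⟩
        exact ⟨x, hx, (hF x hx).symm⟩
      map_target' := by
        rintro _ ⟨x, hx, rfl⟩
        exact ⟨x, hx, (hI x hx).symm⟩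
      left_inv' := by
        rintro _ ⟨x, hx, rfl⟩
        rw [hF x hx, hI x hx]
      right_inv' := by
        rintro _ ⟨x, hx, rfl⟩
        rw [hI x hx, hF x hx]
      open_source := isOpenMap_proj N hN
      open_target := hμo N hN
      continuousOn_toFun := by
        rintro _ ⟨x, hx, rfl⟩
        refine ContinuousAt.continuousWithinAt ?_
        have h1 : Tendsto (fun y => F (proj G y)) (𝓝 x) (𝓝 (F (proj G x))) := by
          rw [hF x hx]
          refine (hμa x).continuousAt.tendsto.congr' ?_
          filter_upwards [hN.mem_nhds hx] with y hy using (hF y hy).symm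
        exact (tendsto_map'_iff.2 h1).mono_left (isOpenMap_proj.nhds_le x)
      continuousOn_invFun := by
        rintro _ ⟨x, hx, rfl⟩
        refine ContinuousAt.continuousWithinAt ?_
        have h1 : Tendsto (fun y => I (μ y)) (𝓝 x) (𝓝 (I (μ x))) := by
          rw [hI x hx]
          refine continuous_proj.continuousAt.tendsto.congr' ?_
          filter_upwards [hN.mem_nhds hx] with y hy using (hI y hy).symm
        exact (tendsto_map'_iff.2 h1).mono_left (hμo.nhds_le x) }
  refine ⟨⟨e, ?_, ?_⟩, rfl, hF⟩
  · rintro _ ⟨x, hx, rfl⟩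
    exact hNΩ x hx
  · intro W hW hWs f
    constructor
    · rintro h _ ⟨z, hz, rfl⟩
      obtain ⟨x, hx, rfl⟩ := hWs hz
      have h1 : e (proj G x) = μ x := hF x hx
      rw [h1]
      refine hdesc (fun w => f (e.symm w)) x ((h x hz).congr ?_)
      filter_upwards [hN.mem_nhds hx] with y hy
      change _ = f (I (μ y))
      rw [hI y hy]
    · intro h y hy
      obtain ⟨x, hx, hxy⟩ := hWs hy
      have h1 : AnalyticAt ℂ (fun u => f (proj G u)) x := by
        have h2 : AnalyticAt ℂ (fun u => f (I (μ u))) x :=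
          AnalyticAt.comp (g := fun w => f (e.symm w)) (f := μ)
            (h _ ⟨proj G x, by rw [hxy]; exact hy, hF x hx⟩) (hμa x)
        refine h2.congr ?_
        filter_upwards [hN.mem_nhds hx] with u hu
        rw [hI u hu]
      obtain ⟨g, hg, rfl⟩ := (proj_eq_proj_iff G).1 hxy
      have h2 : (fun y => f (proj G y)) = fun y => f (proj G (g⁻¹ • y)) := by
        funext y
        rw [proj_smul (inv_mem hg)]
      rw [h2]
      exact AnalyticAt.comp (g := fun y => f (proj G y)) (f := fun y : V => g⁻¹ • y)
        (by rw [inv_smul_smul]; exact h1) (analyticAt_smul _ _)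

variable (V) in
/-- Linear coordinates on `V`. -/
def linearCoord : V ≃L[ℂ] Coord V := ContinuousLinearEquiv.ofFinrankEq (by simp)

theorem analyticAt_of_comp_equiv {E F : Type*} [NormedAddCommGroup E] [NormedSpace ℂ E]
    [NormedAddCommGroup F] [NormedSpace ℂ F] (θ : E ≃L[ℂ] F) {f : F → ℂ} {x : E}
    (h : AnalyticAt ℂ (fun y => f (θ y)) x) : AnalyticAt ℂ f (θ x) := by
  have h1 : AnalyticAt ℂ (fun y => f (θ (θ.symm y))) (θ x) :=
    AnalyticAt.comp (g := fun y => f (θ y)) (f := θ.symm) (by simpa using h)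
      ((θ.symm : F →L[ℂ] E).analyticAt _)
  simpa using h1

variable [Finite G]

/-- At points with trivial isotropy group there are charts which lift to linear coordinates. -/
theorem exists_chart_of_isFree {v : V} (hv : IsFree G v) (hΩ : ∀ᶠ x in 𝓝 v, proj G x ∈ Ω) :
    ∃ φ : Chart G Ω, proj G v ∈ φ.toHomeo.source ∧
      chartMap φ =ᶠ[𝓝 v] fun x => linearCoord V x := by
  obtain ⟨N, hN, hvN, hNΩ, hsep, -⟩ := exists_slice (G := G) hΩ
  have hfib : ∀ x ∈ N, ∀ y ∈ N, proj G x = proj G y ↔ linearCoord V x = linearCoord V y := by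
    intro x hx y hy
    rw [(linearCoord V).injective.eq_iff]
    refine ⟨fun h => ?_, fun h => by rw [h]⟩
    obtain ⟨g, hg, rfl⟩ := (proj_eq_proj_iff G).1 h
    rw [hv g hg (hsep g hg x hx hy), one_smul]
  obtain ⟨φ, hφ, hφμ⟩ := exists_chart (G := G) (Ω := Ω) (μ := fun x => linearCoord V x) hN hNΩ
    (fun x => (linearCoord V : V →L[ℂ] Coord V).analyticAt x)
    (linearCoord V).toHomeomorph.isOpenMap hfib
    (fun f x h => analyticAt_of_comp_equiv _ h)
  exact ⟨φ, by rw [hφ]; exact ⟨v, hvN, rfl⟩, eventually_of_mem (hN.mem_nhds hvN) hφμ⟩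

/-- The quotient map is étale at points with trivial isotropy group. -/
theorem isInvertible_fderiv_chartMap (φ : Chart G Ω) {v : V}
    (hv : proj G v ∈ φ.toHomeo.source) (hfree : IsFree G v) :
    (fderiv ℂ (chartMap φ) v).IsInvertible := by
  have hΩ : ∀ᶠ x in 𝓝 v, proj G x ∈ Ω := (eventually_proj_mem hv).mono fun x hx =>
    φ.source_subset hx
  obtain ⟨ψ, hψ, hψl⟩ := exists_chart_of_isFree hfree hΩ
  have h1 := eventually_chartMap_eq ψ φ hψ
  rw [h1.fderiv_eq, fderiv_fun_comp _ (analyticAt_chartChange ψ φ hψ hv).differentiableAt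
    (analyticAt_chartMap ψ hψ).differentiableAt]
  refine (isInvertible_fderiv_chartChange ψ φ hψ hv).comp ?_
  rw [hψl.fderiv_eq]
  have : fderiv ℂ (fun x => linearCoord V x) v = (linearCoord V : V →L[ℂ] Coord V) :=
    ContinuousLinearMap.fderiv (linearCoord V : V →L[ℂ] Coord V)
  exact this ▸ ContinuousLinearMap.isInvertible_equiv

end Charts

/-! ### The pushforward of an invariant tensor field -/

section Pushforward

variable {V : Type*} [NormedAddCommGroup V] [NormedSpace ℂ V] [FiniteDimensional ℂ V]
  {G : Subgroup (LinearMap.GeneralLinearGroup ℂ V)} {Ω : Set (OrbitSpace G)} {p q : ℕ}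

theorem fderiv_chartMap_smul (φ : Chart G Ω) {v : V} (hv : proj G v ∈ φ.toHomeo.source)
    {g : LinearMap.GeneralLinearGroup ℂ V} (hg : g ∈ G) :
    fderiv ℂ (chartMap φ) (g • v) ∘L (smulCLE g : V →L[ℂ] V) = fderiv ℂ (chartMap φ) v := by
  have h1 : (fun x : V => chartMap φ (g • x)) = chartMap φ := funext fun x => chartMap_smul φ hg x
  have h2 : DifferentiableAt ℂ (chartMap φ) (g • v) :=
    (analyticAt_chartMap φ (by rwa [proj_smul hg])).differentiableAt
  conv_rhs => rw [← h1]
  rw [fderiv_fun_comp v h2 (analyticAt_smul g v).differentiableAt, fderiv_smul_gl]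

/-- The value of `π_* P` at `π(x)` can be computed with any point `x` of the orbit at which `π` is
étale. -/
theorem pushforward_chartMap {U : Set V} (hGU : ∀ g ∈ G, ∀ v ∈ U, g • v ∈ U) {P : V → Tensor p q V}
    (hP : IsHolomorphicInvariant G U P) (φ : Chart G (Z1 G U)) {x : V}
    (hx : proj G x ∈ φ.toHomeo.source) (hi : (fderiv ℂ (chartMap φ) x).IsInvertible) :
    pushforward (Z1 G U) P φ (chartMap φ x)
      = tensorPullback (fderiv ℂ (chartMap φ) x).inverse (P x) := by
  have hxU : x ∈ U := proj_preimage_image hGU (φ.source_subset hx).2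
  obtain ⟨g, hg, hgx⟩ := (proj_eq_proj_iff G).1 (proj_out (proj G x)).symm
  have h1 : pushforward (Z1 G U) P φ (chartMap φ x)
      = tensorPullback (fderiv ℂ (chartMap φ) (g • x)).inverse (P (g • x)) := by
    rw [hgx, ← symm_chartMap hx]
    rfl
  have h2 := fderiv_chartMap_smul φ hx hg
  have hgi : (smulCLE g : V →L[ℂ] V).IsInvertible := ⟨smulCLE g, rfl⟩
  have hi' : (fderiv ℂ (chartMap φ) (g • x)).IsInvertible := by
    rw [← h2] at hi
    exact ContinuousLinearMap.isInvertible_comp_equiv.1 hi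
  have h3 : P x = tensorPullback (smulCLE g : V →L[ℂ] V) (P (g • x)) := by
    have := hP.2 g hg x hxU
    rw [pullbackField, fderiv_smul_gl] at this
    exact this.symm
  rw [h1, ← h2, hi'.inverse_comp_of_left, tensorPullback_comp hi'.inverse, h3,
    tensorPullback_inverse' hgi]

variable [Finite G]

omit [Finite G] [FiniteDimensional ℂ V] in
theorem comp_out_proj {N : V → ℂ} (hN : ∀ g ∈ G, ∀ x, N (g • x) = N x) (x : V) :
    N (Quotient.out (proj G x)) = N x := by
  obtain ⟨g, hg, hgx⟩ := (proj_eq_proj_iff G).1 (proj_out (proj G x)).symm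
  rw [← hgx, hN g hg]

omit [Finite G] in
/-- Invariant holomorphic functions are holomorphic in coordinates. -/
theorem analyticAt_comp_out (φ : Chart G Ω) {v : V} (hv : proj G v ∈ φ.toHomeo.source)
    {N : V → ℂ} (hN : ∀ g ∈ G, ∀ x, N (g • x) = N x) (ha : AnalyticAt ℂ N v) :
    AnalyticAt ℂ (fun w => N (Quotient.out (φ.toHomeo.symm w))) (chartMap φ v) :=
  analyticAt_of_comp_proj φ hv (f := fun z => N (Quotient.out z))
    (ha.congr (Eventually.of_forall fun x => (comp_out_proj hN x).symm))

omit [Finite G] in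
theorem nonzeroGerm_comp_out (φ : Chart G Ω) {v : V} (hv : proj G v ∈ φ.toHomeo.source)
    {N : V → ℂ} (hN : ∀ g ∈ G, ∀ x, N (g • x) = N x) (ha : NonzeroGerm N v) :
    NonzeroGerm (fun w => N (Quotient.out (φ.toHomeo.symm w))) (chartMap φ v) := by
  refine ⟨analyticAt_comp_out φ hv hN ha.1, fun H => ha.2 ?_⟩
  filter_upwards [(analyticAt_chartMap φ hv).continuousAt.eventually H, eventually_proj_mem hv]
    with x hx hxs
  rwa [symm_chartMap hxs, comp_out_proj hN] at hx

/-- In coordinates of `Z_1`, too, the points of `Z_0` form the complement of a thin set: the product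
of the translates of an equation on `V` is invariant. -/
theorem exists_nonzeroGerm_coord_isFree (φ : Chart G Ω) {v : V}
    (hv : proj G v ∈ φ.toHomeo.source) :
    ∃ h : Coord V → ℂ, NonzeroGerm h (chartMap φ v) ∧
      ∀ w, h w ≠ 0 → IsFree G (Quotient.out (φ.toHomeo.symm w)) := by
  obtain ⟨k, hk, hkfree⟩ := exists_nonzeroGerm_isFree G
  have hfin : Fintype G := Fintype.ofFinite G
  let N : V → ℂ := fun x => ∏ g : G, k ((g : LinearMap.GeneralLinearGroup ℂ V) • x)
  have hN : ∀ g ∈ G, ∀ x, N (g • x) = N x := by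
    intro g hg x
    refine Fintype.prod_equiv (Equiv.mulRight ⟨g, hg⟩) _ _ fun a => ?_
    simp [mul_smul]
  have hNv : NonzeroGerm N v := NonzeroGerm.prod _ fun g _ =>
    (hk _).comp (analyticAt_smul _ v)
      (nhds_le_map_of_isInvertible (analyticAt_smul _ v) (isInvertible_fderiv_smul _ v))
  refine ⟨_, nonzeroGerm_comp_out φ hv hN hNv, fun w hw => hkfree _ ?_⟩
  have := Finset.prod_ne_zero_iff.1 hw 1 (Finset.mem_univ _)
  simpa using this

omit [Finite G] in
theorem analyticAt_multilinear_apply {X W N : Type*} [NormedAddCommGroup X] [NormedSpace ℂ X]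
    [NormedAddCommGroup W] [NormedSpace ℂ W] [NormedAddCommGroup N] [NormedSpace ℂ N]
    {T : X → ContinuousMultilinearMap ℂ (fun _ : Fin p => W) N} {α : X → Fin p → W} {x : X}
    (hT : AnalyticAt ℂ T x) (hα : AnalyticAt ℂ α x) : AnalyticAt ℂ (fun y => T y (α y)) x :=
  AnalyticAt.comp (g := fun z : (Fin p → W) × ContinuousMultilinearMap ℂ (fun _ : Fin p => W) N =>
      z.2 z.1) (f := fun y => (α y, T y))
    (ContinuousMultilinearMap.analyticAt_uncurry_of_linear
      (ContinuousLinearMap.id ℂ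
        (ContinuousMultilinearMap ℂ (fun _ : Fin p => W) N)).flipMultilinear)
    (hα.prod hT)

/-- The derivative of a chart at `x`, as a matrix. -/
def chartMatrix (φ : Chart G Ω) (x : V) :
    Matrix (Fin (Module.finrank ℂ V)) (Fin (Module.finrank ℂ V)) ℂ :=
  Matrix.of fun a b => fderiv ℂ (chartMap φ) x ((linearCoord V).symm (Pi.single b 1)) a

omit [Finite G] in
theorem chartMatrix_mulVec (φ : Chart G Ω) (x : V) (u : Coord V) :
    (chartMatrix φ x).mulVec u = fderiv ℂ (chartMap φ) x ((linearCoord V).symm u) := by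
  have hu : u = ∑ b, u b • (Pi.single b 1 : Coord V) := by
    ext j; simp [Finset.sum_apply, Pi.single_apply]
  conv_rhs => rw [hu]
  simp only [map_sum, map_smul]
  ext a
  simp [Matrix.mulVec, dotProduct, chartMatrix, mul_comm]

omit [Finite G] in
theorem analyticAt_chartMatrix (φ : Chart G Ω) {v : V} (hv : proj G v ∈ φ.toHomeo.source)
    (a b : Fin (Module.finrank ℂ V)) : AnalyticAt ℂ (fun x => chartMatrix φ x a b) v := by
  have h1 : AnalyticAt ℂ (fun x => fderiv ℂ (chartMap φ) x
      ((linearCoord V).symm (Pi.single b 1))) v :=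
    AnalyticAt.comp (g := fun A : V →L[ℂ] Coord V => A ((linearCoord V).symm (Pi.single b 1)))
      (ContinuousLinearMap.analyticAt (ContinuousLinearMap.apply ℂ (Coord V)
        ((linearCoord V).symm (Pi.single b 1))) _) (analyticAt_chartMap φ hv).fderiv
  exact analyticAt_pi_iff.1 h1 a

omit [Finite G] in
theorem analyticAt_det {X : Type*} [NormedAddCommGroup X] [NormedSpace ℂ X] {n : ℕ}
    {M : X → Matrix (Fin n) (Fin n) ℂ} {x : X} (hM : ∀ a b, AnalyticAt ℂ (fun y => M y a b) x) :
    AnalyticAt ℂ (fun y => (M y).det) x := by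
  simp_rw [Matrix.det_apply']
  exact Finset.analyticAt_fun_sum _ fun σ _ => analyticAt_const.fun_mul
    (Finset.analyticAt_fun_prod _ fun a _ => hM _ _)

omit [Finite G] in
theorem analyticAt_adjugate {X : Type*} [NormedAddCommGroup X] [NormedSpace ℂ X] {n : ℕ}
    {M : X → Matrix (Fin n) (Fin n) ℂ} {x : X} (hM : ∀ a b, AnalyticAt ℂ (fun y => M y a b) x)
    (a b : Fin n) : AnalyticAt ℂ (fun y => (M y).adjugate a b) x := by
  simp_rw [Matrix.adjugate_apply]
  refine analyticAt_det fun c d => ?_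
  by_cases hc : c = b
  · subst hc; simpa using analyticAt_const
  · simpa [hc] using hM c d

omit [Finite G] in
theorem chartMatrix_det_ne_zero (φ : Chart G Ω) {x : V}
    (hi : (fderiv ℂ (chartMap φ) x).IsInvertible) : (chartMatrix φ x).det ≠ 0 := by
  intro h0
  obtain ⟨u, hu, hu0⟩ := Matrix.exists_mulVec_eq_zero_iff.2 h0
  rw [chartMatrix_mulVec] at hu0
  have h1 := hi.injective (hu0.trans (map_zero _).symm)
  exact hu ((linearCoord V).symm.injective (h1.trans (map_zero _).symm))

/-- The components of `det(dπ)^q π_* P`, as functions on `V`; they are holomorphic, since the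
inverse of a matrix is its adjugate divided by its determinant. -/
def scaledComponent (P : V → Tensor p q V) (φ : Chart G Ω) (i : Fin p → Fin (Module.finrank ℂ V))
    (j : Fin q → Fin (Module.finrank ℂ V)) (x : V) : ℂ :=
  P x (fun s => (ContinuousLinearMap.proj (i s) : Coord V →L[ℂ] ℂ).comp (fderiv ℂ (chartMap φ) x))
    fun t => (linearCoord V).symm fun a => (chartMatrix φ x).adjugate a (j t)

omit [Finite G] in
theorem analyticAt_scaledComponent {P : V → Tensor p q V} (φ : Chart G Ω)
    (i : Fin p → Fin (Module.finrank ℂ V)) (j : Fin q → Fin (Module.finrank ℂ V)) {v : V}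
    (hv : proj G v ∈ φ.toHomeo.source) (hP : AnalyticAt ℂ P v) :
    AnalyticAt ℂ (scaledComponent P φ i j) v := by
  have h1 : AnalyticAt ℂ (fun x => fun s =>
      (ContinuousLinearMap.proj (i s) : Coord V →L[ℂ] ℂ).comp (fderiv ℂ (chartMap φ) x)) v := by
    refine analyticAt_pi_iff.2 fun s => ?_
    exact AnalyticAt.comp (g := fun A : V →L[ℂ] Coord V =>
        (ContinuousLinearMap.proj (i s) : Coord V →L[ℂ] ℂ).comp A)
      (((ContinuousLinearMap.compL ℂ V (Coord V) ℂ)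
        (ContinuousLinearMap.proj (i s) : Coord V →L[ℂ] ℂ)).analyticAt _)
      (analyticAt_chartMap φ hv).fderiv
  have h2 : AnalyticAt ℂ (fun x => fun t : Fin q => (linearCoord V).symm fun a =>
      (chartMatrix φ x).adjugate a (j t)) v := by
    refine analyticAt_pi_iff.2 fun t => ?_
    exact AnalyticAt.comp (g := fun u => (linearCoord V).symm u)
      (((linearCoord V).symm : Coord V →L[ℂ] V).analyticAt _)
      (analyticAt_pi_iff.2 fun a => analyticAt_adjugate (analyticAt_chartMatrix φ hv) a (j t))
  exact analyticAt_multilinear_apply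
    (analyticAt_multilinear_apply (N := ContinuousMultilinearMap ℂ (fun _ : Fin q => V) ℂ) hP h1) h2

omit [Finite G] in
theorem scaledComponent_eq (P : V → Tensor p q V) (φ : Chart G Ω)
    (i : Fin p → Fin (Module.finrank ℂ V)) (j : Fin q → Fin (Module.finrank ℂ V)) {x : V}
    (hi : (fderiv ℂ (chartMap φ) x).IsInvertible) :
    scaledComponent P φ i j x = (chartMatrix φ x).det ^ q *
      component (tensorPullback (fderiv ℂ (chartMap φ) x).inverse (P x)) i j := by
  have h1 : ∀ b, ((linearCoord V).symm fun a => (chartMatrix φ x).adjugate a b)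
      = (chartMatrix φ x).det • (fderiv ℂ (chartMap φ) x).inverse (Pi.single b 1) := by
    intro b
    apply hi.injective
    rw [map_smul, hi.self_apply_inverse, ← chartMatrix_mulVec]
    have h2 := congrArg (fun M : Matrix (Fin (Module.finrank ℂ V)) (Fin (Module.finrank ℂ V)) ℂ =>
      M.col b) (Matrix.mul_adjugate (chartMatrix φ x))
    ext a
    have h3 := congrFun h2 a
    simp only [Matrix.col_apply, Matrix.mul_apply, Matrix.smul_apply, smul_eq_mul] at h3
    simp only [Matrix.mulVec, dotProduct, Pi.smul_apply, smul_eq_mul]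
    rw [h3, Matrix.one_apply, Pi.single_apply]
  rw [scaledComponent]
  simp_rw [h1]
  rw [ContinuousMultilinearMap.map_smul_univ, component, tensorPullback_apply, hi.inverse_inverse]
  simp

/-- The components `f` of `π_* P` are meromorphic. On `V` they are quotients `F / J` of holomorphic
functions, with `J = det(dπ)^q`. The product `N` of the translates of `J` is invariant, and so is
the sum `K` of the products in which one of the factors `J` is replaced by the translate of `F`; since
`f` is invariant, `K = |G| f N`. -/
theorem isMerAt_pushforward {U : Set V} (hGU : ∀ g ∈ G, ∀ v ∈ U, g • v ∈ U)
    {P : V → Tensor p q V} (hP : IsHolomorphicInvariant G U P) (φ : Chart G (Z1 G U))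
    {w₀ : Coord V} (hw₀ : w₀ ∈ φ.toHomeo.target) (i : Fin p → Fin (Module.finrank ℂ V))
    (j : Fin q → Fin (Module.finrank ℂ V)) :
    IsMerAt (fun w => component (pushforward (Z1 G U) P φ w) i j) w₀ := by
  obtain ⟨v, hv, rfl⟩ : ∃ v, proj G v ∈ φ.toHomeo.source ∧ chartMap φ v = w₀ :=
    ⟨_, chartMap_out hw₀⟩
  have hfin : Fintype G := Fintype.ofFinite G
  let J : V → ℂ := fun x => (chartMatrix φ x).det ^ q
  let F : V → ℂ := scaledComponent P φ i j
  have hvg : ∀ g : G, proj G ((g : LinearMap.GeneralLinearGroup ℂ V) • v) ∈ φ.toHomeo.source :=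
    fun g => by rwa [proj_smul g.2]
  have hJ : ∀ g : G, AnalyticAt ℂ J ((g : LinearMap.GeneralLinearGroup ℂ V) • v) := fun g =>
    (analyticAt_det (analyticAt_chartMatrix φ (hvg g))).fun_pow q
  have hF : ∀ g : G, AnalyticAt ℂ F ((g : LinearMap.GeneralLinearGroup ℂ V) • v) := fun g =>
    analyticAt_scaledComponent φ i j (hvg g)
      (hP.1 _ (proj_preimage_image hGU (φ.source_subset (hvg g)).2))
  let N : V → ℂ := fun x => ∏ b : G, J ((b : LinearMap.GeneralLinearGroup ℂ V) • x)
  let K : V → ℂ := fun x => ∑ a : G, ∏ b : G, if b = a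
    then F ((b : LinearMap.GeneralLinearGroup ℂ V) • x)
    else J ((b : LinearMap.GeneralLinearGroup ℂ V) • x)
  have hN : ∀ g ∈ G, ∀ x, N (g • x) = N x := by
    intro g hg x
    refine Fintype.prod_equiv (Equiv.mulRight ⟨g, hg⟩) _ _ fun a => ?_
    simp [mul_smul]
  have hK : ∀ g ∈ G, ∀ x, K (g • x) = K x := by
    intro g hg x
    refine Fintype.sum_equiv (Equiv.mulRight ⟨g, hg⟩) _ _ fun a => ?_
    refine Fintype.prod_equiv (Equiv.mulRight ⟨g, hg⟩) _ _ fun b => ?_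
    simp [mul_smul]
  have hKa : AnalyticAt ℂ K v := by
    refine Finset.analyticAt_fun_sum _ fun a _ => Finset.analyticAt_fun_prod _ fun b _ => ?_
    by_cases hb : b = a
    · simp only [hb, if_true]
      exact (hF a).comp (analyticAt_smul _ v)
    · simp only [hb, if_false]
      exact (hJ b).comp (analyticAt_smul _ v)
  have hinv : ∀ x, proj G x ∈ φ.toHomeo.source → IsFree G x → ∀ g : G,
      (fderiv ℂ (chartMap φ) ((g : LinearMap.GeneralLinearGroup ℂ V) • x)).IsInvertible :=
    fun x hx hxf g => isInvertible_fderiv_chartMap φ (by rwa [proj_smul g.2]) (hxf.smul g.2)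
  have hNne : ∀ x, proj G x ∈ φ.toHomeo.source → IsFree G x → N x ≠ 0 := fun x hx hxf =>
    Finset.prod_ne_zero_iff.2 fun g _ =>
      pow_ne_zero _ (chartMatrix_det_ne_zero φ (hinv x hx hxf g))
  have hNv : NonzeroGerm N v := by
    refine ⟨Finset.analyticAt_fun_prod _ fun b _ => (hJ b).comp (analyticAt_smul _ v), fun H => ?_⟩
    obtain ⟨k, hk, hkf⟩ := exists_nonzeroGerm_isFree G
    obtain ⟨x, hx, hx1, hx2⟩ :=
      ((hk v).frequently.and_eventually (H.and (eventually_proj_mem hv))).exists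
    exact hNne x hx2 (hkf x hx) hx1
  have hcard : (Fintype.card G : ℂ) ≠ 0 := by exact_mod_cast Fintype.card_ne_zero
  obtain ⟨h, hh, hhf⟩ := exists_nonzeroGerm_coord_isFree φ hv
  have hNc := nonzeroGerm_comp_out φ hv hN hNv
  refine ⟨_, fun w => Fintype.card G * N (Quotient.out (φ.toHomeo.symm w)),
    analyticAt_comp_out φ hv hK hKa, analyticAt_const.fun_mul hNc.1, fun H => hNc.2 ?_,
    .of_germ hh ?_⟩
  · exact H.mono fun w hw => (mul_eq_zero.1 hw).resolve_left hcard
  filter_upwards [φ.toHomeo.open_target.mem_nhds (chartMap_mem_target hv)] with w hw hne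
  obtain ⟨hxs, hxw⟩ := chartMap_out (φ := φ) hw
  have hxf := hhf w hne
  generalize Quotient.out (φ.toHomeo.symm w) = x at hxs hxw hxf ⊢
  subst hxw
  rw [eq_div_iff (mul_ne_zero hcard (hNne x hxs hxf))]
  have hterm : ∀ a : G, (∏ b : G, if b = a then F ((b : LinearMap.GeneralLinearGroup ℂ V) • x)
      else J ((b : LinearMap.GeneralLinearGroup ℂ V) • x))
      = component (pushforward (Z1 G U) P φ (chartMap φ x)) i j * N x := by
    intro a
    have h1 : F ((a : LinearMap.GeneralLinearGroup ℂ V) • x)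
        = J ((a : LinearMap.GeneralLinearGroup ℂ V) • x) *
          component (pushforward (Z1 G U) P φ (chartMap φ x)) i j := by
      rw [← chartMap_smul φ a.2 x, pushforward_chartMap hGU hP φ (by rwa [proj_smul a.2])
        (hinv x hxs hxf a)]
      exact scaledComponent_eq P φ i j (hinv x hxs hxf a)
    have h2 : N x = J ((a : LinearMap.GeneralLinearGroup ℂ V) • x) *
        ∏ b ∈ Finset.univ.erase a, J ((b : LinearMap.GeneralLinearGroup ℂ V) • x) :=
      (Finset.mul_prod_erase _ _ (Finset.mem_univ a)).symm
    rw [← Finset.mul_prod_erase _ _ (Finset.mem_univ a), if_pos rfl, h1, h2]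
    rw [Finset.prod_congr rfl fun b hb => if_neg (Finset.ne_of_mem_erase hb)]
    ring
  change _ = ∑ a : G, _
  rw [Finset.sum_congr rfl fun a _ => hterm a, Finset.sum_const, Finset.card_univ, nsmul_eq_mul]
  ring

/-- The meromorphic tensor field `π_* P`. -/
def pushforwardField {U : Set V} (hGU : ∀ g ∈ G, ∀ v ∈ U, g • v ∈ U)
    {P : V → Tensor p q V} (hP : IsHolomorphicInvariant G U P) :
    MeromorphicTensorField G (Z1 G U) p q where
  inChart := pushforward (Z1 G U) P
  meromorphic φ a ha i j := isMerAt_pushforward hGU hP φ ha i j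
  transform := by
    rintro φ ψ z ⟨hzφ, hzψ⟩
    obtain ⟨v, rfl⟩ : ∃ v, proj G v = z := ⟨_, proj_out z⟩
    obtain ⟨h, hh, hhf⟩ := exists_nonzeroGerm_coord_isFree φ hzφ
    refine .of_germ hh ?_
    filter_upwards [eventually_chartChange φ ψ hzφ hzψ] with w hw hne
    have hxf := hhf w hne
    obtain ⟨hxs, hxw⟩ := chartMap_out (φ := φ) hw.1
    have hxψ : proj G (Quotient.out (φ.toHomeo.symm w)) ∈ ψ.toHomeo.source := by
      rw [proj_out]; exact hw.2.1
    generalize Quotient.out (φ.toHomeo.symm w) = x at hxs hxw hxf hxψ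
    subst hxw
    change _ = tensorPullback (fderiv ℂ (chartChange φ ψ) _)
      (pushforward _ _ ψ (chartChange φ ψ (chartMap φ x)))
    have hA := isInvertible_fderiv_chartMap φ hxs hxf
    have hB := isInvertible_fderiv_chartMap ψ hxψ hxf
    have hC := isInvertible_fderiv_chartChange φ ψ hxs hxψ
    have hBA : fderiv ℂ (chartMap ψ) x
        = fderiv ℂ (chartChange φ ψ) (chartMap φ x) ∘L fderiv ℂ (chartMap φ) x := by
      rw [(eventually_chartMap_eq φ ψ hxs).fderiv_eq,
        fderiv_fun_comp _ (analyticAt_chartChange φ ψ hxs hxψ).differentiableAt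
          (analyticAt_chartMap φ hxs).differentiableAt]
    rw [chartChange_chartMap φ ψ hxs, pushforward_chartMap hGU hP φ hxs hA,
      pushforward_chartMap hGU hP ψ hxψ hB, ← tensorPullback_comp hC, hBA,
      hA.inverse_comp_of_right, ContinuousLinearMap.comp_assoc, hC.inverse_comp_self,
      ContinuousLinearMap.comp_id]

theorem extendsPullback_pushforwardField {U : Set V} (hGU : ∀ g ∈ G, ∀ v ∈ U, g • v ∈ U)
    {P : V → Tensor p q V} (hP : IsHolomorphicInvariant G U P) :
    ExtendsPullback P (pushforwardField hGU hP) := by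
  intro φ v hv
  obtain ⟨h, hh, hhf⟩ := exists_nonzeroGerm_isFree G
  refine .of_germ (hh v) ?_
  filter_upwards [eventually_proj_mem hv] with x hx hne
  have hA := isInvertible_fderiv_chartMap φ hx (hhf x hne)
  change _ = tensorPullback (fderiv ℂ (chartMap φ) x) (pushforward _ _ φ (chartMap φ x))
  rw [pushforward_chartMap hGU hP φ hx hA, tensorPullback_inverse hA]

end Pushforward

/-! ### Linear coordinates adapted to a reflection hyperplane -/

section Reflection

variable {V : Type*} [NormedAddCommGroup V] [NormedSpace ℂ V] [FiniteDimensional ℂ V]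
  (G : Subgroup (LinearMap.GeneralLinearGroup ℂ V))

/-- The order of the isotropy group of `v`. -/
def isotropyOrder (v : V) : ℕ :=
  Nat.card {g : LinearMap.GeneralLinearGroup ℂ V // g ∈ G ∧ g • v = v}

variable {G}

omit [FiniteDimensional ℂ V] in
theorem isotropyOrder_ne_zero [Finite G] (v : V) : isotropyOrder G v ≠ 0 := by
  have h1 : Finite {g : LinearMap.GeneralLinearGroup ℂ V // g ∈ G ∧ g • v = v} :=
    Finite.of_injective (fun g => (⟨g.1, g.2.1⟩ : G)) fun a b h =>
      Subtype.ext (congrArg (fun x : G => (x : LinearMap.GeneralLinearGroup ℂ V)) h)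
  have h2 : Nonempty {g : LinearMap.GeneralLinearGroup ℂ V // g ∈ G ∧ g • v = v} :=
    ⟨⟨1, one_mem _, one_smul _ _⟩⟩
  exact Nat.card_ne_zero.2 ⟨h2, h1⟩

omit [FiniteDimensional ℂ V] in
theorem isotropyOrder_smul {g : LinearMap.GeneralLinearGroup ℂ V} (hg : g ∈ G) (v : V) :
    isotropyOrder G (g • v) = isotropyOrder G v := by
  refine Nat.card_congr
    { toFun := fun a => ⟨g⁻¹ * a.1 * g, mul_mem (mul_mem (inv_mem hg) a.2.1) hg, by
        rw [mul_smul, mul_smul, a.2.2, inv_smul_smul]⟩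
      invFun := fun a => ⟨g * a.1 * g⁻¹, mul_mem (mul_mem hg a.2.1) (inv_mem hg), by
        rw [mul_smul, mul_smul, inv_smul_smul, a.2.2]⟩
      left_inv := fun a => Subtype.ext (by simp [mul_assoc])
      right_inv := fun a => Subtype.ext (by simp [mul_assoc]) }

omit [FiniteDimensional ℂ V] in
theorem mem_isotropyFixedSpace_self (v : V) : v ∈ isotropyFixedSpace G v := fun _ _ h => h

omit [FiniteDimensional ℂ V] in
theorem not_isFree_of_mem {v x : V} (hv : ¬ IsFree G v) (hx : x ∈ isotropyFixedSpace G v) :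
    ¬ IsFree G x := fun h => hv fun g hg hgv => h g hg (hx g hg hgv)

theorem finrank_isotropyFixedSpace_add_one {v : V} (hv : proj G v ∈ strataUpTo G 1)
    (hnf : ¬ IsFree G v) :
    Module.finrank ℂ (isotropyFixedSpace G v) + 1 = Module.finrank ℂ V := by
  have h1 := mem_strataUpTo_iff.1 hv
  have h2 : isotropyFixedSpace G v < ⊤ := by
    refine lt_top_iff_ne_top.2 fun h => hnf fun g hg hgv => eq_one_of_forall_smul fun x => ?_
    have hx : x ∈ isotropyFixedSpace G v := h ▸ Submodule.mem_top
    exact hx g hg hgv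
  have h3 := Submodule.finrank_lt h2.ne
  omega

/-- A hyperplane has an equation `ℓ = 0`. -/
theorem exists_equation {H : Submodule ℂ V}
    (hH : Module.finrank ℂ H + 1 = Module.finrank ℂ V) :
    ∃ ℓ : V →ₗ[ℂ] ℂ, (∃ x, ℓ x = 1) ∧ ∀ x, ℓ x = 0 ↔ x ∈ H := by
  have hlt : H < ⊤ := by
    refine lt_top_iff_ne_top.2 fun h => ?_
    rw [h, finrank_top] at hH
    omega
  obtain ⟨ℓ, hℓ, hHℓ⟩ := Submodule.exists_le_ker_of_lt_top H hlt
  have h1 : H = LinearMap.ker ℓ := by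
    refine Submodule.eq_of_le_of_finrank_eq hHℓ ?_
    have := Module.Dual.finrank_ker_add_one_of_ne_zero hℓ
    omega
  refine ⟨ℓ, LinearMap.surjective hℓ 1, fun x => ?_⟩
  rw [h1, LinearMap.mem_ker]

/-- A linear functional takes a nonzero value on a suitably numbered basis vector. -/
theorem exists_basis_ne_zero {ℓ : V →ₗ[ℂ] ℂ} (hℓ : ∃ x, ℓ x = 1)
    (k : Fin (Module.finrank ℂ V)) :
    ∃ b : Module.Basis (Fin (Module.finrank ℂ V)) ℂ V, ℓ (b k) ≠ 0 := by
  have h1 : ∃ j, ℓ (Module.finBasis ℂ V j) ≠ 0 := by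
    by_contra! h
    obtain ⟨x, hx⟩ := hℓ
    have : ℓ = 0 := (Module.finBasis ℂ V).ext fun j => by rw [h j]; rfl
    rw [this] at hx
    exact zero_ne_one hx
  obtain ⟨j, hj⟩ := h1
  exact ⟨(Module.finBasis ℂ V).reindex (Equiv.swap j k), by simpa using hj⟩

/-- Linear coordinates with `k`-th coordinate `ℓ`, the other ones vanishing on `w`. -/
theorem exists_adapted_coord {ℓ : V →ₗ[ℂ] ℂ} {w : V} (hw : ℓ w = 1)
    (k : Fin (Module.finrank ℂ V)) :
    ∃ θ : V ≃L[ℂ] Coord V, (∀ x, θ x k = ℓ x) ∧ ∀ j ≠ k, θ w j = 0 := by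
  obtain ⟨b, hb⟩ := exists_basis_ne_zero ⟨w, hw⟩ k
  let L : V →ₗ[ℂ] Coord V := LinearMap.pi fun j =>
    if j = k then ℓ else b.coord j ∘ₗ (LinearMap.id - ℓ.smulRight w)
  have hLk : ∀ x, L x k = ℓ x := fun x => by simp [L]
  have hLj : ∀ x, ∀ j ≠ k, L x j = b.coord j (x - ℓ x • w) := fun x j hj => by simp [L, hj]
  have hinj : Function.Injective L := by
    refine (injective_iff_map_eq_zero L).2 fun x hx => ?_
    have h1 : ℓ x = 0 := by rw [← hLk, hx]; rfl
    have h2 : ∀ j ≠ k, b.repr x j = 0 := fun j hj => by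
      have := hLj x j hj
      rw [hx, h1, zero_smul, sub_zero] at this
      exact this.symm
    have h3 : x = b.repr x k • b k := by
      conv_lhs => rw [← b.sum_repr x]
      exact Finset.sum_eq_single k (fun j _ hj => by rw [h2 j hj, zero_smul]) (by simp)
    rw [h3, map_smul, smul_eq_mul] at h1
    rw [h3, (mul_eq_zero.1 h1).resolve_right hb, zero_smul]
  refine ⟨(LinearMap.linearEquivOfInjective L hinj (by simp)).toContinuousLinearEquiv, hLk,
    fun j hj => ?_⟩
  change L w j = 0
  rw [hLj w j hj, hw, one_smul, sub_self, map_zero]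

/-- The isotropy group of a point `v` in a stratum of codimension one acts by a faithful character
`χ` on a line `ℂ w` complementary to `V^{G_v}`. In linear coordinates adapted to this decomposition
its orbits are the fibres of the map `powCoord k e`, where `e` is the order of the group, since `χ`
takes all `e`-th roots of unity as values. -/
theorem exists_reflectionCoord [Finite G] {v : V} (hv : proj G v ∈ strataUpTo G 1)
    (hnf : ¬ IsFree G v) (k : Fin (Module.finrank ℂ V)) :
    ∃ θ : V ≃L[ℂ] Coord V, (∀ x, θ x k = 0 ↔ x ∈ isotropyFixedSpace G v) ∧
      ∀ x y, powCoord k (isotropyOrder G v) (θ x) = powCoord k (isotropyOrder G v) (θ y) ↔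
        ∃ g ∈ G, g • v = v ∧ g • x = y := by
  obtain ⟨ℓ, ⟨x₀, hx₀⟩, hℓ⟩ := exists_equation (finrank_isotropyFixedSpace_add_one hv hnf)
  let K : Subgroup (LinearMap.GeneralLinearGroup ℂ V) :=
    G ⊓ MulAction.stabilizer (LinearMap.GeneralLinearGroup ℂ V) v
  have hKfin : Finite K := Finite.of_injective (fun g => (⟨g.1, g.2.1⟩ : G)) fun a b h =>
      Subtype.ext (congrArg (fun x : G => (x : LinearMap.GeneralLinearGroup ℂ V)) h)
  have hK : Fintype K := Fintype.ofFinite K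
  have hcard : isotropyOrder G v = Fintype.card K := by
    rw [← Nat.card_eq_fintype_card]; rfl
  have hfix : ∀ g : K, ∀ x, ℓ x = 0 → (g : LinearMap.GeneralLinearGroup ℂ V) • x = x :=
    fun g x hx => (hℓ x).1 hx g g.2.1 g.2.2
  let χ : K → ℂ := fun g => ℓ ((g : LinearMap.GeneralLinearGroup ℂ V) • x₀)
  have hact : ∀ g : K, ∀ x, (g : LinearMap.GeneralLinearGroup ℂ V) • x
      = x - ℓ x • x₀ + ℓ x • (g : LinearMap.GeneralLinearGroup ℂ V) • x₀ := by
    intro g x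
    have h1 := hfix g (x - ℓ x • x₀) (by simp [hx₀])
    rw [smul_sub_gl, smul_smul_gl] at h1
    rw [← h1, sub_add_cancel]
  have hχ : ∀ g : K, ∀ x, ℓ ((g : LinearMap.GeneralLinearGroup ℂ V) • x) = χ g * ℓ x := by
    intro g x
    rw [hact]
    simp [χ, hx₀, mul_comm]
  have hχ1 : χ 1 = 1 := by simp [χ, hx₀]
  have hχm : ∀ a b, χ (a * b) = χ a * χ b := fun a b => by
    simp only [χ, Subgroup.coe_mul, mul_smul]
    rw [hχ]
  let X : K →* ℂ := { toFun := χ, map_one' := hχ1, map_mul' := hχm }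
  have hχ0 : ∀ g, χ g ≠ 0 := fun g h => by
    have := hχm g g⁻¹
    rw [mul_inv_cancel, hχ1, h, zero_mul] at this
    exact one_ne_zero this
  have hχpow : ∀ g, χ g ^ isotropyOrder G v = 1 := fun g => by
    rw [hcard]
    change X g ^ _ = 1
    rw [← map_pow, pow_card_eq_one, map_one]
  have hcard0 : (Fintype.card K : ℂ) ≠ 0 := by exact_mod_cast Fintype.card_ne_zero
  -- the average of `χ(g)⁻¹ g x₀` spans an invariant line
  let w : V := (Fintype.card K : ℂ)⁻¹ •
    ∑ g : K, (χ g)⁻¹ • (g : LinearMap.GeneralLinearGroup ℂ V) • x₀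
  have hw : ℓ w = 1 := by
    have h1 : ∀ g : K, ℓ ((χ g)⁻¹ • (g : LinearMap.GeneralLinearGroup ℂ V) • x₀) = 1 := fun g => by
      rw [map_smul, hχ, hx₀, mul_one, smul_eq_mul, inv_mul_cancel₀ (hχ0 g)]
    simp only [w, map_smul, map_sum, h1]
    simp [hcard0]
  have hgw : ∀ g : K, (g : LinearMap.GeneralLinearGroup ℂ V) • w = χ g • w := by
    intro g
    have h1 : ∀ y : K → V, (g : LinearMap.GeneralLinearGroup ℂ V) • ∑ a, y a
        = ∑ a, (g : LinearMap.GeneralLinearGroup ℂ V) • y a := fun y =>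
      map_sum (smulCLE (g : LinearMap.GeneralLinearGroup ℂ V)) y Finset.univ
    simp only [w]
    rw [smul_smul_gl, h1, smul_comm (χ g)]
    refine congrArg (fun y : V => (Fintype.card K : ℂ)⁻¹ • y) ?_
    rw [Finset.smul_sum]
    refine Fintype.sum_equiv (Equiv.mulLeft g) _ _ fun a => ?_
    rw [smul_smul_gl]
    rw [Equiv.coe_mulLeft, hχm, Subgroup.coe_mul, ← mul_smul _ _ x₀, mul_inv, smul_smul (χ g),
      mul_inv_cancel_left₀ (hχ0 g)]
  have hact' : ∀ g : K, ∀ x, (g : LinearMap.GeneralLinearGroup ℂ V) • x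
      = x + ((χ g - 1) * ℓ x) • w := by
    intro g x
    have h1 := hfix g (x - ℓ x • w) (by simp [hw])
    rw [smul_sub_gl, smul_smul_gl, hgw, sub_eq_iff_eq_add] at h1
    clear_value w
    rw [h1]
    module
  have hχinj : Function.Injective χ := by
    refine (injective_iff_map_eq_one X).2 fun g hg => Subtype.ext ?_
    refine eq_one_of_forall_smul fun x => ?_
    have hg' : χ g = 1 := hg
    rw [hact', hg', sub_self, zero_mul, zero_smul, add_zero]
  -- `χ` is injective, so it takes `e` values, and there are at most `e` roots of unity
  have hroot : ∀ ζ : ℂ, ζ ^ isotropyOrder G v = 1 → ∃ g, χ g = ζ := by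
    intro ζ hζ
    have hpos : 0 < isotropyOrder G v := Nat.pos_of_ne_zero (isotropyOrder_ne_zero v)
    have h1 : Finset.univ.image χ ⊆ Polynomial.nthRootsFinset (isotropyOrder G v) (1 : ℂ) := by
      intro y hy
      obtain ⟨g, -, rfl⟩ := Finset.mem_image.1 hy
      exact (Polynomial.mem_nthRootsFinset hpos _).2 (hχpow g)
    have h2 : (Polynomial.nthRootsFinset (isotropyOrder G v) (1 : ℂ)).card
        ≤ (Finset.univ.image χ).card := by
      rw [Finset.card_image_of_injective _ hχinj, Finset.card_univ, ← hcard,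
        Polynomial.nthRootsFinset_def]
      exact (Multiset.toFinset_card_le _).trans (Polynomial.card_nthRoots _ _)
    have h3 := (Finset.eq_of_subset_of_card_le h1 h2).symm ▸
      (Polynomial.mem_nthRootsFinset hpos (1 : ℂ)).2 hζ
    obtain ⟨g, -, hg⟩ := Finset.mem_image.1 h3
    exact ⟨g, hg⟩
  obtain ⟨θ, hθk, hθj⟩ := exists_adapted_coord hw k
  have hθg : ∀ g : K, ∀ x, θ ((g : LinearMap.GeneralLinearGroup ℂ V) • x)
      = Function.update (θ x) k (χ g * θ x k) := by
    intro g x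
    ext j
    by_cases hj : j = k
    · subst hj
      rw [Function.update_self, hθk, hχ, hθk]
    · rw [Function.update_of_ne hj, hact', map_add, map_smul, Pi.add_apply, Pi.smul_apply,
        hθj j hj, smul_zero, add_zero]
  refine ⟨θ, fun x => by rw [hθk, hℓ], fun x y => ⟨fun h => ?_, ?_⟩⟩
  · have hk : θ x k ^ isotropyOrder G v = θ y k ^ isotropyOrder G v := by
      simpa using congrFun h k
    have hj : ∀ j ≠ k, θ x j = θ y j := fun j hj => by
      simpa [powCoord_of_ne, hj] using congrFun h j
    obtain ⟨ζ, hζ, hζy⟩ : ∃ ζ : ℂ, ζ ^ isotropyOrder G v = 1 ∧ θ y k = ζ * θ x k := by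
      by_cases h0 : θ x k = 0
      · rw [h0, zero_pow (isotropyOrder_ne_zero v)] at hk
        exact ⟨1, one_pow _, by rw [h0, pow_eq_zero_iff (isotropyOrder_ne_zero v) |>.1 hk.symm,
          mul_zero]⟩
      · refine ⟨θ y k / θ x k, ?_, (div_mul_cancel₀ _ h0).symm⟩
        rw [div_pow, ← hk, div_self (pow_ne_zero _ h0)]
    obtain ⟨g, rfl⟩ := hroot ζ hζ
    refine ⟨g, g.2.1, g.2.2, θ.injective ?_⟩
    rw [hθg, ← hζy]
    ext j
    by_cases hjk : j = k
    · subst hjk; simp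
    · rw [Function.update_of_ne hjk, hj j hjk]
  · rintro ⟨g, hg, hgv, rfl⟩
    rw [hθg ⟨g, hg, hgv⟩, powCoord, powCoord, Function.update_self, mul_pow, hχpow, one_mul,
      Function.update_idem]

/-- Near a point of a stratum of codimension at most one, the points with nontrivial isotropy group
lie in `V^{G_v}`. -/
theorem eventually_mem_of_not_isFree [Finite G] {v : V} (hv : proj G v ∈ strataUpTo G 1) :
    ∀ᶠ x in 𝓝 v, ¬ IsFree G x → x ∈ isotropyFixedSpace G v := by
  filter_upwards [eventually_isotropy_le (G := G) v] with x hx hnf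
  by_contra hxH
  by_cases hvf : IsFree G v
  · exact hxH (by rw [hvf.isotropyFixedSpace_eq]; trivial)
  obtain ⟨ℓ, -, hℓ⟩ := exists_equation (finrank_isotropyFixedSpace_add_one hv hvf)
  have hx0 : ℓ x ≠ 0 := fun h => hxH ((hℓ x).1 h)
  refine hnf fun g hg hgx => eq_one_of_forall_smul fun y => ?_
  have h1 : y - (ℓ y / ℓ x) • x ∈ isotropyFixedSpace G v := by
    rw [← hℓ, map_sub, map_smul, smul_eq_mul, div_mul_cancel₀ _ hx0, sub_self]
  have h2 := h1 g hg (hx g hg hgx)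
  rw [smul_sub_gl, smul_smul_gl, hgx] at h2
  exact sub_left_injective h2

/-- A reflection hyperplane through a point `v` of `π⁻¹(Z_1)` is the fixed space of `G_v`. -/
theorem IsReflectionHyperplane.eq_isotropyFixedSpace {H : Submodule ℂ V}
    (hH : IsReflectionHyperplane G H) {v : V} (hvH : v ∈ H) (hv : proj G v ∈ strataUpTo G 1) :
    H = isotropyFixedSpace G v := by
  obtain ⟨hr, g, hg, hg1, hgH⟩ := hH
  have hnf : ¬ IsFree G v := fun h => hg1 (h g hg (hgH v hvH))
  obtain ⟨ℓ, -, hℓ⟩ := exists_equation hr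
  refine (Submodule.eq_of_le_of_finrank_eq (fun x hx => ?_) ?_).symm
  · by_contra hxH
    have hx0 : ℓ x ≠ 0 := fun h => hxH ((hℓ x).1 h)
    refine hg1 (eq_one_of_forall_smul fun y => ?_)
    have h2 := hgH (y - (ℓ y / ℓ x) • x) (by
      rw [← hℓ, map_sub, map_smul, smul_eq_mul, div_mul_cancel₀ _ hx0, sub_self])
    rw [smul_sub_gl, smul_smul_gl, hx g hg (hgH v hvH)] at h2
    exact sub_left_injective h2
  · have := finrank_isotropyFixedSpace_add_one hv hnf
    omega

omit [FiniteDimensional ℂ V] in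
theorem hyperplaneLabel_isotropyFixedSpace (v : V) :
    hyperplaneLabel G (isotropyFixedSpace G v) = isotropyOrder G v := by
  refine Nat.card_congr (Equiv.subtypeEquivRight fun g => ?_)
  exact and_congr_right fun hg => ⟨fun h => h v (mem_isotropyFixedSpace_self v),
    fun h x hx => hx g hg h⟩

theorem isReflectionHyperplane_isotropyFixedSpace {v : V} (hv : proj G v ∈ strataUpTo G 1)
    (hnf : ¬ IsFree G v) : IsReflectionHyperplane G (isotropyFixedSpace G v) := by
  refine ⟨finrank_isotropyFixedSpace_add_one hv hnf, ?_⟩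
  simp only [IsFree, not_forall] at hnf
  obtain ⟨g, hg, hgv, hg1⟩ := hnf
  exact ⟨g, hg, hg1, fun x hx => hx g hg hgv⟩

variable {Ω : Set (OrbitSpace G)}

/-- The coefficient of the reflection divisor along a germ at `π(v)`, if it is not zero, is the
order of the isotropy group of `v`. -/
theorem exists_of_reflectionDivisor_ne_zero (hΩ : Ω ⊆ strataUpTo G 1) {S : HypersurfaceGerm G Ω}
    (hS : reflectionDivisor G Ω S ≠ 0) :
    ∃ v, proj G v = S.point ∧ ¬ IsFree G v ∧ reflectionDivisor G Ω S = isotropyOrder G v ∧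
      S.LiesIn (proj G '' isotropyFixedSpace G v) := by
  rw [reflectionDivisor] at hS ⊢
  split_ifs at hS ⊢ with h
  · obtain ⟨hH, hL⟩ := h.choose_spec
    obtain ⟨v, hvH, hvS⟩ := hL.self_of_nhds S.coord_eq_zero
    have hv : proj G v ∈ strataUpTo G 1 :=
      hΩ (S.chart.source_subset (by rw [hvS]; exact S.mem_source))
    have hHv := hH.eq_isotropyFixedSpace hvH hv
    obtain ⟨-, g, hg, hg1, hgH⟩ := hH
    refine ⟨v, hvS, fun hf => hg1 (hf g hg (hgH v hvH)), ?_, ?_⟩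
    · rw [hHv, hyperplaneLabel_isotropyFixedSpace]
    · rw [← hHv]; exact hL
  · exact absurd rfl hS

theorem reflectionDivisor_eq_isotropyOrder [Finite G] (hΩ : Ω ⊆ strataUpTo G 1)
    {S : HypersurfaceGerm G Ω}
    {v : V} (hvS : proj G v = S.point) (hnf : ¬ IsFree G v)
    (hL : S.LiesIn (proj G '' isotropyFixedSpace G v)) :
    reflectionDivisor G Ω S = isotropyOrder G v := by
  have hv : proj G v ∈ strataUpTo G 1 :=
    hΩ (S.chart.source_subset (by rw [hvS]; exact S.mem_source))
  have hex : ∃ H : Submodule ℂ V, IsReflectionHyperplane G H ∧ S.LiesIn (proj G '' H) :=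
    ⟨_, isReflectionHyperplane_isotropyFixedSpace hv hnf, hL⟩
  have h0 : reflectionDivisor G Ω S ≠ 0 := by
    rw [reflectionDivisor, dif_pos hex]
    obtain ⟨hH, hL'⟩ := hex.choose_spec
    obtain ⟨y, hyH, hyS⟩ := hL'.self_of_nhds S.coord_eq_zero
    rw [hH.eq_isotropyFixedSpace hyH (by rw [hyS, ← hvS]; exact hv),
      hyperplaneLabel_isotropyFixedSpace]
    exact isotropyOrder_ne_zero y
  obtain ⟨y, hyS, -, hy, -⟩ := exists_of_reflectionDivisor_ne_zero hΩ h0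
  obtain ⟨g, hg, rfl⟩ := (proj_eq_proj_iff G).1 (hvS.trans hyS.symm)
  rw [hy, isotropyOrder_smul hg]

theorem reflectionDivisor_eq_zero_of_isFree (hΩ : Ω ⊆ strataUpTo G 1) {S : HypersurfaceGerm G Ω}
    {v : V} (hvS : proj G v = S.point) (hf : IsFree G v) : reflectionDivisor G Ω S = 0 := by
  by_contra h
  obtain ⟨y, hyS, hy, -⟩ := exists_of_reflectionDivisor_ne_zero hΩ h
  obtain ⟨g, hg, rfl⟩ := (proj_eq_proj_iff G).1 (hvS.trans hyS.symm)
  exact hy (hf.smul hg)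

/-- Near a point of a stratum of codimension one there are charts which lift to the map
`powCoord k e` in linear coordinates, where `e` is the order of the isotropy group. -/
theorem exists_reflectionChart [Finite G] {v : V} (hv : proj G v ∈ strataUpTo G 1)
    (hnf : ¬ IsFree G v) (k : Fin (Module.finrank ℂ V)) (hΩ : ∀ᶠ x in 𝓝 v, proj G x ∈ Ω) :
    ∃ (ψ : Chart G Ω) (θ : V ≃L[ℂ] Coord V), proj G v ∈ ψ.toHomeo.source ∧
      (∀ x, θ x k = 0 ↔ x ∈ isotropyFixedSpace G v) ∧
      chartMap ψ =ᶠ[𝓝 v] fun x => powCoord k (isotropyOrder G v) (θ x) := by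
  obtain ⟨θ, hθ, hfibre⟩ := exists_reflectionCoord hv hnf k
  obtain ⟨N, hN, hvN, hNΩ, hsep, hinv⟩ := exists_slice (G := G) hΩ
  have he := isotropyOrder_ne_zero (G := G) v
  have hfib : ∀ x ∈ N, ∀ y ∈ N, proj G x = proj G y ↔
      powCoord k (isotropyOrder G v) (θ x) = powCoord k (isotropyOrder G v) (θ y) := by
    intro x hx y hy
    rw [hfibre, proj_eq_proj_iff]
    constructor
    · rintro ⟨g, hg, rfl⟩
      exact ⟨g, hg, hsep g hg x hx hy, rfl⟩
    · rintro ⟨g, hg, -, h⟩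
      exact ⟨g, hg, h⟩
  have hμa : ∀ x, AnalyticAt ℂ (fun y => powCoord k (isotropyOrder G v) (θ y)) x := fun x =>
    AnalyticAt.comp (g := powCoord k (isotropyOrder G v)) (f := θ) (analyticAt_powCoord _ _ _)
      ((θ : V →L[ℂ] Coord V).analyticAt x)
  obtain ⟨ψ, hψ, hψμ⟩ := exists_chart (G := G) (Ω := Ω)
    (μ := fun x => powCoord k (isotropyOrder G v) (θ x)) hN hNΩ hμa
    ((isOpenMap_powCoord he).comp θ.toHomeomorph.isOpenMap) hfib
    (fun f x h => analyticAt_of_comp_powCoord he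
      (analyticAt_of_comp_equiv θ (f := fun s => f (powCoord k (isotropyOrder G v) s)) h))
  exact ⟨ψ, θ, by rw [hψ]; exact ⟨v, hvN, rfl⟩, hθ, eventually_of_mem (hN.mem_nhds hvN) hψμ⟩

end Reflection

/-! ### Lifting coordinates through the power map -/

section Lift

variable {n : ℕ} {k : Fin n} {e : ℕ}

theorem exists_analytic_root {X : Type*} [NormedAddCommGroup X] [NormedSpace ℂ X] {f : X → ℂ}
    {x : X} (hf : AnalyticAt ℂ f x) (h0 : f x ≠ 0) (he : e ≠ 0) :
    ∃ c : X → ℂ, AnalyticAt ℂ c x ∧ c x ≠ 0 ∧ ∀ᶠ y in 𝓝 x, c y ^ e = f y := by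
  have h1 : AnalyticAt ℂ (fun y => f y / f x) x := hf.fun_div analyticAt_const h0
  have hs : f x / f x ∈ Complex.slitPlane := by
    rw [div_self h0]; exact Complex.one_mem_slitPlane
  refine ⟨fun y => Complex.exp ((Complex.log (f y / f x) + Complex.log (f x)) / e),
    (((h1.clog hs).fun_add analyticAt_const).fun_div analyticAt_const
      (by exact_mod_cast he)).cexp, Complex.exp_ne_zero _, ?_⟩
  filter_upwards [hf.continuousAt.eventually_ne h0] with y hy
  rw [← Complex.exp_nat_mul, mul_div_cancel₀ _ (by exact_mod_cast he : (e : ℂ) ≠ 0),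
    Complex.exp_add, Complex.exp_log (div_ne_zero hy h0), Complex.exp_log h0, div_mul_cancel₀ _ h0]

theorem fderiv_coord {E : Type*} [NormedAddCommGroup E] [NormedSpace ℂ E] {f : E → Fin n → ℂ}
    {a : E} (hf : DifferentiableAt ℂ f a) (j : Fin n) (x : E) :
    fderiv ℂ (fun w => f w j) a x = fderiv ℂ f a x j := by
  rw [(hasFDerivAt_pi'.1 hf.hasFDerivAt j).fderiv]
  rfl

theorem isInvertible_of_ker {A : (Fin n → ℂ) →L[ℂ] (Fin n → ℂ)} (h : ∀ x, A x = 0 → x = 0) :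
    A.IsInvertible := by
  have hinj : Function.Injective (A : (Fin n → ℂ) →ₗ[ℂ] (Fin n → ℂ)) :=
    (injective_iff_map_eq_zero _).2 h
  exact ⟨(LinearEquiv.ofInjectiveEndo _ hinj).toContinuousLinearEquiv, rfl⟩

/-- A local biholomorphism `T` which preserves the hyperplane `{y_k = 0}` lifts through the map
`powCoord k e`: its `k`-th coordinate is `y_k` times a nonvanishing function, and this function has
a holomorphic `e`-th root. -/
theorem exists_lift_powCoord (he : e ≠ 0) {T T' : (Fin n → ℂ) → Fin n → ℂ} {s₀ : Fin n → ℂ}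
    (hT : AnalyticAt ℂ T s₀) (hTi : (fderiv ℂ T s₀).IsInvertible) (hT' : AnalyticAt ℂ T' (T s₀))
    (hs₀ : s₀ k = 0) (hTs₀ : T s₀ k = 0) (hz : ∀ᶠ y in 𝓝 (T s₀), y k = 0 → T' y k = 0)
    (hinv : ∀ᶠ s in 𝓝 s₀, T' (T s) = s) :
    ∃ Θ : (Fin n → ℂ) → Fin n → ℂ, AnalyticAt ℂ Θ s₀ ∧ (fderiv ℂ Θ s₀).IsInvertible ∧
      Θ s₀ k = 0 ∧ ∀ᶠ t in 𝓝 s₀, powCoord k e (Θ t) = T (powCoord k e t) := by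
  obtain ⟨u, hu, hTu⟩ := coordDvdAt_of_eventually (analyticAt_pi_iff.1 hT' k) hTs₀
    (((tendsto_dropCoord hTs₀).eventually hz).mono fun y hy => hy (by simp))
  have hTk : AnalyticAt ℂ (fun s => T s k) s₀ := analyticAt_pi_iff.1 hT k
  have huT : AnalyticAt ℂ (fun s => u (T s)) s₀ := hu.comp hT
  have hrel : (fun s : Fin n → ℂ => s k) =ᶠ[𝓝 s₀] fun s => T s k * u (T s) := by
    filter_upwards [hinv, hT.continuousAt.eventually hTu] with s h1 h2
    rw [← h2, h1]
  have hder : ∀ x : Fin n → ℂ, x k = u (T s₀) * fderiv ℂ T s₀ x k := by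
    intro x
    have h1 : fderiv ℂ (fun s : Fin n → ℂ => s k) s₀ x = x k :=
      fderiv_coord (f := fun s => s) differentiableAt_id k x |>.trans (by simp)
    rw [← h1, hrel.fderiv_eq, fderiv_fun_mul hTk.differentiableAt huT.differentiableAt, hTs₀]
    simp [fderiv_coord hT.differentiableAt]
  have hu0 : u (T s₀) ≠ 0 := fun h => by
    have := hder (Pi.single k 1)
    simp [h] at this
  have hps : powCoord k e s₀ = s₀ := powCoord_of_eq_zero he hs₀
  have hpa := analyticAt_powCoord k e s₀
  have hTp : AnalyticAt ℂ (fun t => T (powCoord k e t)) s₀ :=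
    AnalyticAt.comp (g := T) (by rwa [hps]) hpa
  obtain ⟨c, hc, hc0, hce⟩ := exists_analytic_root (f := fun t => (u (T (powCoord k e t)))⁻¹)
    ((AnalyticAt.comp (g := fun s => u (T s)) (by rwa [hps]) hpa).fun_inv
      (by simpa [hps] using hu0))
    (by rw [hps]; exact inv_ne_zero hu0) he
  have hΘ : AnalyticAt ℂ (fun t => Function.update (T (powCoord k e t)) k (t k * c t)) s₀ :=
    analyticAt_update k hTp ((analyticAt_proj k s₀).fun_mul hc)
  refine ⟨_, hΘ, isInvertible_of_ker fun x hx => ?_, by simp [hs₀], ?_⟩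
  · have hxk : x k = 0 := by
      have h1 := congrFun hx k
      rw [← fderiv_coord hΘ.differentiableAt] at h1
      simp only [Function.update_self] at h1
      rw [fderiv_fun_mul (analyticAt_proj k s₀).differentiableAt hc.differentiableAt, hs₀] at h1
      have h2 : fderiv ℂ (fun s : Fin n → ℂ => s k) s₀ x = x k :=
        fderiv_coord (f := fun s => s) differentiableAt_id k x |>.trans (by simp)
      simpa [h2, hc0] using h1
    have hpx : fderiv ℂ (powCoord k e) s₀ x = x := by
      ext j
      rw [fderiv_powCoord_apply]
      by_cases hj : j = k
      · rw [hj, hxk, mul_zero]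
      · simp [powCoordEigenvalue, hj]
    refine hTi.injective ?_
    rw [map_zero]
    ext j
    by_cases hj : j = k
    · subst hj
      have := hder x
      rw [hxk] at this
      exact (mul_eq_zero.1 this.symm).resolve_left hu0
    · have h1 := congrFun hx j
      rw [← fderiv_coord hΘ.differentiableAt] at h1
      simp only [Function.update_of_ne hj] at h1
      rw [fderiv_coord hTp.differentiableAt, fderiv_fun_comp _ (by
        rw [hps]; exact hT.differentiableAt) hpa.differentiableAt, hps] at h1
      simpa [hpx] using h1
  · filter_upwards [hce, (hpa.continuousAt.tendsto.mono_right (by rw [hps])).eventually hrel,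
      (hTp.continuousAt.tendsto.mono_right (by rw [hps])).eventually
        (hu.continuousAt.eventually_ne hu0)] with t h1 h2 h3
    have h4 : T (powCoord k e t) k = t k ^ e * (u (T (powCoord k e t)))⁻¹ := by
      rw [eq_mul_inv_iff_mul_eq₀ h3, ← h2, powCoord_self]
    rw [powCoord, Function.update_self, Function.update_idem, mul_pow, h1, ← h4,
      Function.update_eq_self]

/-- Pullback along `powCoord k e` changes the order `m` of a coefficient into
`m e + (q' - p') (e - 1)`, where `p'` and `q'` count the indices `k`. -/
theorem merEqAt_component_pullback_powCoord {p q : ℕ} (he : e ≠ 0) {t₀ : Fin n → ℂ}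
    {R : (Fin n → ℂ) → Tensor p q (Fin n → ℂ)} {i : Fin p → Fin n} {j : Fin q → Fin n} {m : ℤ}
    {g h : (Fin n → ℂ) → ℂ} (hR : MerEqAt (fun w => component (R w) i j)
      (fun w => w k ^ m * (g w / h w)) (powCoord k e t₀)) :
    MerEqAt (fun t => component (pullbackField (powCoord k e) R t) i j)
      (fun t => (e : ℂ) ^ ((indexCount j k : ℤ) - indexCount i k) *
        t k ^ (m * e + ((indexCount j k : ℤ) - indexCount i k) * ((e : ℤ) - 1)) *
          (g (powCoord k e t) / h (powCoord k e t))) t₀ := by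
  have h1 := hR.comp (analyticAt_powCoord k e t₀) ((isOpenMap_powCoord he).nhds_le t₀)
  have h2 := h1.apply fun t x => ((e : ℂ) * t k ^ (e - 1)) ^ ((indexCount j k : ℤ)
    - indexCount i k) * x
  refine (MerEqAt.of_germ (nonzeroGerm_coord k t₀) (Eventually.of_forall fun t ht => ?_)).trans
    (h2.trans (MerEqAt.of_germ (nonzeroGerm_coord k t₀) (Eventually.of_forall fun t ht => ?_)))
  · exact component_pullbackField_powCoord he ht R i j
  · have h3 : ((e - 1 : ℕ) : ℤ) = (e : ℤ) - 1 := by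
      rw [Nat.cast_sub (Nat.one_le_iff_ne_zero.2 he), Nat.cast_one]
    rw [mul_zpow, powCoord_self, ← zpow_natCast (t k) (e - 1), ← zpow_natCast (t k) e,
      ← zpow_mul, ← zpow_mul, h3, zpow_add₀ ht, mul_comm m, mul_comm ((e : ℤ) - 1)]
    ring

/-- If a holomorphic tensor field is the pullback of `R` along a map which is `powCoord k e` up to
a local biholomorphism, then the orders of the coefficients of `R` are bounded from below. -/
theorem nonneg_of_extends_pullback {p q : ℕ} {E : Type*} [NormedAddCommGroup E] [NormedSpace ℂ E]
    [CompleteSpace E] (he : e ≠ 0) {f θ : E → Fin n → ℂ} {v : E} (hθ : AnalyticAt ℂ θ v)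
    (hθi : (fderiv ℂ θ v).IsInvertible) (hf : f =ᶠ[𝓝 v] fun x => powCoord k e (θ x))
    (h0 : θ v k = 0) {P : E → Tensor p q E} (hP : AnalyticAt ℂ P v)
    {R : (Fin n → ℂ) → Tensor p q (Fin n → ℂ)} (hPR : MerEqAt P (pullbackField f R) v)
    {i : Fin p → Fin n} {j : Fin q → Fin n} {m : ℤ}
    (hm : HasOrderAlong k (fun w => component (R w) i j) (f v) m) :
    0 ≤ m * e + ((indexCount j k : ℤ) - indexCount i k) * ((e : ℤ) - 1) := by
  obtain ⟨L, hvL, rfl, hL, hL'⟩ := exists_local_inverse hθ hθi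
  have ht := hL' (L v) (L.map_source hvL)
  have hLv : L.symm (L v) = v := L.left_inv hvL
  have hfv : f v = powCoord k e (L v) := hf.self_of_nhds
  have hps : powCoord k e (L v) = L v := powCoord_of_eq_zero he h0
  have h1 : MerEqAt P (pullbackField L (pullbackField (powCoord k e) R)) v := by
    refine hPR.trans (MerEqAt.of_eventuallyEq ((pullbackField_congr hf R).trans ?_))
    filter_upwards [L.open_source.mem_nhds hvL] with x hx
    exact pullbackField_comp (hL x hx).1.differentiableAt
      (analyticAt_powCoord _ _ _).differentiableAt (hL x hx).2 R
  have h2 : MerEqAt (pullbackField L.symm P) (pullbackField (powCoord k e) R) (L v) := by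
    refine (MerEqAt.pullbackField (f := L.symm) (by rwa [hLv]) ht.1
      (nhds_le_map_of_isInvertible ht.1 ht.2)).trans (MerEqAt.of_eventuallyEq ?_)
    filter_upwards [L.open_target.mem_nhds (L.map_source hvL)] with t htL
    have h3 := L.map_target htL
    rw [← pullbackField_comp (hL' t htL).1.differentiableAt (hL _ h3).1.differentiableAt
      (hL' t htL).2]
    have h4 : (fun x => L (L.symm x)) =ᶠ[𝓝 t] fun x => x := by
      filter_upwards [L.open_target.mem_nhds htL] with x hx using L.right_inv hx
    rw [(pullbackField_congr h4 _).self_of_nhds]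
    rw [pullbackField, fderiv_fun_id, tensorPullback_id]
  have h3 : AnalyticAt ℂ (pullbackField L.symm P) (L v) :=
    analyticAt_pullbackField (by rwa [hLv]) ht.1 ht.2
  obtain ⟨g, h, hg, hh, hgk, hhk, hR⟩ := hm
  rw [hfv] at hR hg hh hgk hhk
  have hpa := analyticAt_powCoord k e (L v)
  have hdrop : ∀ {g : (Fin n → ℂ) → ℂ}, AnalyticAt ℂ g (powCoord k e (L v)) →
      ¬ CoordDvdAt k g (powCoord k e (L v)) →
      NonzeroGerm (fun t => g (powCoord k e (dropCoord k t))) (L v) := by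
    intro g hg hgk
    simp_rw [powCoord_dropCoord he]
    rw [hps] at hg hgk
    exact nonzeroGerm_drop_of_not_dvd hg h0 hgk
  have hga : AnalyticAt ℂ (fun t => g (powCoord k e t)) (L v) := hg.comp hpa
  have hha : AnalyticAt ℂ (fun t => h (powCoord k e t)) (L v) := hh.comp hpa
  have hFa : AnalyticAt ℂ (fun t => component (pullbackField L.symm P t) i j) (L v) :=
    analyticAt_component h3 i j
  have hFM := (h2.apply fun _ T => component T i j).trans
    (merEqAt_component_pullback_powCoord he hR)
  have hc : (e : ℂ) ^ ((indexCount j k : ℤ) - indexCount i k) ≠ 0 :=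
    zpow_ne_zero _ (by exact_mod_cast he)
  exact nonneg_of_merEqAt_zpow hFa hga hha h0 hc (hdrop hg hgk)
    (NonzeroGerm.of_drop hha h0 (hdrop hh hhk)) hFM

/-- If all coefficients of `R` have sufficiently large orders along `{y_k = 0}`, then the pullback
of `R` along `powCoord k e` extends holomorphically over this hyperplane. -/
theorem holExtAt_pullback_powCoord {p q : ℕ} (he : e ≠ 0) {t₀ : Fin n → ℂ} (h0 : t₀ k = 0)
    {R : (Fin n → ℂ) → Tensor p q (Fin n → ℂ)}
    (hoff : ∀ᶠ t in 𝓝 t₀, t k ≠ 0 → HolExtAt (pullbackField (powCoord k e) R) t)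
    (hR : ∀ i j, MerEqAt (fun w => component (R w) i j) (fun _ => 0) (powCoord k e t₀) ∨
      ∃ m, HasOrderAlong k (fun w => component (R w) i j) (powCoord k e t₀) m ∧
        0 ≤ m * e + ((indexCount j k : ℤ) - indexCount i k) * ((e : ℤ) - 1)) :
    HolExtAt (pullbackField (powCoord k e) R) t₀ := by
  have hps : powCoord k e t₀ = t₀ := powCoord_of_eq_zero he h0
  have hpa := analyticAt_powCoord k e t₀
  refine holExtAt_of_components fun i j => ?_
  rcases hR i j with h | ⟨m, ⟨g, h, hg, hh, hgk, hhk, hR⟩, hm⟩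
  · have h1 := h.comp hpa ((isOpenMap_powCoord he).nhds_le t₀)
    have h2 := h1.apply fun t x => ((e : ℂ) * t k ^ (e - 1)) ^ ((indexCount j k : ℤ)
      - indexCount i k) * x
    simp only [mul_zero] at h2
    have h3 : MerEqAt (fun t => component (pullbackField (powCoord k e) R t) i j)
        (fun t => ((e : ℂ) * t k ^ (e - 1)) ^ ((indexCount j k : ℤ) - indexCount i k) *
          component (R (powCoord k e t)) i j) t₀ :=
      MerEqAt.of_germ (nonzeroGerm_coord k t₀) (Eventually.of_forall fun t ht =>
        component_pullbackField_powCoord he ht R i j)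
    exact (HolExtAt.of_analyticAt analyticAt_const).congr (h3.trans h2)
  · obtain ⟨M, hM⟩ := Int.eq_ofNat_of_zero_le hm
    have h1 := merEqAt_component_pullback_powCoord he hR
    rw [hM] at h1
    refine holExtAt_of_order_nonneg (k := k) (M := M)
      (G := fun t => (e : ℂ) ^ ((indexCount j k : ℤ) - indexCount i k) * g (powCoord k e t))
      (H := fun t => h (powCoord k e t)) ?_ (analyticAt_const.fun_mul (hg.comp hpa))
      (hh.comp hpa) h0 ?_ ?_
    · filter_upwards [hoff] with t ht htk
      obtain ⟨W, hW, hWR⟩ := ht htk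
      exact ⟨_, analyticAt_component hW i j, hWR.apply fun _ T => component T i j⟩
    · simp_rw [powCoord_dropCoord he]
      rw [hps] at hh hhk
      exact nonzeroGerm_drop_of_not_dvd hh h0 hhk
    · refine h1.trans (MerEqAt.of_eventuallyEq (Eventually.of_forall fun t => ?_))
      simp only [zpow_natCast]
      ring

/-- An order along a smooth hypersurface is locally constant on the hypersurface. -/
theorem HasOrderAlong.eventually {f : (Fin n → ℂ) → ℂ} {a : Fin n → ℂ} {m : ℤ} (ha : a k = 0)
    (h : HasOrderAlong k f a m) : ∀ᶠ b in 𝓝 a, b k = 0 → HasOrderAlong k f b m := by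
  obtain ⟨g, h, hg, hh, hgk, hhk, hf⟩ := h
  filter_upwards [hg.eventually_analyticAt, hh.eventually_analyticAt,
    (nonzeroGerm_drop_of_not_dvd hg ha hgk).eventually,
    (nonzeroGerm_drop_of_not_dvd hh ha hhk).eventually, hf.eventually] with b h1 h2 h3 h4 h5 hb
  exact ⟨g, h, h1, h2, not_dvd_of_nonzeroGerm_drop hb h3, not_dvd_of_nonzeroGerm_drop hb h4, h5⟩

end Lift

/-! ### The divisor of a field with a holomorphic pullback -/

section Divisor

variable {V : Type*} [NormedAddCommGroup V] [NormedSpace ℂ V]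
  {G : Subgroup (LinearMap.GeneralLinearGroup ℂ V)} {Ω : Set (OrbitSpace G)} {p q : ℕ}

/-- The two cases in the definition of `div_D` are the cases `r = 1` and `r = e_S` of the reflection
residuum. -/
theorem zero_le_divD_iff (Q : MeromorphicTensorField G Ω p q) (D : HypersurfaceGerm G Ω → ℕ) :
    0 ≤ Q.divD D ↔ ∀ S i j, 0 ≤ Q.residuum S (max 1 (D S)) i j := by
  rw [Pi.le_def]
  refine forall_congr' fun S => ?_
  rw [Pi.zero_apply, MeromorphicTensorField.divD]
  split_ifs with h
  · have h1 : ∀ i j, Q.residuum S (max 1 (D S)) i j = Q.coeffOrder S i j := fun i j => by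
      rw [h, MeromorphicTensorField.residuum]
      simp only [zero_le, sup_of_le_left, Nat.cast_one, sub_self, mul_one, mul_zero, add_zero]
      exact congrFun WithTop.map_id (Q.coeffOrder S i j)
    simp [MeromorphicTensorField.div, Finset.le_inf_iff, h1]
  · have h1 : max 1 (D S) = D S := max_eq_right (Nat.one_le_iff_ne_zero.2 h)
    simp [Finset.le_inf_iff, h1]

theorem zero_le_residuum (Q : MeromorphicTensorField G Ω p q) (S : HypersurfaceGerm G Ω) (r : ℕ)
    (i : Fin p → Fin (Module.finrank ℂ V)) (j : Fin q → Fin (Module.finrank ℂ V))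
    (h : ∀ m, HasOrderAlong S.index (fun w => component (Q.inChart S.chart w) i j)
        (S.chart.toHomeo S.point) m →
      0 ≤ m * r + ((indexCount j S.index : ℤ) - indexCount i S.index) * ((r : ℤ) - 1)) :
    0 ≤ Q.residuum S r i j := by
  rw [MeromorphicTensorField.residuum, MeromorphicTensorField.coeffOrder]
  by_cases h0 : MerEqAt (fun w => component (Q.inChart S.chart w) i j) (fun _ => 0)
    (S.chart.toHomeo S.point)
  · rw [orderAlong, if_pos h0]
    exact le_top
  · obtain ⟨m, hm, hmo⟩ := (Q.meromorphic S.chart _ (S.chart.toHomeo.map_source S.mem_source)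
      i j).orderAlong_spec S.coord_eq_zero h0
    rw [hmo, WithTop.map_coe]
    exact_mod_cast h m hm

theorem exists_hasOrderAlong_of_zero_le_residuum {Q : MeromorphicTensorField G Ω p q}
    {S : HypersurfaceGerm G Ω} {r : ℕ} {i : Fin p → Fin (Module.finrank ℂ V)}
    {j : Fin q → Fin (Module.finrank ℂ V)} (h : 0 ≤ Q.residuum S r i j) :
    MerEqAt (fun w => component (Q.inChart S.chart w) i j) (fun _ => 0)
        (S.chart.toHomeo S.point) ∨
      ∃ m, HasOrderAlong S.index (fun w => component (Q.inChart S.chart w) i j)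
          (S.chart.toHomeo S.point) m ∧
        0 ≤ m * r + ((indexCount j S.index : ℤ) - indexCount i S.index) * ((r : ℤ) - 1) := by
  refine or_iff_not_imp_left.2 fun h0 => ?_
  obtain ⟨m, hm, hmo⟩ := (Q.meromorphic S.chart _ (S.chart.toHomeo.map_source S.mem_source)
    i j).orderAlong_spec S.coord_eq_zero h0
  refine ⟨m, hm, ?_⟩
  rw [MeromorphicTensorField.residuum, MeromorphicTensorField.coeffOrder, hmo, WithTop.map_coe] at h
  exact_mod_cast h

variable [FiniteDimensional ℂ V] [Finite G]

/-- A hypersurface germ which is not in the support of the reflection divisor meets `Z_0` in points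
arbitrarily close to its base point. -/
theorem exists_isFree_of_reflectionDivisor_eq_zero (hΩ : Ω ⊆ strataUpTo G 1)
    {S : HypersurfaceGerm G Ω} (hS : reflectionDivisor G Ω S = 0) {W : Set (OrbitSpace G)}
    (hW : W ∈ 𝓝 S.point) :
    ∃ v, IsFree G v ∧ proj G v ∈ W ∧ S.chart.toHomeo (proj G v) S.index = 0 := by
  obtain ⟨v, hvS⟩ : ∃ v, proj G v = S.point := ⟨_, proj_out _⟩
  by_cases hf : IsFree G v
  · exact ⟨v, hf, by rw [hvS]; exact mem_of_mem_nhds hW, by rw [hvS]; exact S.coord_eq_zero⟩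
  have hv : proj G v ∈ strataUpTo G 1 :=
    hΩ (S.chart.source_subset (by rw [hvS]; exact S.mem_source))
  have hL : ¬ S.LiesIn (proj G '' isotropyFixedSpace G v) := fun h =>
    isotropyOrder_ne_zero v ((reflectionDivisor_eq_isotropyOrder hΩ hvS hf h).symm.trans hS)
  by_contra! hcon
  refine hL ?_
  rw [HypersurfaceGerm.LiesIn, ← hvS]
  refine (isOpenMap_proj.nhds_le v) ?_
  rw [mem_map]
  have hW' : ∀ᶠ x in 𝓝 v, proj G x ∈ W :=
    continuous_proj.continuousAt.eventually_mem (by rwa [hvS])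
  filter_upwards [eventually_mem_of_not_isFree hv, hW'] with x hx hxW hx0
  exact ⟨x, hx fun hxf => hcon x hxf hxW hx0, rfl⟩

/-- Coordinates near a point `π(v)` of a germ `S` in the support of the reflection divisor lift to
`powCoord k e` up to local biholomorphisms of `V`, where `S = {y^k = 0}` and `e = e_S`. -/
theorem exists_lift_of_reflectionDivisor_ne_zero (hΩ : Ω ⊆ strataUpTo G 1)
    {S : HypersurfaceGerm G Ω} (hS : reflectionDivisor G Ω S ≠ 0) :
    ∃ (v : V) (θ : V → Coord V), proj G v = S.point ∧ AnalyticAt ℂ θ v ∧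
      (fderiv ℂ θ v).IsInvertible ∧ θ v S.index = 0 ∧
      chartMap S.chart =ᶠ[𝓝 v] fun x => powCoord S.index (reflectionDivisor G Ω S) (θ x) := by
  obtain ⟨v, hvS, hnf, hlab, hL⟩ := exists_of_reflectionDivisor_ne_zero hΩ hS
  have hvs : proj G v ∈ S.chart.toHomeo.source := by rw [hvS]; exact S.mem_source
  have hv : proj G v ∈ strataUpTo G 1 := hΩ (S.chart.source_subset hvs)
  have hnear : ∀ᶠ x in 𝓝 v, proj G x ∈ Ω :=
    (eventually_proj_mem hvs).mono fun x hx => S.chart.source_subset hx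
  obtain ⟨ψ, θ, hψ, hθ, hψθ⟩ := exists_reflectionChart hv hnf S.index hnear
  rw [hlab]
  have he := isotropyOrder_ne_zero (G := G) v
  generalize isotropyOrder G v = e at he hψθ
  have hθv : θ v S.index = 0 := (hθ v).2 (mem_isotropyFixedSpace_self v)
  have hψv : chartMap ψ v = θ v := hψθ.self_of_nhds.trans (powCoord_of_eq_zero he hθv)
  have hT := analyticAt_chartChange ψ S.chart hψ hvs
  have hTi := isInvertible_fderiv_chartChange ψ S.chart hψ hvs
  have hTv := chartChange_chartMap ψ S.chart hψ
  have hcoord : chartMap S.chart v S.index = 0 := by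
    rw [chartMap, hvS]; exact S.coord_eq_zero
  have hz : ∀ᶠ y in 𝓝 (chartMap S.chart v), y S.index = 0 →
      chartChange S.chart ψ y S.index = 0 := by
    refine nhds_le_map_chartMap S.chart hvs ?_
    rw [mem_map]
    have hL' : ∀ᶠ x in 𝓝 v, S.chart.toHomeo (proj G x) S.index = 0 →
        proj G x ∈ proj G '' isotropyFixedSpace G v :=
      continuous_proj.continuousAt.eventually (by rw [hvS]; exact hL)
    filter_upwards [eventually_mem_of_not_isFree hv, hL', hψθ, eventually_proj_mem hvs]
      with x hx hxL hxψ hxs hx0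
    obtain ⟨y, hy, hyx⟩ := hxL hx0
    obtain ⟨g, hg, rfl⟩ := (proj_eq_proj_iff G).1 hyx
    have hxH := hx fun hf => not_isFree_of_mem hnf hy
      (by simpa using hf.smul (inv_mem hg))
    rw [chartChange_chartMap _ _ hxs, hxψ, powCoord_self, (hθ _).2 hxH, zero_pow he]
  have hinv := (eventually_chartChange ψ S.chart hψ hvs).mono fun w hw => hw.2.2
  have hT' := analyticAt_chartChange S.chart ψ hvs hψ
  rw [← hTv] at hT' hz hcoord
  rw [hψv] at hT hTi hT' hz hcoord hinv
  obtain ⟨Θ, hΘ, hΘi, hΘ0, hΘe⟩ := exists_lift_powCoord he hT hTi hT' hθv hcoord hz hinv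
  have hθa : AnalyticAt ℂ θ v := (θ : V →L[ℂ] Coord V).analyticAt v
  have hθf : fderiv ℂ (fun x => θ x) v = (θ : V →L[ℂ] Coord V) :=
    ContinuousLinearMap.fderiv (θ : V →L[ℂ] Coord V)
  refine ⟨v, fun x => Θ (θ x), hvS, hΘ.comp hθa, ?_, hΘ0, ?_⟩
  · rw [fderiv_fun_comp _ hΘ.differentiableAt hθa.differentiableAt, hθf]
    exact hΘi.comp ContinuousLinearMap.isInvertible_equiv
  · filter_upwards [eventually_chartMap_eq ψ S.chart hψ, hψθ, hθa.continuousAt.eventually hΘe]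
      with x h1 h2 h3
    rw [h1, h2, h3]

/-- A field whose pullback extends to a holomorphic field has a nonnegative divisor. -/
theorem zero_le_divD_of_extendsPullback {U : Set V} (hGU : ∀ g ∈ G, ∀ v ∈ U, g • v ∈ U)
    {P : V → Tensor p q V} (hP : AnalyticOnNhd ℂ P U) {Q : MeromorphicTensorField G (Z1 G U) p q}
    (hPQ : ExtendsPullback P Q) : 0 ≤ Q.divD (reflectionDivisor G (Z1 G U)) := by
  have hΩ : Z1 G U ⊆ strataUpTo G 1 := Set.inter_subset_left
  rw [zero_le_divD_iff]
  refine fun S i j => zero_le_residuum Q S _ i j fun m hm => ?_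
  have hPv : ∀ v, proj G v ∈ S.chart.toHomeo.source → AnalyticAt ℂ P v := fun v hv =>
    hP v (proj_preimage_image hGU (S.chart.source_subset hv).2)
  by_cases hS : reflectionDivisor G (Z1 G U) S = 0
  · -- at a nearby point of `Z_0` on `S` the order is the same, and `π` is étale
    rw [hS, max_eq_left (zero_le_one)]
    have hW := (S.chart.toHomeo.continuousAt S.mem_source).eventually
      (HasOrderAlong.eventually S.coord_eq_zero hm)
    obtain ⟨v, hvf, ⟨hvW, hvs⟩, hv0⟩ := exists_isFree_of_reflectionDivisor_eq_zero hΩ hS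
      (inter_mem hW (S.chart.toHomeo.open_source.mem_nhds S.mem_source))
    refine nonneg_of_extends_pullback one_ne_zero (analyticAt_chartMap S.chart hvs)
      (isInvertible_fderiv_chartMap S.chart hvs hvf)
      (Eventually.of_forall fun x => ?_) hv0 (hPv v hvs) (hPQ S.chart v hvs) (hvW hv0)
    simp [powCoord, chartMap]
  · obtain ⟨v, θ, hvS, hθ, hθi, hθ0, hlift⟩ := exists_lift_of_reflectionDivisor_ne_zero hΩ hS
    have hvs : proj G v ∈ S.chart.toHomeo.source := by rw [hvS]; exact S.mem_source
    rw [max_eq_right (Nat.one_le_iff_ne_zero.2 hS)]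
    refine nonneg_of_extends_pullback hS hθ hθi hlift hθ0 (hPv v hvs) (hPQ S.chart v hvs) ?_
    rw [chartMap, hvS]
    exact hm

end Divisor

/-! ### Smooth points of thin sets -/

section ThinSets

variable {n : ℕ}

theorem NonzeroGerm.exists_iteratedFDeriv_ne_zero {h : (Fin n → ℂ) → ℂ} {a : Fin n → ℂ}
    (hh : NonzeroGerm h a) : ∃ N, iteratedFDeriv ℂ N h a ≠ 0 := by
  by_contra! hcon
  obtain ⟨p, r, hp⟩ := hh.1
  refine hh.2 ?_
  filter_upwards [Metric.eball_mem_nhds a hp.r_pos] with w hw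
  have h1 := hp.hasSum_sub hw
  have h2 : (fun m => p m fun _ => w - a) = fun _ => 0 := by
    funext m
    have h3 := hp.factorial_smul (w - a) m
    rw [hcon m] at h3
    simpa [Nat.factorial_ne_zero] using h3
  rw [h2] at h1
  exact h1.unique hasSum_zero

/-- A nonempty set which is contained in the zero set of a nonzero holomorphic function is near one
of its points contained in the zero set of a holomorphic function with nonzero differential: some
partial derivative of minimal order which does not vanish identically on the set will do. -/
theorem exists_regular_equation {X W : Set (Fin n → ℂ)} (hW : IsOpen W) {h : (Fin n → ℂ) → ℂ}
    {a : Fin n → ℂ} (hh : NonzeroGerm h a) (ha : a ∈ X) (haW : a ∈ W)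
    (hX : ∀ᶠ w in 𝓝 a, w ∈ X → h w = 0) :
    ∃ b ∈ X, b ∈ W ∧ ∃ y : (Fin n → ℂ) → ℂ, AnalyticAt ℂ y b ∧ (∀ᶠ w in 𝓝 b, w ∈ X → y w = 0) ∧
      ∃ k, fderiv ℂ y b (Pi.single k 1) ≠ 0 := by
  obtain ⟨N, hN⟩ := hh.exists_iteratedFDeriv_ne_zero
  have hha := hh.1
  clear hh
  have hiter : ∀ {b N}, AnalyticAt ℂ h b → AnalyticAt ℂ (iteratedFDeriv ℂ N h) b := fun {b N} hb =>
    AnalyticOnNhd.iteratedFDeriv (s := {b}) (fun x hx => hx ▸ hb) N b rfl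
  induction N generalizing a with
  | zero =>
    refine absurd ?_ hN
    ext m
    simpa using hX.self_of_nhds ha
  | succ N ih =>
    obtain ⟨m, hm⟩ : ∃ m, iteratedFDeriv ℂ (N + 1) h a m ≠ 0 := by
      by_contra! hcon
      exact hN (ContinuousMultilinearMap.ext hcon)
    let y : (Fin n → ℂ) → ℂ := fun w => iteratedFDeriv ℂ N h w (Fin.tail m)
    have hya : AnalyticAt ℂ y a :=
      AnalyticAt.comp
        (g := ContinuousMultilinearMap.apply ℂ (fun _ : Fin N => Fin n → ℂ) ℂ (Fin.tail m))
        (ContinuousLinearMap.analyticAt _ _) (hiter hha)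
    have hdy : fderiv ℂ y a (m 0) ≠ 0 := by
      have h1 : fderiv ℂ y a = (ContinuousMultilinearMap.apply ℂ (fun _ : Fin N => Fin n → ℂ) ℂ
          (Fin.tail m)).comp (fderiv ℂ (iteratedFDeriv ℂ N h) a) :=
        ((ContinuousMultilinearMap.apply ℂ (fun _ : Fin N => Fin n → ℂ) ℂ
          (Fin.tail m)).hasFDerivAt.comp a
            (hiter hha).differentiableAt.hasFDerivAt).fderiv
      rw [h1]
      rwa [iteratedFDeriv_succ_apply_left] at hm
    by_cases hyX : ∀ᶠ w in 𝓝 a, w ∈ X → y w = 0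
    · refine ⟨a, ha, haW, y, hya, hyX, ?_⟩
      by_contra! hcon
      refine hdy ?_
      have h2 : m 0 = ∑ k, m 0 k • (Pi.single k 1 : Fin n → ℂ) := by
        ext j; simp [Finset.sum_apply, Pi.single_apply]
      rw [h2, map_sum]
      exact Finset.sum_eq_zero fun k _ => by rw [map_smul, hcon k, smul_zero]
    · obtain ⟨w, hw, hw1, hw2, hw3⟩ := ((not_eventually.1 hyX).and_eventually
        (hX.eventually_nhds.and (hha.eventually_analyticAt.and (hW.mem_nhds haW)))).exists
      rw [Classical.not_imp] at hw
      exact ih hw.1 hw3 hw1 (fun h0 => hw.2 (by simp [y, h0])) hw2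

end ThinSets

/-! ### Extension over the quotient of codimension one -/

section Extension

variable {V : Type*} [NormedAddCommGroup V] [NormedSpace ℂ V] [FiniteDimensional ℂ V]
  {G : Subgroup (LinearMap.GeneralLinearGroup ℂ V)} {Ω : Set (OrbitSpace G)} {p q : ℕ}
  {Q : MeromorphicTensorField G Ω p q}

theorem holExtAt_inChart_of_holExtAt_inChart {φ ψ : Chart G Ω} {v : V}
    (hφ : proj G v ∈ φ.toHomeo.source) (hψ : proj G v ∈ ψ.toHomeo.source)
    (h : HolExtAt (Q.inChart φ) (chartMap φ v)) : HolExtAt (Q.inChart ψ) (chartMap ψ v) := by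
  refine HolExtAt.congr (HolExtAt.pullbackField (f := chartChange ψ φ) ?_
    (analyticAt_chartChange ψ φ hψ hφ) (isInvertible_fderiv_chartChange ψ φ hψ hφ))
    (Q.transform ψ φ _ ⟨hψ, hφ⟩)
  rwa [chartChange_chartMap ψ φ hψ]

/-- Replacing the `k`-th coordinate by a function `y` with `∂y/∂w_k ≠ 0`. -/
theorem isInvertible_fderiv_update {n : ℕ} {k : Fin n} {b : Fin n → ℂ} {y : (Fin n → ℂ) → ℂ}
    (hy : AnalyticAt ℂ y b) (hk : fderiv ℂ y b (Pi.single k 1) ≠ 0) :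
    (fderiv ℂ (fun w : Fin n → ℂ => Function.update w k (y w)) b).IsInvertible := by
  have hC : AnalyticAt ℂ (fun w : Fin n → ℂ => Function.update w k (y w)) b :=
    analyticAt_update k analyticAt_id hy
  refine isInvertible_of_ker fun x hx => ?_
  have h1 : ∀ j ≠ k, x j = 0 := by
    intro j hj
    have h2 := congrFun hx j
    rw [← fderiv_coord hC.differentiableAt] at h2
    simp only [Function.update_of_ne hj] at h2
    have h3 : fderiv ℂ (fun s : Fin n → ℂ => s j) b x = x j :=
      fderiv_coord (f := fun s => s) differentiableAt_id j x |>.trans (by simp)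
    rwa [h3] at h2
  have h2 : x = x k • (Pi.single k 1 : Fin n → ℂ) := by
    ext j
    by_cases hj : j = k
    · subst hj; simp
    · simp [h1 j hj, hj]
  have h3 := congrFun hx k
  rw [← fderiv_coord hC.differentiableAt] at h3
  simp only [Function.update_self] at h3
  rw [h2, map_smul, smul_eq_mul] at h3
  rw [h2, (mul_eq_zero.1 h3).resolve_right hk, zero_smul]

omit [FiniteDimensional ℂ V] in
/-- The set of singularities of a meromorphic tensor field is contained in the zero set of the
product of the denominators of its coefficients. -/
theorem exists_denominator (φ : Chart G Ω) {a : Coord V} (ha : a ∈ φ.toHomeo.target) :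
    ∃ h : Coord V → ℂ, NonzeroGerm h a ∧
      ∀ᶠ w in 𝓝 a, ¬ HolExtAt (Q.inChart φ) w → h w = 0 := by
  choose g h hg hh hh0 hQ using Q.meromorphic φ a ha
  refine ⟨fun w => ∏ i, ∏ j, h i j w, NonzeroGerm.prod _ fun i _ => NonzeroGerm.prod _ fun j _ =>
    ⟨hh i j, hh0 i j⟩, ?_⟩
  have h1 : ∀ᶠ w in 𝓝 a, ∀ i j, AnalyticAt ℂ (g i j) w ∧ AnalyticAt ℂ (h i j) w ∧
      MerEqAt (fun w => component (Q.inChart φ w) i j) (fun w => g i j w / h i j w) w :=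
    eventually_all.2 fun i => eventually_all.2 fun j =>
      (hg i j).eventually_analyticAt.and ((hh i j).eventually_analyticAt.and (hQ i j).eventually)
  filter_upwards [h1] with w hw hnot
  by_contra hne
  refine hnot (holExtAt_of_components fun i j => ?_)
  obtain ⟨hga, hha, hM⟩ := hw i j
  have hne' : h i j w ≠ 0 := Finset.prod_ne_zero_iff.1
    (Finset.prod_ne_zero_iff.1 hne i (Finset.mem_univ _)) j (Finset.mem_univ _)
  exact (HolExtAt.of_analyticAt (hga.fun_div hha hne')).congr hM

variable [Finite G]

/-- A meromorphic tensor field with nonnegative divisor is holomorphic on `Z_0`: otherwise its set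
of singularities would be contained in a smooth hypersurface near one of its points, and the
coefficients would have nonnegative order along this hypersurface. -/
theorem holExtAt_inChart_of_isFree (hΩ : Ω ⊆ strataUpTo G 1)
    (hQ : 0 ≤ Q.divD (reflectionDivisor G Ω)) (φ : Chart G Ω) {v : V}
    (hv : proj G v ∈ φ.toHomeo.source) (hf : IsFree G v) :
    HolExtAt (Q.inChart φ) (chartMap φ v) := by
  by_contra hnot
  rw [zero_le_divD_iff] at hQ
  obtain ⟨h, hh, hX⟩ := exists_denominator (Q := Q) φ (chartMap_mem_target hv)
  have hfree : ∀ᶠ w in 𝓝 (chartMap φ v), w ∈ φ.toHomeo.target ∧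
      IsFree G (Quotient.out (φ.toHomeo.symm w)) := by
    refine Filter.Eventually.and (φ.toHomeo.open_target.mem_nhds (chartMap_mem_target hv)) ?_
    refine nhds_le_map_chartMap φ hv ?_
    rw [mem_map]
    filter_upwards [eventually_isFree hf, eventually_proj_mem hv] with x hx hxs
    change IsFree G (Quotient.out (φ.toHomeo.symm (chartMap φ x)))
    rw [symm_chartMap hxs]
    obtain ⟨g, hg, hgx⟩ := (proj_eq_proj_iff G).1 (proj_out (proj G x)).symm
    rw [← hgx]
    exact hx.smul hg
  obtain ⟨W, hW, hWo, hvW⟩ := eventually_nhds_iff.1 hfree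
  obtain ⟨b, hbX, hbW, y, hy, hyX, k, hk⟩ := exists_regular_equation
    (X := {w | ¬ HolExtAt (Q.inChart φ) w}) hWo hh hnot hvW hX
  have hyb : y b = 0 := hyX.self_of_nhds hbX
  have hC : AnalyticAt ℂ (fun w : Coord V => Function.update w k (y w)) b :=
    analyticAt_update k analyticAt_id hy
  have hCi := isInvertible_fderiv_update hy hk
  obtain ⟨e, hbe, heC, he, he'⟩ := exists_local_inverse hC hCi
  -- coordinates in which the hypersurface `{y = 0}` is a coordinate hyperplane
  let φ' : Chart G Ω := φ.trans e (fun x hx => by rw [heC]; exact (he x hx).1)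
    fun y hy => (he' y hy).1
  have hlift : ∀ w ∈ W, w ∈ e.source →
      proj G (Quotient.out (φ.toHomeo.symm w)) ∈ φ.toHomeo.source ∧
      proj G (Quotient.out (φ.toHomeo.symm w)) ∈ φ'.toHomeo.source ∧
      chartMap φ (Quotient.out (φ.toHomeo.symm w)) = w ∧
      chartMap φ' (Quotient.out (φ.toHomeo.symm w)) = Function.update w k (y w) := by
    intro w hw hwe
    obtain ⟨h1, h2⟩ := chartMap_out (hW w hw).1
    have h3 : chartMap φ' (Quotient.out (φ.toHomeo.symm w)) = e (chartMap φ
        (Quotient.out (φ.toHomeo.symm w))) := rfl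
    refine ⟨h1, ?_, h2, by rw [h3, h2, heC]⟩
    change _ ∈ (φ.toHomeo.trans e).source
    rw [OpenPartialHomeomorph.trans_source]
    refine ⟨h1, ?_⟩
    change chartMap φ _ ∈ e.source
    rwa [h2]
  obtain ⟨hb1, hb2, hb3, hb4⟩ := hlift b hbW hbe
  have hbf := (hW b hbW).2
  generalize Quotient.out (φ.toHomeo.symm b) = x at hb1 hb2 hb3 hb4 hbf
  have hC0 : Function.update b k (y b) k = 0 := by rw [Function.update_self, hyb]
  let S : HypersurfaceGerm G Ω := ⟨φ', k, proj G x, hb2, by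
    change chartMap φ' x k = 0
    rw [hb4, hC0]⟩
  have hS : reflectionDivisor G Ω S = 0 := reflectionDivisor_eq_zero_of_isFree hΩ rfl hbf
  have hpow : powCoord k 1 = fun t : Coord V => t := by
    funext t
    simp [powCoord]
  have hid : pullbackField (fun t : Coord V => t) (Q.inChart φ') = Q.inChart φ' := by
    funext t
    rw [pullbackField, fderiv_fun_id, tensorPullback_id]
  have hres := holExtAt_pullback_powCoord (k := k) (R := Q.inChart φ')
    (t₀ := Function.update b k (y b)) one_ne_zero hC0
  rw [hpow, hid] at hres
  refine hbX ?_
  rw [← hb3]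
  refine holExtAt_inChart_of_holExtAt_inChart hb2 hb1 ?_
  rw [hb4]
  refine hres ?_ fun i j => ?_
  · refine nhds_le_map_of_isInvertible hC hCi ?_
    rw [mem_map]
    filter_upwards [hyX, hWo.mem_nhds hbW, e.open_source.mem_nhds hbe] with w hw hwW hwe hwk
    obtain ⟨h1, h2, h3, h4⟩ := hlift w hwW hwe
    change HolExtAt (Q.inChart φ') (Function.update w k (y w))
    rw [← h4]
    refine holExtAt_inChart_of_holExtAt_inChart h1 h2 ?_
    rw [h3]
    by_contra hcon
    exact hwk ((Function.update_self k (y w) w).trans (hw hcon))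
  · have h1 := hQ S i j
    rw [hS, max_eq_left zero_le_one] at h1
    have h2 := exists_hasOrderAlong_of_zero_le_residuum h1
    have h3 : S.chart.toHomeo S.point = Function.update b k (y b) := hb4
    rw [h3] at h2
    exact h2

/-- The pullbacks to `V` of the coordinate representations of `Q` agree as meromorphic fields. -/
theorem merEqAt_pullback_pullback {φ ψ : Chart G Ω} {v : V} (hφ : proj G v ∈ φ.toHomeo.source)
    (hψ : proj G v ∈ ψ.toHomeo.source) :
    MerEqAt (pullbackField (chartMap φ) (Q.inChart φ)) (pullbackField (chartMap ψ) (Q.inChart ψ))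
      v := by
  have h1 : MerEqAt (pullbackField (chartMap φ) (Q.inChart φ)) (pullbackField (chartMap φ)
      (pullbackField (chartChange φ ψ) (Q.inChart ψ))) v :=
    MerEqAt.pullbackField (f := chartMap φ) (Q.transform φ ψ _ ⟨hφ, hψ⟩)
      (analyticAt_chartMap φ hφ) (nhds_le_map_chartMap φ hφ)
  obtain ⟨h, hh, hfree⟩ := exists_nonzeroGerm_isFree G
  refine h1.trans (MerEqAt.of_germ (hh v) ?_)
  filter_upwards [eventually_proj_mem hφ, eventually_proj_mem hψ] with x hx1 hx2 hx
  rw [← pullbackField_comp (analyticAt_chartMap φ hx1).differentiableAt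
    (analyticAt_chartChange φ ψ hx1 hx2).differentiableAt
    (isInvertible_fderiv_chartMap φ hx1 (hfree x hx))]
  exact ((pullbackField_congr (eventually_chartMap_eq φ ψ hx1) _).self_of_nhds).symm

/-- The pullback of a meromorphic tensor field with nonnegative divisor is holomorphic on
`π⁻¹(Z_1)`. -/
theorem holExtAt_pullback (hΩ : Ω ⊆ strataUpTo G 1)
    (hQ : 0 ≤ Q.divD (reflectionDivisor G Ω)) (φ : Chart G Ω) {v : V}
    (hv : proj G v ∈ φ.toHomeo.source) :
    HolExtAt (pullbackField (chartMap φ) (Q.inChart φ)) v := by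
  by_cases hf : IsFree G v
  · exact (holExtAt_inChart_of_isFree hΩ hQ φ hv hf).pullbackField (analyticAt_chartMap φ hv)
      (isInvertible_fderiv_chartMap φ hv hf)
  have hv1 : proj G v ∈ strataUpTo G 1 := hΩ (φ.source_subset hv)
  have hn := finrank_isotropyFixedSpace_add_one hv1 hf
  let k : Fin (Module.finrank ℂ V) := ⟨0, by omega⟩
  obtain ⟨ψ, θ, hψ, hθ, hψθ⟩ := exists_reflectionChart hv1 hf k
    ((eventually_proj_mem hv).mono fun x hx => φ.source_subset hx)
  have he := isotropyOrder_ne_zero (G := G) v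
  have hθv : θ v k = 0 := (hθ v).2 (mem_isotropyFixedSpace_self v)
  have hψv : chartMap ψ v = powCoord k (isotropyOrder G v) (θ v) := hψθ.self_of_nhds
  let S : HypersurfaceGerm G Ω := ⟨ψ, k, proj G v, hψ, by
    change chartMap ψ v k = 0
    rw [hψv, powCoord_self, hθv, zero_pow he]⟩
  have hS : reflectionDivisor G Ω S = isotropyOrder G v := by
    refine reflectionDivisor_eq_isotropyOrder hΩ rfl hf (isOpenMap_proj.nhds_le v ?_)
    rw [mem_map]
    filter_upwards [hψθ] with x hx hx0
    refine ⟨x, (hθ x).1 ?_, rfl⟩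
    have h1 : chartMap ψ x k = 0 := hx0
    rw [hx, powCoord_self] at h1
    exact (pow_eq_zero_iff he).1 h1
  rw [zero_le_divD_iff] at hQ
  have hθa : ∀ x, AnalyticAt ℂ θ x := fun x => (θ : V →L[ℂ] Coord V).analyticAt x
  have hθf : ∀ x, (fderiv ℂ (fun x => θ x) x).IsInvertible := fun x => by
    have h1 : fderiv ℂ (fun x => θ x) x = (θ : V →L[ℂ] Coord V) :=
      ContinuousLinearMap.fderiv (θ : V →L[ℂ] Coord V)
    rw [h1]
    exact ContinuousLinearMap.isInvertible_equiv
  have hR : HolExtAt (pullbackField (powCoord k (isotropyOrder G v)) (Q.inChart ψ)) (θ v) := by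
    refine holExtAt_pullback_powCoord he hθv ?_ fun i j => ?_
    · refine nhds_le_map_of_isInvertible (hθa v) (hθf v) ?_
      rw [mem_map]
      filter_upwards [eventually_mem_of_not_isFree hv1, hψθ, eventually_proj_mem hψ]
        with x hx hxθ hxs hxk
      have hxf : IsFree G x := by
        by_contra hcon
        exact hxk ((hθ x).2 (hx hcon))
      refine HolExtAt.pullbackField ?_ (analyticAt_powCoord _ _ _)
        (isInvertible_fderiv_powCoord he hxk)
      rw [← hxθ]
      exact holExtAt_inChart_of_isFree hΩ (by rwa [zero_le_divD_iff]) ψ hxs hxf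
    · have h1 := hQ S i j
      rw [hS, max_eq_right (Nat.one_le_iff_ne_zero.2 he)] at h1
      have h2 := exists_hasOrderAlong_of_zero_le_residuum h1
      have h3 : S.chart.toHomeo S.point = powCoord k (isotropyOrder G v) (θ v) := hψv
      rw [h3] at h2
      exact h2
  refine (hR.pullbackField (hθa v) (hθf v)).congr ((merEqAt_pullback_pullback hv hψ).trans
    (MerEqAt.of_eventuallyEq ((pullbackField_congr hψθ _).trans ?_)))
  exact Eventually.of_forall fun x => pullbackField_comp (hθa x).differentiableAt
    (analyticAt_powCoord _ _ _).differentiableAt (hθf x) _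

end Extension

/-! ### Extension over the strata of codimension at least two -/

section Codimension

variable {V : Type*} [NormedAddCommGroup V] [NormedSpace ℂ V] [FiniteDimensional ℂ V]
  {G : Subgroup (LinearMap.GeneralLinearGroup ℂ V)} [Finite G]

/-- Generic lines with direction `u` do not meet the strata of codimension at least two, since these
are contained in finitely many linear subspaces of codimension at least two. -/
theorem exists_nonzeroGerm_line_mem_strataUpTo (G : Subgroup (LinearMap.GeneralLinearGroup ℂ V))
    [Finite G] (u : V) : ∃ h : V → ℂ, (∀ a, NonzeroGerm h a) ∧
      ∀ w, h w ≠ 0 → ∀ z : ℂ, proj G (w + z • u) ∈ strataUpTo G 1 := by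
  have hfin : Fintype (Set G) := Fintype.ofFinite _
  have hK : ∀ K : Set G, ∃ h : V → ℂ, (∀ a, NonzeroGerm h a) ∧ ∀ (w : V) (z : ℂ),
      {g : G | (g : LinearMap.GeneralLinearGroup ℂ V) • (w + z • u) = w + z • u} = K →
        proj G (w + z • u) ∉ strataUpTo G 1 → h w = 0 := by
    intro K
    by_cases hex : ∃ x : V, {g : G | (g : LinearMap.GeneralLinearGroup ℂ V) • x = x} = K ∧
      proj G x ∉ strataUpTo G 1
    · obtain ⟨x, rfl, hx⟩ := hex
      rw [mem_strataUpTo_iff, not_le] at hx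
      have hlt : isotropyFixedSpace G x ⊔ Submodule.span ℂ {u} < ⊤ := by
        refine lt_top_iff_ne_top.2 fun h => ?_
        have h1 := Submodule.finrank_add_le_finrank_add_finrank (isotropyFixedSpace G x)
          (Submodule.span ℂ {u})
        have h2 := finrank_span_le_card (R := ℂ) ({u} : Set V)
        rw [h, finrank_top] at h1
        simp only [Set.toFinset_singleton, Finset.card_singleton] at h2
        omega
      obtain ⟨ℓ, hℓ, hker⟩ := Submodule.exists_le_ker_of_lt_top _ hlt
      refine ⟨fun w => LinearMap.toContinuousLinearMap ℓ w, fun a => nonzeroGerm_linear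
        (fun h => hℓ (LinearMap.toContinuousLinearMap.injective (h.trans (map_zero _).symm))) a,
        fun w z hwz _ => ?_⟩
      have h1 : w + z • u ∈ isotropyFixedSpace G x := fun g hg hgx => by
        have h2 : (⟨g, hg⟩ : G) ∈ {g : G | (g : LinearMap.GeneralLinearGroup ℂ V) • x = x} := hgx
        rw [← hwz] at h2
        exact h2
      have h2 : ℓ (w + z • u) = 0 := hker (Submodule.mem_sup_left h1)
      have h3 : ℓ u = 0 := hker (Submodule.mem_sup_right (Submodule.mem_span_singleton_self u))
      rw [map_add, map_smul, h3, smul_zero, add_zero] at h2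
      exact h2
    · exact ⟨fun _ => 1, nonzeroGerm_one, fun w z hwz hns => absurd ⟨_, hwz, hns⟩ hex⟩
  choose h hh hhK using hK
  refine ⟨fun w => ∏ K, h K w, fun a => NonzeroGerm.prod _ fun K _ => hh K a, fun w hw z => ?_⟩
  by_contra hns
  exact Finset.prod_ne_zero_iff.1 hw _ (Finset.mem_univ _) (hhK _ w z rfl hns)

/-- A function which is holomorphic off the strata of codimension at least two extends
holomorphically: the values of the extension are the averages over circles in generic lines. -/
theorem holExtAt_of_analyticAt_strata {F : Type*} [NormedAddCommGroup F] [NormedSpace ℂ F]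
    [CompleteSpace F] {f : V → F} {U : Set V} (hU : IsOpen U)
    (hf : ∀ v ∈ U, proj G v ∈ strataUpTo G 1 → AnalyticAt ℂ f v) {v : V} (hv : v ∈ U) :
    HolExtAt f v := by
  obtain ⟨k, hk, hkf⟩ := exists_nonzeroGerm_isFree G
  obtain ⟨u, hu⟩ := (hk 0).frequently.exists
  have huf := hkf u hu
  obtain ⟨r, hr, hdisc⟩ := exists_disc_radius (u := u)
    ((hU.eventually_mem hv).and (eventually_isotropy_le (G := G) v))
  obtain ⟨h, hh, hline⟩ := exists_nonzeroGerm_line_mem_strataUpTo G u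
  have hball : ∀ {z : ℂ}, ‖z‖ ≤ |r| → z ∈ Metric.ball (0 : ℂ) (2 * r) := fun {z} hz => by
    rw [mem_ball_zero_iff]
    rw [abs_of_pos hr] at hz
    linarith
  -- `u` has trivial isotropy group and `G_x ⊆ G_v` for `x` near `v`, so the points `v + z u`,
  -- `z ≠ 0`, have trivial isotropy groups
  refine holExtAt_of_discs (hh v) (u := u) (r := r) (fun z hz => ?_) ?_
  · rw [mem_sphere_zero_iff_norm] at hz
    obtain ⟨h1, h2⟩ := hdisc.self_of_nhds z (hball hz.le)
    have hz0 : z ≠ 0 := fun h0 => by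
      rw [h0, norm_zero] at hz
      exact hr.ne' (abs_eq_zero.1 hz.symm)
    refine hf _ h1 (IsFree.mem_strataUpTo (fun g hg hgz => huf g hg ?_) 1)
    have h3 := h2 g hg hgz
    rw [smul_add_gl, smul_smul_gl, h3] at hgz
    exact smul_right_injective V hz0 (add_left_cancel hgz)
  · filter_upwards [hdisc] with w hw hne z hz
    exact hf _ (hw z (hball (mem_closedBall_zero_iff.1 hz))).1 (hline w hne z)

variable {Ω : Set (OrbitSpace G)} {p q : ℕ}

/-- There are coordinates near all points of `Z_1`. -/
theorem exists_chart_at {v : V} (hv : proj G v ∈ strataUpTo G 1)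
    (hΩ : ∀ᶠ x in 𝓝 v, proj G x ∈ Ω) : ∃ φ : Chart G Ω, proj G v ∈ φ.toHomeo.source := by
  by_cases hf : IsFree G v
  · obtain ⟨φ, hφ, -⟩ := exists_chart_of_isFree hf hΩ
    exact ⟨φ, hφ⟩
  · have hn := finrank_isotropyFixedSpace_add_one hv hf
    obtain ⟨φ, -, hφ, -⟩ := exists_reflectionChart hv hf ⟨0, by omega⟩ hΩ
    exact ⟨φ, hφ⟩

/-- The holomorphic tensor field on `π⁻¹(Z_1)` glued from the pullbacks of the coordinate
representations of `Q`. -/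
def gluedPullback (Q : MeromorphicTensorField G Ω p q) (v : V) : Tensor p q V :=
  if h : ∃ φ : Chart G Ω, proj G v ∈ φ.toHomeo.source then
    holExt (pullbackField (chartMap h.choose) (Q.inChart h.choose)) v
  else 0

theorem gluedPullback_eventuallyEq {Q : MeromorphicTensorField G Ω p q}
    (hΩ : Ω ⊆ strataUpTo G 1) (hQ : 0 ≤ Q.divD (reflectionDivisor G Ω)) (φ : Chart G Ω) {v : V}
    (hv : proj G v ∈ φ.toHomeo.source) :
    gluedPullback Q =ᶠ[𝓝 v] holExt (pullbackField (chartMap φ) (Q.inChart φ)) := by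
  filter_upwards [eventually_proj_mem hv] with x hx
  have hex : ∃ φ : Chart G Ω, proj G x ∈ φ.toHomeo.source := ⟨φ, hx⟩
  rw [gluedPullback, dif_pos hex]
  have h1 := holExtAt_pullback hΩ hQ φ hx
  exact (holExt_eventuallyEq h1.analyticAt_holExt
    ((merEqAt_pullback_pullback hex.choose_spec hx).trans h1.merEqAt_holExt)).self_of_nhds

/-- The pullback of a meromorphic tensor field with nonnegative divisor extends to a holomorphic
invariant tensor field. -/
theorem exists_extension {U : Set V} (hU : IsOpen U) (hGU : ∀ g ∈ G, ∀ v ∈ U, g • v ∈ U)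
    {Q : MeromorphicTensorField G (Z1 G U) p q}
    (hQ : 0 ≤ Q.divD (reflectionDivisor G (Z1 G U))) :
    ∃ P : V → Tensor p q V, IsHolomorphicInvariant G U P ∧ ExtendsPullback P Q := by
  have hΩ : Z1 G U ⊆ strataUpTo G 1 := Set.inter_subset_left
  have hchart : ∀ v ∈ U, proj G v ∈ strataUpTo G 1 →
      ∃ φ : Chart G (Z1 G U), proj G v ∈ φ.toHomeo.source := fun v hvU hv =>
    exists_chart_at hv (((eventually_mem_strataUpTo hv).and (hU.eventually_mem hvU)).mono
      fun x hx => ⟨hx.1, x, hx.2, rfl⟩)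
  have hglue : ∀ (φ : Chart G (Z1 G U)) (v : V), proj G v ∈ φ.toHomeo.source →
      AnalyticAt ℂ (gluedPullback Q) v ∧
        MerEqAt (gluedPullback Q) (pullbackField (chartMap φ) (Q.inChart φ)) v := fun φ v hv => by
    have h1 := gluedPullback_eventuallyEq hΩ hQ φ hv
    have h2 := holExtAt_pullback hΩ hQ φ hv
    exact ⟨h2.analyticAt_holExt.congr h1.symm,
      (MerEqAt.of_eventuallyEq h1).trans h2.merEqAt_holExt.symm⟩
  have hext : ∀ v ∈ U, HolExtAt (gluedPullback Q) v := fun v hv =>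
    holExtAt_of_analyticAt_strata (G := G) hU (fun x hx hxs => by
      obtain ⟨φ, hφ⟩ := hchart x hx hxs
      exact (hglue φ x hφ).1) hv
  have hPa : AnalyticOnNhd ℂ (holExt (gluedPullback Q)) U := fun v hv =>
    (hext v hv).analyticAt_holExt
  have hPQ : ∀ (φ : Chart G (Z1 G U)) (v : V), proj G v ∈ φ.toHomeo.source →
      MerEqAt (holExt (gluedPullback Q)) (pullbackField (chartMap φ) (Q.inChart φ)) v :=
    fun φ v hv => ((hext v (proj_preimage_image hGU
      (φ.source_subset hv).2)).merEqAt_holExt.symm).trans (hglue φ v hv).2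
  refine ⟨holExt (gluedPullback Q), ⟨hPa, fun g hg v hv => ?_⟩, hPQ⟩
  have hga : ∀ x ∈ U, AnalyticAt ℂ (pullbackField (fun x : V => g • x)
      (holExt (gluedPullback Q))) x := fun x hx =>
    analyticAt_pullbackField (hPa _ (hGU g hg x hx)) (analyticAt_smul g x)
      (isInvertible_fderiv_smul g x)
  obtain ⟨k, hk, hkf⟩ := exists_nonzeroGerm_isFree G
  refine (MerEqAt.eventuallyEq_of_analyticAt (MerEqAt.of_germ (hk v) ?_) (hga v hv)
    (hPa v hv)).self_of_nhds
  -- at points of `Z_0` both sides extend the pullback of `Q`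
  filter_upwards [hU.eventually_mem hv] with x hx hxk
  obtain ⟨φ, hφ⟩ := hchart x hx ((hkf x hxk).mem_strataUpTo 1)
  have hφg : proj G (g • x) ∈ φ.toHomeo.source := by rwa [proj_smul hg]
  have h1 := MerEqAt.pullbackField (f := fun x : V => g • x) (hPQ φ (g • x) hφg)
    (analyticAt_smul g x)
    (nhds_le_map_of_isInvertible (analyticAt_smul g x) (isInvertible_fderiv_smul g x))
  have h2 : pullbackField (fun x : V => g • x) (pullbackField (chartMap φ) (Q.inChart φ))
      =ᶠ[𝓝 x] pullbackField (chartMap φ) (Q.inChart φ) := by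
    filter_upwards [eventually_proj_mem hφ] with y hy
    rw [← pullbackField_comp (analyticAt_smul g y).differentiableAt
      (analyticAt_chartMap φ (by rwa [proj_smul hg])).differentiableAt
      (isInvertible_fderiv_smul g y)]
    rw [show (fun x : V => chartMap φ (g • x)) = chartMap φ from
      funext fun x => chartMap_smul φ hg x]
  exact (MerEqAt.eventuallyEq_of_analyticAt ((h1.trans (MerEqAt.of_eventuallyEq h2)).trans
    (hPQ φ x hφ).symm) (hga x hx) (hPa x hx)).self_of_nhds

end Codimension

end OrbitTensor

end

theorem theorem3p7 {V : Type*} [NormedAddCommGroup V] [NormedSpace ℂ V] [FiniteDimensional ℂ V]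
    (G : Subgroup (LinearMap.GeneralLinearGroup ℂ V)) [Finite G] (p q : ℕ)
    (U : Set V) (hU : IsOpen U) (hGU : ∀ g ∈ G, ∀ v ∈ U, g • v ∈ U) :
    (∀ P : V → Tensor p q V, IsHolomorphicInvariant G U P →
      ∃ Q : MeromorphicTensorField G (Z1 G U) p q,
        Q.inChart = pushforward (Z1 G U) P ∧ ExtendsPullback P Q ∧
          0 ≤ Q.divD (reflectionDivisor G (Z1 G U))) ∧
    (∀ Q : MeromorphicTensorField G (Z1 G U) p q,
      (∃ P : V → Tensor p q V, IsHolomorphicInvariant G U P ∧ ExtendsPullback P Q) ↔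
        0 ≤ Q.divD (reflectionDivisor G (Z1 G U))) := by
  refine ⟨fun P hP => ⟨pushforwardField hGU hP, rfl, extendsPullback_pushforwardField hGU hP,
    zero_le_divD_of_extendsPullback hGU hP.1 (extendsPullback_pushforwardField hGU hP)⟩,
    fun Q => ⟨?_, exists_extension hU hGU⟩⟩
  rintro ⟨P, hP, hPQ⟩
  exact zero_le_divD_of_extendsPullback hGU hP.1 hPQ
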